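/- Theorem. Let $\pi:E\to M$ be a smooth real vector bundle of finite rank over a finite-dimensional smooth (Hausdorff, boundaryless) manifold, let $\Omega\subseteq E$ be open (for a connection smooth on the whole bundle, $\Omega=E$), and let a smooth, generally nonlinear, connection be given on $\Omega$: a horizontal lifting $\xi^{H}_p:T_{\pi(p)}M\to T_pE$ ($p\in\Omega$), linear in the tangent vector, smooth, and with $T\pi\circ\xi^H_p=\mathrm{id}$. Notation. Sections of $\pi^*E$ are regarded as maps $\sigma$ into $E$ with $\pi\circ\sigma=\pi$. The vertical lift is $\xi^{V}(p,b)=\frac{d}{ds}(p+sb)|_{s=0}$ for $p,b$ in one fibre, and $\sigma^V=\xi^V\circ\sigma$. The connector $\kappa$ is defined by $\xi^V(p,\kappa(w))=w-\xi^H_p(T\pi(w))$ for $w\in T_pE$, $p\in\Omega$; on vertical vectors, at any point of $E$, $\kappa$ is the inverse of $\xi^V$. Put $P_H=\xi^H\circ T\pi$, $P_V=\xi^V\circ\kappa$. For a vector field $X$ on $M$, $X^H_p=\xi^H_p(X_{\pi(p)})$. The linearization of the connection is $$D_U\sigma=\kappa\bigl([P_H(U),\sigma^V]\bigr)+\kappa\bigl(T\sigma(P_V(U))\bigr)$$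 for smooth vector fields $U$ on $\Omega$ and smooth sections $\sigma$ of $\pi^*E|_\Omega$. For a covariant derivative $D'$ on $\pi^*E|_\Omega$, a section $s$ of $\pi^*E$ along a curve $\gamma$ in $\Omega$ (that is, $s(t)\in E_{\pi(\gamma(t))}$) is parallel if the curve $(\gamma,s)$ in $\pi^*E\subseteq E\times E$ is horizontal, the horizontal vectors being the pairs $(U_p,T_p\sigma(U_p))$ with $(D'_U\sigma)(p)=0$. The element $s(b)$ is then a parallel transport of $s(a)$ along $\gamma$ from time $a$ to time $b$. Consider the following two rules for $D'$. (V) For every smooth curve $\gamma$ in $\Omega$ contained in a single fibre $E_m$, and every $v\in E_m$, parallel transport of $v$ along $\gamma$ exists, is unique, and equals $v$ (the standard complete parallelism of the vector space $E_m$). (H) For every smooth vector field $X$ on $M$, with $\phi_t$ the (maximal, local) flow of $X^H$ on $\Omega$, for every $(t,p)$ in the flow domain and every $v\in E_{\pi(p)}$, parallel transport of $v$ along the curve $s\mapsto\phi_s(p)$ from time $0$ to time $t$ (of either sign) exists, is unique, and equals $\psi_t(p,v)=\kappa\bigl(T\phi_t(\xi^V(p,v))\bigr)$. Then: 1. $D$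 is a covariant derivative on $\pi^*E|_\Omega$, i.e. $D_U\sigma$ is a smooth section, additive in $U$ and in $\sigma$, $C^\infty(\Omega)$-linear in $U$, and satisfies $D_U(f\sigma)=U(f)\sigma+fD_U\sigma$; 2. $D$ satisfies (V) and (H); 3. $\psi_t$ is the fibre derivative of $\phi_t$: $\xi^V(\phi_t(p),\psi_t(p,v))=T\phi_t(\xi^V(p,v))$ for every $(t,p)$ in the flow domain and $v\in E_{\pi(p)}$; 4. the rules determine $D$: every covariant derivative on $\pi^*E|_\Omega$ that satisfies (V) and (H) is equal to $D$. -/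

import Mathlib

open Bundle Set TopologicalSpace
open scoped Manifold ContDiff

noncomputable section

namespace EhresmannConnection

section Flow

/-! ### The maximal flow of a vector field on an open set -/

variable {G : Type*} [NormedAddCommGroup G] [NormedSpace ℝ G]
  {H : Type*} [TopologicalSpace H] {J : ModelWithCorners ℝ G H}
  {N : Type*} [TopologicalSpace N] [ChartedSpace H N]

/-- The domain of the maximal flow of the vector field `Y` on the open set `Ω`: the pairs `(t, p)`
such that some integral curve of `Y` lying in `Ω`, defined on an open interval containing `0`
and `t`, starts at `p` at time `0`. -/
def flowDomain (Ω : Opens N) (Y : (p : N) → TangentSpace J p) : Set (ℝ × N) :=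
  {x | ∃ γ : ℝ → N, ∃ a b : ℝ, (0 : ℝ) ∈ Ioo a b ∧ x.1 ∈ Ioo a b ∧ γ 0 = x.2 ∧
    MapsTo γ (Ioo a b) Ω ∧ IsMIntegralCurveOn γ Y (Ioo a b)}

open Classical in
/-- The maximal flow `φ_t(p)` of `Y` on `Ω`: the position at time `t` of the integral curve
starting at `p`. Outside the flow domain the value `p` is a dummy. -/
def flow (Ω : Opens N) (Y : (p : N) → TangentSpace J p) (t : ℝ) (p : N) : N :=
  if h : (t, p) ∈ flowDomain Ω Y then h.choose t else p

end Flow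

/-! Throughout, `M` is a smooth manifold modelled on `EB`, and `V` is a smooth vector bundle over `M`
with typical fibre `F`; its total space `E` is `TotalSpace F V`, and `p.proj` is `π p`. -/

variable (EB : Type*) [NormedAddCommGroup EB] [NormedSpace ℝ EB]
  {F : Type*} [NormedAddCommGroup F] [NormedSpace ℝ F]
  {M : Type*} [TopologicalSpace M] [ChartedSpace EB M]
  {V : M → Type*} [∀ x, AddCommGroup (V x)] [∀ x, Module ℝ (V x)] [∀ x, TopologicalSpace (V x)]
  [TopologicalSpace (TotalSpace F V)] [FiberBundle F V]

/-- The tangent space `T_p E` of the total space. -/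
abbrev TE (p : TotalSpace F V) : Type _ := TangentSpace (𝓘(ℝ, EB).prod 𝓘(ℝ, F)) p

/-- The tangent map `T_p π : T_p E → T_{π p} M`. -/
def tproj (p : TotalSpace F V) : TE EB p →L[ℝ] TangentSpace 𝓘(ℝ, EB) p.proj :=
  mfderiv (𝓘(ℝ, EB).prod 𝓘(ℝ, F)) 𝓘(ℝ, EB) (π F V) p

/-- The vertical lift `ξ^V(p, b) = d/ds (p + s b)` at `s = 0`, for `b` in the fibre through `p`. -/
def verticalLift (p : TotalSpace F V) (b : V p.proj) : TE EB p :=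
  mfderiv 𝓘(ℝ, ℝ) (𝓘(ℝ, EB).prod 𝓘(ℝ, F))
    (fun s : ℝ ↦ (⟨p.proj, p.2 + s • b⟩ : TotalSpace F V)) 0 (1 : ℝ)

/-- A section `σ` of the pullback bundle `π^*E`, regarded as a map `E → E` over `M`. -/
def asMap (σ : (p : TotalSpace F V) → V p.proj) (p : TotalSpace F V) : TotalSpace F V :=
  ⟨p.proj, σ p⟩

/-- Smoothness on `Ω` of a section of `π^*E`. -/
def SmoothSection (Ω : Opens (TotalSpace F V)) (σ : (p : TotalSpace F V) → V p.proj) : Prop :=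
  ContMDiffOn (𝓘(ℝ, EB).prod 𝓘(ℝ, F)) (𝓘(ℝ, EB).prod 𝓘(ℝ, F)) ∞ (asMap σ) Ω

/-- The projection `π : E → M` as a smooth map. -/
def projMap : ContMDiffMap (𝓘(ℝ, EB).prod 𝓘(ℝ, F)) 𝓘(ℝ, EB) (TotalSpace F V) M ∞ :=
  ⟨π F V, Bundle.contMDiff_proj V⟩

set_option linter.unusedSectionVars false in
/-- In the preferred chart at `p`, the tangent map of `π` is the first projection. -/
theorem tproj_eq (p : TotalSpace F V) (w : TE EB p) : tproj EB p w = (show EB × F from w).1 := by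
  have h : HasMFDerivAt (𝓘(ℝ, EB).prod 𝓘(ℝ, F)) 𝓘(ℝ, EB) (π F V) p
      (ContinuousLinearMap.fst ℝ EB F) := by
    have key : ∀ y ∈ (extChartAt (𝓘(ℝ, EB).prod 𝓘(ℝ, F)) p).target,
        writtenInExtChartAt (𝓘(ℝ, EB).prod 𝓘(ℝ, F)) 𝓘(ℝ, EB) p (π F V) y = y.1 := by
      intro y hy
      rw [FiberBundle.extChartAt_target] at hy
      simp only [writtenInExtChartAt, Function.comp_apply, FiberBundle.extChartAt,
        PartialEquiv.coe_trans_symm, PartialEquiv.prod_symm, PartialEquiv.prod_coe,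
        PartialEquiv.refl_symm, PartialEquiv.refl_coe, id]
      erw [(trivializationAt F V p.proj).proj_symm_apply' hy.1.2]
      exact (extChartAt 𝓘(ℝ, EB) p.proj).right_inv hy.1.1
    refine ⟨(FiberBundle.continuous_proj F V).continuousAt, ?_⟩
    refine HasFDerivWithinAt.congr_of_eventuallyEq
      (ContinuousLinearMap.fst ℝ EB F).hasFDerivWithinAt ?_ (key _ (mem_extChartAt_target p))
    filter_upwards [extChartAt_target_mem_nhdsWithin (I := 𝓘(ℝ, EB).prod 𝓘(ℝ, F)) p] with y hy
    exact key y hy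
  unfold tproj
  rw [h.mfderiv]
  rfl

variable [VectorBundle ℝ F V]

/-- In the preferred chart at `p`, the vertical lift of `b` is `(0, b)`. -/
theorem verticalLift_eq (p : TotalSpace F V) (b : V p.proj) :
    verticalLift EB p b =
      ((0 : EB), (trivializationAt F V p.proj).continuousLinearMapAt ℝ p.proj b) := by
  obtain ⟨x, a⟩ := p
  set L := (trivializationAt F V x).continuousLinearMapAt ℝ x with hL
  have hx : x ∈ (trivializationAt F V x).baseSet := mem_baseSet_trivializationAt F V x
  have key : ∀ s : ℝ, (trivializationAt F V x ⟨x, a + s • b⟩) = (x, L a + s • L b) := by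
    intro s
    refine Prod.ext (Trivialization.coe_fst' _ hx) ?_
    rw [← map_smul, ← map_add, hL, Trivialization.continuousLinearMapAt_apply,
      Trivialization.linearMapAt_apply, if_pos hx]
  have h : HasMFDerivAt 𝓘(ℝ, ℝ) (𝓘(ℝ, EB).prod 𝓘(ℝ, F))
      (fun s : ℝ ↦ (⟨x, a + s • b⟩ : TotalSpace F V)) 0
      ((0 : ℝ →L[ℝ] EB).prod ((1 : ℝ →L[ℝ] ℝ).smulRight (L b))) := by
    constructor
    · refine (FiberBundle.continuousAt_totalSpace F _).2 ⟨continuousAt_const, ?_⟩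
      simp only [key]
      fun_prop
    · have hw : writtenInExtChartAt 𝓘(ℝ, ℝ) (𝓘(ℝ, EB).prod 𝓘(ℝ, F)) 0
          (fun s : ℝ ↦ (⟨x, a + s • b⟩ : TotalSpace F V)) =
          fun s : ℝ ↦ (extChartAt 𝓘(ℝ, EB) x x, L a + s • L b) := by
        funext s
        simp only [writtenInExtChartAt, FiberBundle.extChartAt, Function.comp_apply,
          PartialEquiv.coe_trans, extChartAt_model_space_eq_id, PartialEquiv.refl_symm,
          PartialEquiv.refl_coe, id, PartialEquiv.prod_coe, Trivialization.coe_coe, key,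
          OpenPartialHomeomorph.coe_toPartialEquiv]
      rw [hw]
      refine HasFDerivAt.hasFDerivWithinAt ?_
      refine HasFDerivAt.prodMk (hasFDerivAt_const _ _) ?_
      refine HasFDerivAt.const_add _ ?_
      simpa using (hasFDerivAt_id (𝕜 := ℝ) _).smul_const (L b)
  unfold verticalLift
  rw [h.mfderiv]
  refine Prod.ext rfl ?_
  change (1 : ℝ) • L b = L b
  rw [one_smul]

theorem verticalLift_injective (p : TotalSpace F V) :
    Function.Injective (verticalLift EB p) := by
  intro b b' h
  rw [verticalLift_eq, verticalLift_eq] at h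
  have hp := mem_baseSet_trivializationAt F V p.proj
  have h2 := congrArg ((trivializationAt F V p.proj).symmL ℝ p.proj)
    (congrArg Prod.snd (show ((_, _) : EB × F) = (_, _) from h))
  simpa only [Trivialization.symmL_continuousLinearMapAt _ hp] using h2

/-- The image of the vertical lift is the kernel of `T_p π`. -/
theorem exists_verticalLift_eq_iff (p : TotalSpace F V) (w : TE EB p) :
    (∃ b, verticalLift EB p b = w) ↔ tproj EB p w = 0 := by
  have hp := mem_baseSet_trivializationAt F V p.proj
  rw [tproj_eq]
  constructor
  · rintro ⟨b, rfl⟩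
    rw [verticalLift_eq]
    rfl
  · intro h
    refine ⟨(trivializationAt F V p.proj).symmL ℝ p.proj (show EB × F from w).2, ?_⟩
    rw [verticalLift_eq, Trivialization.continuousLinearMapAt_symmL _ hp]
    exact Prod.ext h.symm rfl

variable [IsManifold 𝓘(ℝ, EB) ∞ M] [ContMDiffVectorBundle ∞ F V 𝓘(ℝ, EB)]

/-- Smoothness on `Ω` of a vector field on `E`. -/
def SmoothField (Ω : Opens (TotalSpace F V)) (U : (p : TotalSpace F V) → TE EB p) : Prop :=
  ContMDiffOn (𝓘(ℝ, EB).prod 𝓘(ℝ, F)) (𝓘(ℝ, EB).prod 𝓘(ℝ, F)).tangent ∞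
    (fun p ↦ (⟨p, U p⟩ : TangentBundle (𝓘(ℝ, EB).prod 𝓘(ℝ, F)) (TotalSpace F V))) Ω

/-- A (generally nonlinear) smooth connection on the open set `Ω ⊆ E`: a horizontal lifting
`ξ^H : π^*TM → TE`, linear in the tangent vector, splitting the projection `TE → π^*TM` and smooth,
all over `Ω` (the values of `hlift` outside `Ω` play no role). -/
structure NonlinearConnection (Ω : Opens (TotalSpace F V)) where
  hlift : (p : TotalSpace F V) → TangentSpace 𝓘(ℝ, EB) p.proj →L[ℝ] TE EB p
  tproj_hlift : ∀ p ∈ Ω, ∀ v, tproj EB p (hlift p v) = v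
  smooth_hlift : ContMDiffOn ((𝓘(ℝ, EB).prod 𝓘(ℝ, F)).prod 𝓘(ℝ, EB))
    (𝓘(ℝ, EB).prod 𝓘(ℝ, F)).tangent ∞
    (fun q : TotalSpace EB (projMap EB (F := F) (V := V) *ᵖ
        (TangentSpace 𝓘(ℝ, EB) : M → Type _)) ↦
      (⟨q.proj, hlift q.proj q.2⟩ :
        TangentBundle (𝓘(ℝ, EB).prod 𝓘(ℝ, F)) (TotalSpace F V)))
    {q | q.proj ∈ Ω}

namespace NonlinearConnection

variable {EB} {Ω : Opens (TotalSpace F V)} (C : NonlinearConnection EB Ω)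

/-- The connector `κ : TE → π^*E`: `κ(w)` is the element `b` of the fibre with
`ξ^V(p, b) = w - ξ^H(p, Tπ(w))`. -/
def connector (p : TotalSpace F V) (w : TE EB p) : V p.proj :=
  Function.invFun (verticalLift EB p) (w - C.hlift p (tproj EB p w))

/-- The defining equation of the connector, over `Ω`. -/
theorem verticalLift_connector {p : TotalSpace F V} (hp : p ∈ Ω) (w : TE EB p) :
    verticalLift EB p (C.connector p w) = w - C.hlift p (tproj EB p w) := by
  refine Function.invFun_eq ((exists_verticalLift_eq_iff EB p _).2 ?_)
  rw [map_sub, C.tproj_hlift p hp, sub_self]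

/-- On vertical vectors the connector is the inverse of the vertical lift, at every point. -/
theorem connector_verticalLift (p : TotalSpace F V) (b : V p.proj) :
    C.connector p (verticalLift EB p b) = b := by
  have h : tproj EB p (verticalLift EB p b) = 0 := (exists_verticalLift_eq_iff EB p _).1 ⟨b, rfl⟩
  unfold connector
  rw [h, map_zero, sub_zero]
  exact Function.leftInverse_invFun (verticalLift_injective EB p) b

/-- The horizontal part `P_H(U) = ξ^H(Tπ(U))`. -/
def horPart (U : (p : TotalSpace F V) → TE EB p) (p : TotalSpace F V) : TE EB p :=
  C.hlift p (tproj EB p (U p))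

/-- The vertical part `P_V(U) = ξ^V(κ(U))`. -/
def verPart (U : (p : TotalSpace F V) → TE EB p) (p : TotalSpace F V) : TE EB p :=
  verticalLift EB p (C.connector p (U p))

/-- The horizontal lift `X^H` of a vector field `X` on `M`. -/
def horizontalLift (X : (x : M) → TangentSpace 𝓘(ℝ, EB) x) (p : TotalSpace F V) : TE EB p :=
  C.hlift p (X p.proj)

/-- `κ(Tσ(w))` for a section `σ` of `π^*E` and `w` tangent to `E` at `p`; here `Tσ(w)` is tangent to
`E` at the point `σ(p)` of the fibre through `p`. -/
def connectorTangent (σ : (p : TotalSpace F V) → V p.proj) (p : TotalSpace F V) (w : TE EB p) :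
    V p.proj :=
  C.connector (asMap σ p)
    (mfderiv (𝓘(ℝ, EB).prod 𝓘(ℝ, F)) (𝓘(ℝ, EB).prod 𝓘(ℝ, F)) (asMap σ) p w)

/-- The linearization `D_U σ = κ([P_H(U), σ^V] + Tσ(P_V(U)))`. The two terms are tangent to `E` at
the points `p` and `σ(p)` of the same fibre, and `κ` is applied to each of them at its own
base point. -/
def linearization (U : (p : TotalSpace F V) → TE EB p) (σ : (p : TotalSpace F V) → V p.proj)
    (p : TotalSpace F V) : V p.proj :=
  C.connector p (VectorField.mlieBracket (𝓘(ℝ, EB).prod 𝓘(ℝ, F)) (C.horPart U)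
      (fun q ↦ verticalLift EB q (σ q)) p) +
    C.connectorTangent σ p (C.verPart U p)

/-- `ψ_t = κ ∘ Tφ_t ∘ ξ^V` at `(p, b)`, with `φ_t` the flow of `X^H` on `Ω`. -/
def psi (X : (x : M) → TangentSpace 𝓘(ℝ, EB) x) (t : ℝ) (p : TotalSpace F V) (b : V p.proj) :
    V (flow Ω (C.horizontalLift X) t p).proj :=
  C.connector (flow Ω (C.horizontalLift X) t p)
    (mfderiv (𝓘(ℝ, EB).prod 𝓘(ℝ, F)) (𝓘(ℝ, EB).prod 𝓘(ℝ, F))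
      (flow Ω (C.horizontalLift X) t) p (verticalLift EB p b))

end NonlinearConnection

/-! ### Linear connections on `π^*E` over `Ω`, and their parallel transport -/

/-- `D` is a covariant derivative on the restriction of `π^*E` to `Ω`, i.e. an operator `(U, σ) ↦ D_U σ`
on smooth vector fields and smooth sections over `Ω` (the homogeneity of `σ ↦ D_U σ` under real
scalars is the Leibniz rule for constant functions). -/
structure IsCovariantDerivative (Ω : Opens (TotalSpace F V))
    (D : ((p : TotalSpace F V) → TE EB p) → ((p : TotalSpace F V) → V p.proj) →
      (p : TotalSpace F V) → V p.proj) : Prop where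
  smooth : ∀ U σ, SmoothField EB Ω U → SmoothSection EB Ω σ → SmoothSection EB Ω (D U σ)
  add_field : ∀ U U' σ, SmoothField EB Ω U → SmoothField EB Ω U' → SmoothSection EB Ω σ →
    ∀ p ∈ Ω, D (fun q ↦ U q + U' q) σ p = D U σ p + D U' σ p
  smul_field : ∀ (f : TotalSpace F V → ℝ) U σ,
    ContMDiffOn (𝓘(ℝ, EB).prod 𝓘(ℝ, F)) 𝓘(ℝ, ℝ) ∞ f Ω → SmoothField EB Ω U →
    SmoothSection EB Ω σ → ∀ p ∈ Ω, D (fun q ↦ f q • U q) σ p = f p • D U σ p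
  add_section : ∀ U σ σ', SmoothField EB Ω U → SmoothSection EB Ω σ → SmoothSection EB Ω σ' →
    ∀ p ∈ Ω, D U (fun q ↦ σ q + σ' q) p = D U σ p + D U σ' p
  leibniz : ∀ (f : TotalSpace F V → ℝ) U σ,
    ContMDiffOn (𝓘(ℝ, EB).prod 𝓘(ℝ, F)) 𝓘(ℝ, ℝ) ∞ f Ω → SmoothField EB Ω U →
    SmoothSection EB Ω σ → ∀ p ∈ Ω, D U (fun q ↦ f q • σ q) p =
      mvfderiv (𝓘(ℝ, EB).prod 𝓘(ℝ, F)) f p (U p) • σ p + f p • D U σ p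

/-- The horizontal distribution of `D`, as a subset of `T(π^*E) ⊆ TE × TE` (recall that
`π^*E ⊆ E × E`): the tangent vectors `(U_p, T_pσ(U_p))` with `D_U σ (p) = 0`. -/
def horizontalSet (Ω : Opens (TotalSpace F V))
    (D : ((p : TotalSpace F V) → TE EB p) → ((p : TotalSpace F V) → V p.proj) →
      (p : TotalSpace F V) → V p.proj) :
    Set (TangentBundle (𝓘(ℝ, EB).prod 𝓘(ℝ, F)) (TotalSpace F V) ×
      TangentBundle (𝓘(ℝ, EB).prod 𝓘(ℝ, F)) (TotalSpace F V)) :=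
  {z | ∃ p ∈ Ω, ∃ U σ, SmoothField EB Ω U ∧ SmoothSection EB Ω σ ∧ D U σ p = 0 ∧
    z.1 = ⟨p, U p⟩ ∧
    z.2 = tangentMap (𝓘(ℝ, EB).prod 𝓘(ℝ, F)) (𝓘(ℝ, EB).prod 𝓘(ℝ, F)) (asMap σ) ⟨p, U p⟩}

/-- The section `s` of `π^*E` along the curve `γ` in `Ω` (so `s(t)` lies in the fibre of `E` through
`γ(t)`) is parallel on `I`: the curve `(γ, s)` in `π^*E` is horizontal. -/
def IsParallelAlong (Ω : Opens (TotalSpace F V))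
    (D : ((p : TotalSpace F V) → TE EB p) → ((p : TotalSpace F V) → V p.proj) →
      (p : TotalSpace F V) → V p.proj)
    (γ s : ℝ → TotalSpace F V) (I : Set ℝ) : Prop :=
  ∀ t ∈ I, ∃ (z : TE EB (γ t)) (z' : TE EB (s t)),
    HasMFDerivWithinAt 𝓘(ℝ, ℝ) (𝓘(ℝ, EB).prod 𝓘(ℝ, F)) γ I t
      ((1 : ℝ →L[ℝ] ℝ).smulRight z) ∧
    HasMFDerivWithinAt 𝓘(ℝ, ℝ) (𝓘(ℝ, EB).prod 𝓘(ℝ, F)) s I t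
      ((1 : ℝ →L[ℝ] ℝ).smulRight z') ∧
    ((⟨γ t, z⟩, ⟨s t, z'⟩) :
      TangentBundle (𝓘(ℝ, EB).prod 𝓘(ℝ, F)) (TotalSpace F V) ×
        TangentBundle (𝓘(ℝ, EB).prod 𝓘(ℝ, F)) (TotalSpace F V)) ∈ horizontalSet EB Ω D

/-- `w` is the parallel transport of `v` along `γ` from time `a` to time `b`, where `v` and `w` lie in
the fibres of `E` through `γ(a)` and `γ(b)`. -/
def IsParallelTransport (Ω : Opens (TotalSpace F V))
    (D : ((p : TotalSpace F V) → TE EB p) → ((p : TotalSpace F V) → V p.proj) →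
      (p : TotalSpace F V) → V p.proj)
    (γ : ℝ → TotalSpace F V) (a b : ℝ) (v w : TotalSpace F V) : Prop :=
  ∃ s : ℝ → TotalSpace F V, IsParallelAlong EB Ω D γ s (uIcc a b) ∧ s a = v ∧ s b = w

/-- Along every smooth curve contained in a fibre `E_m` (and in `Ω`), every `v ∈ E_m` has exactly
one parallel transport, namely `v` itself. -/
def VerticalRule (Ω : Opens (TotalSpace F V))
    (D : ((p : TotalSpace F V) → TE EB p) → ((p : TotalSpace F V) → V p.proj) →
      (p : TotalSpace F V) → V p.proj) : Prop :=
  ∀ (m : M) (γ : ℝ → TotalSpace F V) (a b : ℝ),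
    ContMDiffOn 𝓘(ℝ, ℝ) (𝓘(ℝ, EB).prod 𝓘(ℝ, F)) ∞ γ (uIcc a b) →
    (∀ t ∈ uIcc a b, γ t ∈ Ω ∧ (γ t).proj = m) →
    ∀ (v : V m) (w : TotalSpace F V),
      IsParallelTransport EB Ω D γ a b ⟨m, v⟩ w ↔ w = ⟨m, v⟩

variable {EB} in
/-- Along the curve `s ↦ φ_s(p)` from time `0` to time `t`, where `φ` is the flow of the horizontal
lift `X^H` of a vector field `X` on `M`, every `v` in the fibre of `E` through `p` has exactly one
parallel transport, namely `ψ_t(p, v)`. -/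
def HorizontalRule {Ω : Opens (TotalSpace F V)} (C : NonlinearConnection EB Ω)
    (D : ((p : TotalSpace F V) → TE EB p) → ((p : TotalSpace F V) → V p.proj) →
      (p : TotalSpace F V) → V p.proj) : Prop :=
  ∀ X : (x : M) → TangentSpace 𝓘(ℝ, EB) x,
    ContMDiff 𝓘(ℝ, EB) 𝓘(ℝ, EB).tangent ∞ (fun x ↦ (⟨x, X x⟩ : TangentBundle 𝓘(ℝ, EB) M)) →
    ∀ (t : ℝ) (p : TotalSpace F V), (t, p) ∈ flowDomain Ω (C.horizontalLift X) →
    ∀ (v : V p.proj) (w : TotalSpace F V),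
      IsParallelTransport EB Ω D (fun s ↦ flow Ω (C.horizontalLift X) s p) 0 t ⟨p.proj, v⟩ w ↔
        w = ⟨(flow Ω (C.horizontalLift X) t p).proj, C.psi X t p v⟩

end EhresmannConnection

end

set_option linter.unusedSectionVars false

/-! In a bundle chart with coordinates `(x, y)`, horizontal vectors are `(v, A(x, y) v)`. The
bracket term of the linearization contributes `dσ(U₁, A U₁) - (∂_y A · σ) U₁`, because the
derivative of `U₁` cancels under `κ`; the other term contributes `dσ(0, U₂ - A U₁)`. Hence `D_U σ =
dσ(U) - (∂_y A · σ) U₁` (`fiberTriv_linearization`). The axioms of a covariant derivative are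
immediate from this formula.

By the same formula, a section `s` along `γ` is parallel exactly when it solves the linear equation
`s' = (∂_y A(γ) · s) x'`, where `x` is the projection of `γ` (`dchart_of_mem_horizontalSet`,
`mem_horizontalSet_of_dchart`). Along a curve in a fibre `x' = 0`, so constants are parallel: this
is (V). The flow of `X^H` solves `x' = X`, `y' = A X`. It carries fibres to fibres, so its tangent
map keeps vertical vectors vertical and `ψ_t` is the fibre derivative of `φ_t`. Differentiating the
flow equation in a fibre direction gives the parallel equation again, so `ψ_t(p, v)` is parallel:
this is the existence half of (H). Uniqueness in both rules is Grönwall's inequality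
(`parallel_eq`). The variational equation for a flow on an open subset of a manifold is first
derived from Picard–Lindelöf (`exists_local_flow_hasFDerivAt`, `hasDerivAt_mfderiv_flow`).

For the converse, the difference of two covariant derivatives is tensorial in `U` and in `σ`. A
tangent vector is the sum of a vertical and a horizontal one, and these are velocities of curves to
which (V) and (H) apply. Along such curves both derivatives have the same parallel sections, so
their difference vanishes on each summand (`exists_common_horizontal`, `eq_linearization`). -/

namespace EhresmannConnection

/-! ### Local flows in a normed space: differentiability in the initial point and the variational
equation. -/

section LocalFlow

variable {G : Type*} [NormedAddCommGroup G] [NormedSpace ℝ G]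

/-- Second order Taylor estimate for a map with Lipschitz derivative on a convex set. -/
theorem norm_sub_sub_le_of_lipschitz_fderiv {f : G → G} {f' : G → G →L[ℝ] G} {S : Set G}
    {K : NNReal} (hS : Convex ℝ S) (hf : ∀ x ∈ S, HasFDerivAt f (f' x) x)
    (hf' : LipschitzOnWith K f' S) {x y : G} (hx : x ∈ S) (hy : y ∈ S) :
    ‖f y - f x - f' x (y - x)‖ ≤ K * ‖y - x‖ ^ 2 := by
  -- On this ball `f'` differs from `f' x` by at most `K * ‖y - x‖`, which is the constant for the
  -- mean value inequality.
  have hconv : Convex ℝ (S ∩ Metric.closedBall x ‖y - x‖) := hS.inter (convex_closedBall _ _)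
  have h := hconv.norm_image_sub_le_of_norm_hasFDerivWithin_le' (f := f) (f' := f') (φ := f' x)
    (C := K * ‖y - x‖) (x := x) (y := y)
    (fun z hz ↦ (hf z hz.1).hasFDerivWithinAt) (fun z hz ↦ ?_)
    ⟨hx, Metric.mem_closedBall_self (norm_nonneg _)⟩ ⟨hy, by simp [dist_eq_norm]⟩
  · calc _ ≤ _ := h
      _ = _ := by ring
  · have h1 := hf'.dist_le_mul z hz.1 x hx
    rw [dist_eq_norm] at h1
    have h2 := Metric.mem_closedBall.1 hz.2
    exact h1.trans (by gcongr)

/-- Comparison of two nearby solutions of an autonomous equation with the linearized equation. -/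
theorem norm_sub_sub_le_of_linearized {f : G → G} {f' : G → G →L[ℝ] G} {S : Set G}
    {K : NNReal} {k : ℝ} (hS : Convex ℝ S) (hf : ∀ x ∈ S, HasFDerivAt f (f' x) x)
    (hf' : LipschitzOnWith K f' S) (hk : 0 < k) (hbd : ∀ x ∈ S, ‖f' x‖ ≤ k)
    {T : ℝ} (hT : 0 ≤ T) {γ γ₁ w : ℝ → G}
    (hγ : ∀ t ∈ Icc 0 T, γ t ∈ S ∧ HasDerivAt γ (f (γ t)) t)
    (hγ₁ : ∀ t ∈ Icc 0 T, γ₁ t ∈ S ∧ HasDerivAt γ₁ (f (γ₁ t)) t)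
    (hw : ∀ t ∈ Icc 0 T, HasDerivAt w (f' (γ t) (w t)) t) (hw0 : w 0 = γ₁ 0 - γ 0) :
    ‖γ₁ T - γ T - w T‖ ≤
      K * Real.exp (k * T) ^ 2 / k * (Real.exp (k * T) - 1) * ‖γ₁ 0 - γ 0‖ ^ 2 := by
  have hlip : LipschitzOnWith ⟨k, hk.le⟩ f S :=
    hS.lipschitzOnWith_of_nnnorm_hasFDerivWithin_le (f' := f')
      (fun x hx ↦ (hf x hx).hasFDerivWithinAt) (fun x hx ↦ hbd x hx)
  have hdist : ∀ t ∈ Icc 0 T, ‖γ₁ t - γ t‖ ≤ ‖γ₁ 0 - γ 0‖ * Real.exp (k * T) := by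
    intro t ht
    have := dist_le_of_trajectories_ODE_of_mem (v := fun _ ↦ f) (s := fun _ ↦ S)
      (K := ⟨k, hk.le⟩) (f := γ₁) (g := γ) (a := 0) (b := T) (δ := ‖γ₁ 0 - γ 0‖)
      (fun _ _ ↦ hlip)
      (HasDerivAt.continuousOn fun t ht ↦ (hγ₁ t ht).2)
      (fun t ht ↦ (hγ₁ t (Ico_subset_Icc_self ht)).2.hasDerivWithinAt)
      (fun t ht ↦ (hγ₁ t (Ico_subset_Icc_self ht)).1)
      (HasDerivAt.continuousOn fun t ht ↦ (hγ t ht).2)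
      (fun t ht ↦ (hγ t (Ico_subset_Icc_self ht)).2.hasDerivWithinAt)
      (fun t ht ↦ (hγ t (Ico_subset_Icc_self ht)).1) (dist_eq_norm _ _).le t ht
    rw [dist_eq_norm, sub_zero] at this
    refine this.trans ?_
    change _ * Real.exp (k * t) ≤ _
    gcongr
    exact ht.2
  -- The error `e = γ₁ - γ - w` satisfies `e' = f'(γ) e + r` with `r` a second order Taylor
  -- remainder. By `hdist` the norm of `r` is at most `c`, and Grönwall applies with `e 0 = 0`.
  set c : ℝ := K * (‖γ₁ 0 - γ 0‖ * Real.exp (k * T)) ^ 2 with hc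
  have hd : ∀ t ∈ Icc 0 T, HasDerivAt (fun t ↦ γ₁ t - γ t - w t)
      (f (γ₁ t) - f (γ t) - f' (γ t) (w t)) t := fun t ht ↦
    ((hγ₁ t ht).2.sub (hγ t ht).2).sub (hw t ht)
  have hmain := norm_le_gronwallBound_of_norm_deriv_right_le (f := fun t ↦ γ₁ t - γ t - w t)
    (f' := fun t ↦ f (γ₁ t) - f (γ t) - f' (γ t) (w t)) (δ := 0) (K := k) (ε := c) (a := 0) (b := T)
    (HasDerivAt.continuousOn hd)
    (fun t ht ↦ (hd t (Ico_subset_Icc_self ht)).hasDerivWithinAt) (by simp [hw0]) ?_ T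
    ⟨hT, le_rfl⟩
  · refine hmain.trans (le_of_eq ?_)
    rw [gronwallBound_of_K_ne_0 hk.ne', hc]
    simp only [sub_zero, zero_mul, zero_add]
    ring
  · intro t ht
    have ht' := Ico_subset_Icc_self ht
    have h1 := norm_sub_sub_le_of_lipschitz_fderiv hS hf hf' (hγ t ht').1 (hγ₁ t ht').1
    have h2 : f (γ₁ t) - f (γ t) - f' (γ t) (w t) =
        f' (γ t) (γ₁ t - γ t - w t) + (f (γ₁ t) - f (γ t) - f' (γ t) (γ₁ t - γ t)) := by
      simp only [map_sub]; abel
    rw [h2]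
    refine (norm_add_le _ _).trans (add_le_add ?_ (h1.trans ?_))
    · exact (ContinuousLinearMap.le_opNorm _ _).trans (by gcongr; exact hbd _ (hγ t ht').1)
    · rw [hc]
      gcongr
      exact hdist t ht'

/-- A `C^1` vector field has a local flow that stays in a prescribed neighbourhood. -/
theorem exists_local_flow [CompleteSpace G] {f : G → G} {x₀ : G} (hf : ContDiffAt ℝ 1 f x₀)
    {N : Set G} (hN : N ∈ nhds x₀) :
    ∃ ε > (0 : ℝ), ∃ α : G → ℝ → G, ∀ᶠ x in nhds x₀, α x 0 = x ∧
      ∀ t, |t| < ε → α x t ∈ N ∧ HasDerivAt (α x) (f (α x t)) t := by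
  obtain ⟨ε, hε, a, r, _, _, hr, hpl⟩ := IsPicardLindelof.of_contDiffAt_one hf
  obtain ⟨α, hα, hcont⟩ := (hpl 0).exists_forall_mem_closedBall_eq_hasDerivWithinAt_continuousOn
  have h0 : α (x₀, 0) = x₀ := (hα x₀ (Metric.mem_closedBall_self hr.le)).1
  have hnh : Metric.closedBall x₀ r ×ˢ Icc (0 - ε) (0 + ε) ∈ nhds (x₀, (0 : ℝ)) :=
    prod_mem_nhds (Metric.closedBall_mem_nhds _ hr) (Icc_mem_nhds (by linarith) (by linarith))
  have hc : ContinuousAt α (x₀, 0) := hcont.continuousAt hnh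
  -- Joint continuity of the flow at `(x₀, 0)` gives one time span during which all solutions
  -- starting near `x₀` stay in `N`.
  have hev : ∀ᶠ z in nhds (x₀, (0 : ℝ)), α z ∈ N :=
    hc.eventually (by rw [h0]; exact hN)
  rw [nhds_prod_eq, Filter.eventually_prod_iff] at hev
  obtain ⟨pa, hpa, pb, hpb, hab⟩ := hev
  obtain ⟨δ, hδ, hδ'⟩ := Metric.eventually_nhds_iff.1 hpb
  refine ⟨min δ ε, lt_min hδ hε, fun x t ↦ α (x, t), ?_⟩
  filter_upwards [hpa, Metric.closedBall_mem_nhds x₀ hr] with x hx hx'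
  refine ⟨(hα x hx').1, fun t ht ↦ ⟨hab hx (hδ' ?_), ?_⟩⟩
  · rw [Real.dist_eq, sub_zero]
    exact ht.trans_le (min_le_left _ _)
  · have ht' := abs_lt.1 (ht.trans_le (min_le_right _ _))
    exact ((hα x hx').2 t ⟨by linarith, by linarith⟩).hasDerivAt
      (Icc_mem_nhds (by linarith) (by linarith))

/-- The local flow of a `C^2` vector field is differentiable in the initial point, and the
derivative solves the linearized equation. -/
theorem exists_local_flow_hasFDerivAt [CompleteSpace G] {f : G → G} {x₀ : G}
    (hf : ContDiffAt ℝ 2 f x₀) {N : Set G} (hN : N ∈ nhds x₀) :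
    ∃ ε > (0 : ℝ), ∃ φ : G → ℝ → G, ∃ W : G → ℝ → (G →L[ℝ] G), ∀ᶠ x in nhds x₀,
      φ x 0 = x ∧ W x 0 = ContinuousLinearMap.id ℝ G ∧ ∀ t, |t| < ε →
        φ x t ∈ N ∧ HasDerivAt (φ x) (f (φ x t)) t ∧
        HasDerivAt (W x) ((fderiv ℝ f (φ x t)).comp (W x t)) t ∧
        HasFDerivAt (fun y ↦ φ y t) (W x t) x := by
  have hf1 : ContDiffAt ℝ 1 (fderiv ℝ f) x₀ := hf.fderiv_right (by norm_num)
  obtain ⟨K, S₀, hS₀, hlip⟩ := hf1.exists_lipschitzOnWith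
  have hdiff : ∀ᶠ x in nhds x₀, HasFDerivAt f (fderiv ℝ f x) x := by
    filter_upwards [hf.eventually (by simp)] with x hx
    exact (hx.differentiableAt (by norm_num)).hasFDerivAt
  set k : ℝ := ‖fderiv ℝ f x₀‖ + 1 with hk
  have hkpos : 0 < k := by positivity
  have hbd : ∀ᶠ x in nhds x₀, ‖fderiv ℝ f x‖ ≤ k :=
    (hf1.continuousAt.norm.eventually (gt_mem_nhds (lt_add_one _))).mono fun _ h ↦ le_of_lt h
  obtain ⟨ρ, hρ, hball⟩ := Metric.eventually_nhds_iff_ball.1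
    ((Filter.Eventually.and (show ∀ᶠ x in nhds x₀, x ∈ S₀ from hS₀) hdiff).and
      (hbd.and (show ∀ᶠ x in nhds x₀, x ∈ N from hN)))
  set S := Metric.ball x₀ ρ with hSdef
  have hSconv : Convex ℝ S := convex_ball _ _
  have hlipS : LipschitzOnWith K (fderiv ℝ f) S := hlip.mono fun x hx ↦ (hball x hx).1.1
  -- The equation is coupled with its linearization: `F` is `C^1` because `f` is `C^2`, and its
  -- solution from `(x, id)` consists of the trajectory and the candidate derivative of the flow.
  set F : G × (G →L[ℝ] G) → G × (G →L[ℝ] G) := fun z ↦ (f z.1, (fderiv ℝ f z.1).comp z.2) with hF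
  have hFsm : ContDiffAt ℝ 1 F (x₀, ContinuousLinearMap.id ℝ G) := by
    refine ContDiffAt.prodMk ?_ (ContDiffAt.clm_comp ?_ contDiffAt_snd)
    · exact (hf.of_le (by norm_num)).comp (x₀, ContinuousLinearMap.id ℝ G) contDiffAt_fst
    · exact hf1.comp (x₀, ContinuousLinearMap.id ℝ G) contDiffAt_fst
  obtain ⟨ε, hε, α, hα⟩ := exists_local_flow hFsm
    (N := S ×ˢ univ) (prod_mem_nhds (Metric.ball_mem_nhds _ hρ) Filter.univ_mem)
  have hc : ContinuousAt (fun x : G ↦ (x, ContinuousLinearMap.id ℝ G)) x₀ := by fun_prop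
  -- Differentiability at `x` compares the trajectory from `x` with those from all `y` near `x`, so
  -- the solution property is needed on a neighbourhood of `x`.
  have hα' := (hc.eventually hα).eventually_nhds
  refine ⟨ε, hε, fun x t ↦ (α (x, ContinuousLinearMap.id ℝ G) t).1,
    fun x t ↦ (α (x, ContinuousLinearMap.id ℝ G) t).2, ?_⟩
  have hfst : ∀ {x s}, HasDerivAt (α x) (F (α x s)) s →
      HasDerivAt (fun s ↦ (α x s).1) (f (α x s).1) s := fun h ↦ h.fst
  have hsnd : ∀ {x s}, HasDerivAt (α x) (F (α x s)) s → ∀ v, HasDerivAt (fun s ↦ (α x s).2 v)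
      (fderiv ℝ f (α x s).1 ((α x s).2 v)) s := fun {x s} h v ↦ by
    have h2 : HasDerivAt (fun s ↦ (α x s).2) ((fderiv ℝ f (α x s).1).comp (α x s).2) s := h.snd
    simpa using h2.clm_apply (hasDerivAt_const s v)
  filter_upwards [hα'] with x hxev
  have hx := hxev.self_of_nhds
  refine ⟨by rw [hx.1], by rw [hx.1], fun t ht ↦ ⟨(hball _ (hx.2 t ht).1.1).2.2,
    ?_, ?_, ?_⟩⟩
  · exact (hx.2 t ht).2.fst
  · exact (hx.2 t ht).2.snd
  · set C : ℝ := K * Real.exp (k * |t|) ^ 2 / k * (Real.exp (k * |t|) - 1) with hC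
    have hest : ∀ᶠ y in nhds x, ‖(α (y, ContinuousLinearMap.id ℝ G) t).1 -
        (α (x, ContinuousLinearMap.id ℝ G) t).1 -
        (α (x, ContinuousLinearMap.id ℝ G) t).2 (y - x)‖ ≤ C * ‖y - x‖ ^ 2 := by
      filter_upwards [hxev] with y hy
      rcases le_total 0 t with h0 | h0
      · have hlt : ∀ s ∈ Icc 0 t, |s| < ε := fun s hs ↦ by
          rw [abs_of_nonneg hs.1]; rw [abs_of_nonneg h0] at ht; linarith [hs.2]
        have := norm_sub_sub_le_of_linearized hSconv (fun z hz ↦ (hball z hz).1.2) hlipS hkpos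
          (fun z hz ↦ (hball z hz).2.1) h0
          (γ := fun s ↦ (α (x, ContinuousLinearMap.id ℝ G) s).1)
          (γ₁ := fun s ↦ (α (y, ContinuousLinearMap.id ℝ G) s).1)
          (w := fun s ↦ (α (x, ContinuousLinearMap.id ℝ G) s).2 (y - x))
          (fun s hs ↦ ⟨(hx.2 s (hlt s hs)).1.1, (hx.2 s (hlt s hs)).2.fst⟩)
          (fun s hs ↦ ⟨(hy.2 s (hlt s hs)).1.1, (hy.2 s (hlt s hs)).2.fst⟩)
          (fun s hs ↦ hsnd (hx.2 s (hlt s hs)).2 (y - x))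
          (by simp only [hx.1, hy.1]; rfl)
        simpa only [hx.1, hy.1, hC, abs_of_nonneg h0] using this
      -- For negative times the reversed trajectories solve the equation of `-f`, to which the
      -- forward estimate applies.
      · have hlt : ∀ s ∈ Icc 0 (-t), |-s| < ε := fun s hs ↦ by
          rw [abs_neg, abs_of_nonneg hs.1]; rw [abs_of_nonpos h0] at ht; linarith [hs.2]
        have hneg : ∀ s : ℝ, HasDerivAt (fun s : ℝ ↦ -s) (-1) s := fun s ↦ hasDerivAt_neg s
        have := norm_sub_sub_le_of_linearized (f := fun z ↦ - f z) (f' := fun z ↦ - fderiv ℝ f z)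
          hSconv (fun z hz ↦ (hball z hz).1.2.neg) hlipS.neg hkpos
          (fun z hz ↦ by rw [norm_neg]; exact (hball z hz).2.1) (neg_nonneg.2 h0)
          (γ := fun s ↦ (α (x, ContinuousLinearMap.id ℝ G) (-s)).1)
          (γ₁ := fun s ↦ (α (y, ContinuousLinearMap.id ℝ G) (-s)).1)
          (w := fun s ↦ (α (x, ContinuousLinearMap.id ℝ G) (-s)).2 (y - x))
          (fun s hs ↦ ⟨(hx.2 _ (hlt s hs)).1.1, by
            simpa [Function.comp_def] using (hfst (hx.2 _ (hlt s hs)).2).scomp s (hneg s)⟩)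
          (fun s hs ↦ ⟨(hy.2 _ (hlt s hs)).1.1, by
            simpa [Function.comp_def] using (hfst (hy.2 _ (hlt s hs)).2).scomp s (hneg s)⟩)
          (fun s hs ↦ by
            simpa [Function.comp_def] using
              (hsnd (hx.2 _ (hlt s hs)).2 (y - x)).scomp s (hneg s))
          (by simp only [neg_zero, hx.1, hy.1]; rfl)
        simpa only [neg_zero, neg_neg, hx.1, hy.1, hC, abs_of_nonpos h0] using this
    refine HasFDerivAt.of_isLittleO ?_
    have h1 : (fun y ↦ (α (y, ContinuousLinearMap.id ℝ G) t).1 -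
        (α (x, ContinuousLinearMap.id ℝ G) t).1 -
        (α (x, ContinuousLinearMap.id ℝ G) t).2 (y - x)) =O[nhds x] fun y ↦ ‖y - x‖ ^ 2 := by
      refine Asymptotics.IsBigO.of_bound C ?_
      filter_upwards [hest] with y hy
      rwa [norm_pow, norm_norm]
    refine h1.trans_isLittleO ?_
    exact (Asymptotics.isLittleO_pow_sub_sub x one_lt_two)

end LocalFlow

/-! ### Vector fields and their smoothness in a fixed extended chart. -/

section Chart

variable {G : Type*} [NormedAddCommGroup G] [NormedSpace ℝ G]
  {H : Type*} [TopologicalSpace H] (J : ModelWithCorners ℝ G H)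
  {N : Type*} [TopologicalSpace N] [ChartedSpace H N]

/-- The derivative at `q` of the extended chart centred at `x`. -/
noncomputable def dchart (x q : N) : TangentSpace J q →L[ℝ] G :=
  mfderiv J 𝓘(ℝ, G) (extChartAt J x) q

/-- The coordinate representation of a vector field in the extended chart centred at `x`. -/
noncomputable def chartField (x : N) (Y : (p : N) → TangentSpace J p) (y : G) : G :=
  dchart J x ((extChartAt J x).symm y) (Y ((extChartAt J x).symm y))

variable {J} [IsManifold J ∞ N]

theorem hasMFDerivAt_extChartAt_dchart {x q : N} (hq : q ∈ (extChartAt J x).source) :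
    HasMFDerivAt J 𝓘(ℝ, G) (extChartAt J x) q (dchart J x q) :=
  (mdifferentiableAt_extChartAt (by rwa [extChartAt_source] at hq)).hasMFDerivAt

theorem isInvertible_dchart {x q : N} (hq : q ∈ (extChartAt J x).source) :
    (dchart J x q).IsInvertible :=
  isInvertible_mfderiv_extChartAt hq

theorem dchart_injective {x q : N} (hq : q ∈ (extChartAt J x).source) :
    Function.Injective (dchart J x q) :=
  (isInvertible_dchart hq).injective

theorem dchart_inverse {x q : N} (hq : q ∈ (extChartAt J x).source) (v : G) :
    dchart J x q ((dchart J x q).inverse v) = v :=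
  (isInvertible_dchart hq).self_apply_inverse v

theorem inverse_dchart {x q : N} (hq : q ∈ (extChartAt J x).source) (w : TangentSpace J q) :
    (dchart J x q).inverse (dchart J x q w) = w :=
  (isInvertible_dchart hq).inverse_apply_self w

theorem hasMFDerivAt_extChartAt_symm [J.Boundaryless] {x : N} {y : G}
    (hy : y ∈ (extChartAt J x).target) :
    HasMFDerivAt 𝓘(ℝ, G) J (extChartAt J x).symm y
      (dchart J x ((extChartAt J x).symm y)).inverse := by
  have h1 : HasMFDerivAt 𝓘(ℝ, G) J (extChartAt J x).symm y
      (mfderiv 𝓘(ℝ, G) J (extChartAt J x).symm y) := by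
    have := mdifferentiableWithinAt_extChartAt_symm (I := J) hy
    rw [J.range_eq_univ, mdifferentiableWithinAt_univ] at this
    exact this.hasMFDerivAt
  have hs := (extChartAt J x).map_target hy
  have h2 := mfderiv_extChartAt_comp_mfderivWithin_extChartAt_symm (I := J) hy
  rw [J.range_eq_univ, mfderivWithin_univ] at h2
  have h3 : mfderiv 𝓘(ℝ, G) J (extChartAt J x).symm y =
      (dchart J x ((extChartAt J x).symm y)).inverse := by
    ext v
    exact dchart_injective hs ((DFunLike.congr_fun h2 v).trans (dchart_inverse hs v).symm)
  rwa [h3] at h1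

theorem contMDiffAt_extChartAt_symm [J.Boundaryless] {x : N} {y : G}
    (hy : y ∈ (extChartAt J x).target) :
    ContMDiffAt 𝓘(ℝ, G) J ∞ (extChartAt J x).symm y :=
  (contMDiffOn_extChartAt_symm x).contMDiffAt (extChartAt_target_mem_nhds' hy)

/-- The trivialization of the tangent bundle centred at `x` is the derivative of the chart at `x`.
Smoothness at `q` can thus be tested in any chart containing `q`, not only in the one centred there.
-/
theorem contMDiffAt_field_iff {x q : N} (hq : q ∈ (extChartAt J x).source)
    {Y : (p : N) → TangentSpace J p} :
    ContMDiffAt J J.tangent ∞ (fun p ↦ (⟨p, Y p⟩ : TangentBundle J N)) q ↔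
      ContMDiffAt J 𝓘(ℝ, G) ∞ (fun p ↦ dchart J x p (Y p)) q := by
  rw [extChartAt_source] at hq
  have := (trivializationAt G (TangentSpace J) x).contMDiffAt_section_iff (IB := J) (n := ∞)
    (s := Y) (x₀ := q) hq
  refine Iff.trans this (Filter.EventuallyEq.contMDiffAt_iff ?_)
  filter_upwards [(chartAt H x).open_source.mem_nhds hq] with p hp
  have h := TangentBundle.continuousLinearMapAt_trivializationAt (I := J) hp
  have h2 := DFunLike.congr_fun h (Y p)
  refine Eq.trans ?_ h2
  rw [Trivialization.continuousLinearMapAt_apply, Trivialization.linearMapAt_apply]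
  exact (if_pos (by exact hp)).symm

theorem contDiffAt_comp_extChartAt_symm [J.Boundaryless] {x q : N} {Z : Type*}
    [NormedAddCommGroup Z] [NormedSpace ℝ Z]
    (hq : q ∈ (extChartAt J x).source) {g : N → Z} :
    ContDiffAt ℝ ∞ (g ∘ (extChartAt J x).symm) (extChartAt J x q) ↔
      ContMDiffAt J 𝓘(ℝ, Z) ∞ g q := by
  have hy := (extChartAt J x).map_source hq
  constructor
  · intro h
    have h1 := h.contMDiffAt.comp q (contMDiffAt_extChartAt' (n := ∞) (I := J) (x := x)
      (by rwa [extChartAt_source] at hq))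
    refine h1.congr_of_eventuallyEq ?_
    filter_upwards [extChartAt_source_mem_nhds' hq] with p hp
    exact (congrArg g ((extChartAt J x).left_inv hp)).symm
  · intro h
    rw [← contMDiffAt_iff_contDiffAt]
    refine ContMDiffAt.comp _ ?_ (contMDiffAt_extChartAt_symm hy)
    rwa [(extChartAt J x).left_inv hq]

theorem contDiffAt_chartField [J.Boundaryless] {x q : N} (hq : q ∈ (extChartAt J x).source)
    {Y : (p : N) → TangentSpace J p}
    (hY : ContMDiffAt J J.tangent ∞ (fun p ↦ (⟨p, Y p⟩ : TangentBundle J N)) q) :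
    ContDiffAt ℝ ∞ (chartField J x Y) (extChartAt J x q) :=
  (contDiffAt_comp_extChartAt_symm (g := fun p ↦ dchart J x p (Y p)) hq).2
    ((contMDiffAt_field_iff hq).1 hY)

end Chart

/-! ### The maximal flow: uniqueness of integral curves and the group law. -/

section Flow

variable {G : Type*} [NormedAddCommGroup G] [NormedSpace ℝ G]
  {H : Type*} [TopologicalSpace H] {J : ModelWithCorners ℝ G H} [J.Boundaryless]
  {N : Type*} [TopologicalSpace N] [ChartedSpace H N] [IsManifold J ∞ N] [T2Space N]
  {Ω : Opens N} {Y : (p : N) → TangentSpace J p}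

/-- Uniqueness of integral curves lying in an open set on which the vector field is smooth. -/
theorem integralCurve_eqOn [CompleteSpace G]
    (hY : ContMDiffOn J J.tangent ∞ (fun p ↦ (⟨p, Y p⟩ : TangentBundle J N)) Ω)
    {γ γ' : ℝ → N} {a b t₀ : ℝ} (ht₀ : t₀ ∈ Ioo a b) (hγΩ : MapsTo γ (Ioo a b) Ω)
    (hγ : IsMIntegralCurveOn γ Y (Ioo a b)) (hγ' : IsMIntegralCurveOn γ' Y (Ioo a b))
    (h : γ t₀ = γ' t₀) : EqOn γ γ' (Ioo a b) := by
  set s := {t | γ t = γ' t} ∩ Ioo a b with hs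
  suffices hsub : Ioo a b ⊆ s from fun t ht ↦ (hsub ht).1
  -- The set of agreement is open by local uniqueness and relatively closed because `N` is
  -- Hausdorff, so it fills the interval.
  refine isPreconnected_Ioo.subset_of_closure_inter_subset (s := Ioo a b) (u := s) ?_
    ⟨t₀, ⟨ht₀, ⟨h, ht₀⟩⟩⟩ ?_
  · rw [isOpen_iff_mem_nhds]
    intro t₁ ht₁
    have hmem := Ioo_mem_nhds ht₁.2.1 ht₁.2.2
    have heq : γ =ᶠ[nhds t₁] γ' := isMIntegralCurveAt_eventuallyEq_of_contMDiffAt_boundaryless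
      ((hY.contMDiffAt (Ω.isOpen.mem_nhds (hγΩ ht₁.2))).of_le (by norm_num))
      (hγ.isMIntegralCurveAt hmem) (hγ'.isMIntegralCurveAt hmem) ht₁.1
    exact (heq.and hmem).mono fun _ ht ↦ ht
  · rintro t ⟨htc, ht⟩
    refine ⟨?_, ht⟩
    have hmem := Ioo_mem_nhds ht.1 ht.2
    have h1 := (hγ.continuousWithinAt ht).continuousAt hmem
    have h2 := (hγ'.continuousWithinAt ht).continuousAt hmem
    by_contra hne
    have := (h1.prodMk h2).eventually (isClosed_diagonal.isOpen_compl.mem_nhds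
      (show (γ t, γ' t) ∈ (diagonal N)ᶜ from hne))
    obtain ⟨u, hu, hu'⟩ := mem_closure_iff_nhds.1 htc _ this
    exact hu hu'.1

/-- The integral curve picked in the definition of `flow` is arbitrary; it agrees with any other one
on the common interval, which contains both `0` and `t`. -/
theorem flow_eq [CompleteSpace G]
    (hY : ContMDiffOn J J.tangent ∞ (fun p ↦ (⟨p, Y p⟩ : TangentBundle J N)) Ω)
    {γ : ℝ → N} {a b t : ℝ} (h0 : (0 : ℝ) ∈ Ioo a b) (hγΩ : MapsTo γ (Ioo a b) Ω)
    (hγ : IsMIntegralCurveOn γ Y (Ioo a b)) (ht : t ∈ Ioo a b) :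
    (t, γ 0) ∈ flowDomain Ω Y ∧ flow Ω Y t (γ 0) = γ t := by
  have hmem : (t, γ 0) ∈ flowDomain Ω Y := ⟨γ, a, b, h0, ht, rfl, hγΩ, hγ⟩
  refine ⟨hmem, ?_⟩
  rw [flow, dif_pos hmem]
  obtain ⟨a', b', h0', ht', hγ0, hγ'Ω, hγ'⟩ := hmem.choose_spec
  have hI : Ioo (max a a') (min b b') ⊆ Ioo a b :=
    Ioo_subset_Ioo (le_max_left _ _) (min_le_left _ _)
  have hI' : Ioo (max a a') (min b b') ⊆ Ioo a' b' :=
    Ioo_subset_Ioo (le_max_right _ _) (min_le_right _ _)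
  exact integralCurve_eqOn hY (t₀ := 0) (a := max a a') (b := min b b')
    ⟨max_lt h0.1 h0'.1, lt_min h0.2 h0'.2⟩ (hγ'Ω.mono_left hI') (hγ'.mono hI') (hγ.mono hI) hγ0
    ⟨max_lt ht.1 ht'.1, lt_min ht.2 ht'.2⟩

theorem exists_isMIntegralCurveOn_flow [CompleteSpace G]
    (hY : ContMDiffOn J J.tangent ∞ (fun p ↦ (⟨p, Y p⟩ : TangentBundle J N)) Ω)
    {p : N} {T : ℝ} (hT : (T, p) ∈ flowDomain Ω Y) :
    ∃ a b : ℝ, (0 : ℝ) ∈ Ioo a b ∧ T ∈ Ioo a b ∧ (∀ t ∈ Ioo a b, (t, p) ∈ flowDomain Ω Y) ∧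
      (∀ t ∈ Ioo a b, flow Ω Y t p ∈ Ω) ∧ flow Ω Y 0 p = p ∧
      ∀ t ∈ Ioo a b, HasMFDerivAt 𝓘(ℝ, ℝ) J (fun t ↦ flow Ω Y t p) t
        ((1 : ℝ →L[ℝ] ℝ).smulRight (Y (flow Ω Y t p))) := by
  obtain ⟨γ, a, b, h0, hT', rfl, hγΩ, hγ⟩ := hT
  have h := fun t ht ↦ flow_eq (t := t) hY h0 hγΩ hγ ht
  refine ⟨a, b, h0, hT', fun t ht ↦ (h t ht).1, fun t ht ↦ ?_, (h 0 h0).2, fun t ht ↦ ?_⟩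
  · rw [(h t ht).2]; exact hγΩ ht
  · have hmem := Ioo_mem_nhds ht.1 ht.2
    have h1 := (hγ t ht).hasMFDerivAt hmem
    have h2 : (fun t ↦ flow Ω Y t (γ 0)) =ᶠ[nhds t] γ := by
      filter_upwards [hmem] with s hs using (h s hs).2
    rw [(h t ht).2]
    exact h1.congr_of_eventuallyEq h2

theorem flow_mem [CompleteSpace G]
    (hY : ContMDiffOn J J.tangent ∞ (fun p ↦ (⟨p, Y p⟩ : TangentBundle J N)) Ω)
    {p : N} {t : ℝ} (h : (t, p) ∈ flowDomain Ω Y) : flow Ω Y t p ∈ Ω := by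
  obtain ⟨a, b, _, ht, _, hΩ, _⟩ := exists_isMIntegralCurveOn_flow hY h
  exact hΩ t ht

/-- The flow property. -/
theorem flow_add [CompleteSpace G]
    (hY : ContMDiffOn J J.tangent ∞ (fun p ↦ (⟨p, Y p⟩ : TangentBundle J N)) Ω)
    {p : N} {s r : ℝ} (hs : (s, p) ∈ flowDomain Ω Y) (hr : (r, flow Ω Y s p) ∈ flowDomain Ω Y) :
    (s + r, p) ∈ flowDomain Ω Y ∧ flow Ω Y (s + r) p = flow Ω Y r (flow Ω Y s p) := by
  obtain ⟨a, b, h0, hsab, -, hΩ, hz, hd⟩ := exists_isMIntegralCurveOn_flow hY hs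
  obtain ⟨c, d, h0', hrcd, -, hΩ', hz', hd'⟩ := exists_isMIntegralCurveOn_flow hY hr
  set γ₁ : ℝ → N := fun t ↦ flow Ω Y t p with hγ₁
  set γ₂ : ℝ → N := fun t ↦ flow Ω Y (t - s) (γ₁ s) with hγ₂
  have hd2 : ∀ t ∈ Ioo (s + c) (s + d), HasMFDerivAt 𝓘(ℝ, ℝ) J γ₂ t
      ((1 : ℝ →L[ℝ] ℝ).smulRight (Y (γ₂ t))) := by
    have := IsMIntegralCurveOn.comp_add (γ := fun t ↦ flow Ω Y t (γ₁ s)) (v := Y) (s := Ioo c d)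
      (fun t ht ↦ (hd' t ht).hasMFDerivWithinAt) (-s)
    intro t ht
    have htm : t ∈ {t | t + -s ∈ Ioo c d} := ⟨by linarith [ht.1], by linarith [ht.2]⟩
    have h := (this t htm).hasMFDerivAt
      ((isOpen_Ioo.preimage (by fun_prop : Continuous fun t : ℝ ↦ t + -s)).mem_nhds htm)
    exact h
  have hΩ2 : ∀ t ∈ Ioo (s + c) (s + d), γ₂ t ∈ Ω := fun t ht ↦
    hΩ' (t - s) ⟨by linarith [ht.1], by linarith [ht.2]⟩
  have hagree : EqOn γ₁ γ₂ (Ioo (max a (s + c)) (min b (s + d))) := by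
    have hI : Ioo (max a (s + c)) (min b (s + d)) ⊆ Ioo a b :=
      Ioo_subset_Ioo (le_max_left _ _) (min_le_left _ _)
    have hI' : Ioo (max a (s + c)) (min b (s + d)) ⊆ Ioo (s + c) (s + d) :=
      Ioo_subset_Ioo (le_max_right _ _) (min_le_right _ _)
    refine integralCurve_eqOn hY (t₀ := s)
      ⟨max_lt hsab.1 (by linarith [h0'.1]), lt_min hsab.2 (by linarith [h0'.2])⟩
      (fun t ht ↦ hΩ t (hI ht)) (fun t ht ↦ (hd t (hI ht)).hasMFDerivWithinAt)
      (fun t ht ↦ (hd2 t (hI' ht)).hasMFDerivWithinAt) ?_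
    simp only [hγ₂, sub_self]
    exact hz'.symm
  classical
  -- Two integral curves through the same point at time `s` are glued. Both intervals contain `s`,
  -- so their union is again an open interval, and uniqueness makes the curves agree on the overlap.
  set γ : ℝ → N := fun t ↦ if t ∈ Ioo a b then γ₁ t else γ₂ t with hγ
  have hγ1 : ∀ t ∈ Ioo a b, γ t = γ₁ t := fun t ht ↦ if_pos ht
  have hγ2 : ∀ t ∈ Ioo (s + c) (s + d), γ t = γ₂ t := by
    intro t ht
    by_cases h : t ∈ Ioo a b
    · rw [hγ1 t h]
      exact hagree ⟨max_lt h.1 ht.1, lt_min h.2 ht.2⟩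
    · exact if_neg h
  have hcover : ∀ t ∈ Ioo (min a (s + c)) (max b (s + d)),
      t ∈ Ioo a b ∨ t ∈ Ioo (s + c) (s + d) := by
    intro t ht
    have hc : s + c < s := by linarith [h0'.1]
    have hd : s < s + d := by linarith [h0'.2]
    rcases le_total t s with hts | hts
    · rcases min_lt_iff.1 ht.1 with h | h
      · exact Or.inl ⟨h, hts.trans_lt hsab.2⟩
      · exact Or.inr ⟨h, by linarith⟩
    · rcases lt_max_iff.1 ht.2 with h | h
      · exact Or.inl ⟨hsab.1.trans_le hts, h⟩
      · exact Or.inr ⟨by linarith, h⟩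
  have hsub1 : Ioo a b ⊆ Ioo (min a (s + c)) (max b (s + d)) :=
    Ioo_subset_Ioo (min_le_left _ _) (le_max_left _ _)
  have hsub2 : Ioo (s + c) (s + d) ⊆ Ioo (min a (s + c)) (max b (s + d)) :=
    Ioo_subset_Ioo (min_le_right _ _) (le_max_right _ _)
  have hsr : s + r ∈ Ioo (s + c) (s + d) := ⟨by linarith [hrcd.1], by linarith [hrcd.2]⟩
  have hfin := flow_eq (γ := γ) (t := s + r) hY (hsub1 h0) (fun t ht ↦ ?_) (fun t ht ↦ ?_)
    (hsub2 hsr)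
  · have h00 : γ 0 = p := (hγ1 0 h0).trans hz
    rw [h00, hγ2 _ hsr] at hfin
    refine ⟨hfin.1, hfin.2.trans ?_⟩
    simp only [hγ₂, hγ₁, add_sub_cancel_left]
  · rcases hcover t ht with h | h
    · rw [hγ1 t h]; exact hΩ t h
    · rw [hγ2 t h]; exact hΩ2 t h
  · refine HasMFDerivAt.hasMFDerivWithinAt ?_
    rcases hcover t ht with h | h
    · rw [hγ1 t h]
      refine (hd t h).congr_of_eventuallyEq ?_
      filter_upwards [Ioo_mem_nhds h.1 h.2] with u hu using hγ1 u hu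
    · rw [hγ2 t h]
      refine (hd2 t h).congr_of_eventuallyEq ?_
      filter_upwards [Ioo_mem_nhds h.1 h.2] with u hu using hγ2 u hu

end Flow

/-! ### Differentiability of the maximal flow in the initial point. -/

section FlowDerivative

variable {G : Type*} [NormedAddCommGroup G] [NormedSpace ℝ G] [CompleteSpace G]
  {H : Type*} [TopologicalSpace H] {J : ModelWithCorners ℝ G H} [J.Boundaryless]
  {N : Type*} [TopologicalSpace N] [ChartedSpace H N] [IsManifold J ∞ N] [T2Space N]
  {Ω : Opens N} {Y : (p : N) → TangentSpace J p}

/-- Near a point, the flow exists for a uniform time, is differentiable, and its derivative is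
represented in the chart by a solution of the linearized equation. -/
theorem exists_flow_local
    (hY : ContMDiffOn J J.tangent ∞ (fun p ↦ (⟨p, Y p⟩ : TangentBundle J N)) Ω)
    {p₀ : N} (hp₀ : p₀ ∈ Ω) :
    ∃ ε > (0 : ℝ), ∃ W : G → ℝ → (G →L[ℝ] G),
      (∀ᶠ q in nhds p₀, ∀ t, |t| < ε → (t, q) ∈ flowDomain Ω Y ∧
        flow Ω Y t q ∈ (extChartAt J p₀).source ∧ MDifferentiableAt J J (flow Ω Y t) q ∧
        ∀ w : TangentSpace J q, dchart J p₀ (flow Ω Y t q) (mfderiv J J (flow Ω Y t) q w) =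
          W (extChartAt J p₀ q) t (dchart J p₀ q w)) ∧
      W (extChartAt J p₀ p₀) 0 = ContinuousLinearMap.id ℝ G ∧
      HasDerivAt (W (extChartAt J p₀ p₀))
        (fderiv ℝ (chartField J p₀ Y) (extChartAt J p₀ p₀)) 0 := by
  set Ψ := extChartAt J p₀ with hΨ
  have hsrc : p₀ ∈ Ψ.source := mem_extChartAt_source p₀
  have hf : ContDiffAt ℝ 2 (chartField J p₀ Y) (Ψ p₀) :=
    (contDiffAt_chartField hsrc (hY.contMDiffAt (Ω.isOpen.mem_nhds hp₀))).of_le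
      ENat.LEInfty.out
  -- Chart solutions confined to this set are the images of integral curves lying in `Ω`.
  have hN : Ψ.target ∩ Ψ.symm ⁻¹' Ω ∈ nhds (Ψ p₀) := by
    refine Filter.inter_mem (extChartAt_target_mem_nhds p₀) ?_
    refine (continuousAt_extChartAt_symm p₀).preimage_mem_nhds ?_
    rw [extChartAt_to_inv]
    exact Ω.isOpen.mem_nhds hp₀
  obtain ⟨ε, hε, φ, W, hφ⟩ := exists_local_flow_hasFDerivAt hf hN
  have h0 := hφ.self_of_nhds
  have hcontΨ : ContinuousAt Ψ p₀ := continuousAt_extChartAt p₀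
  have hcurve : ∀ᶠ q in nhds p₀, ∀ t, |t| < ε → (t, q) ∈ flowDomain Ω Y ∧
      flow Ω Y t q = Ψ.symm (φ (Ψ q) t) := by
    filter_upwards [hcontΨ.eventually hφ, extChartAt_source_mem_nhds (I := J) p₀] with q hq hqs t ht
    have hq0 : Ψ.symm (φ (Ψ q) 0) = q := by rw [hq.1, Ψ.left_inv hqs]
    have hab : ∀ {t : ℝ}, |t| < ε ↔ t ∈ Ioo (-ε) ε := abs_lt
    have := flow_eq (γ := fun t ↦ Ψ.symm (φ (Ψ q) t)) hY (a := -ε) (b := ε)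
      ⟨by linarith, hε⟩ (fun t ht ↦ (hq.2.2 t (hab.2 ht)).1.2) (fun t ht ↦ ?_) (hab.1 ht)
    · simpa only [hq0] using this
    · obtain ⟨h1, h2, -, -⟩ := hq.2.2 t (hab.2 ht)
      have h3 := hasMFDerivAt_extChartAt_symm h1.1
      have h4 := h3.comp t h2.hasFDerivAt.hasMFDerivAt
      refine HasMFDerivAt.hasMFDerivWithinAt ?_
      refine (HasMFDerivAt.congr_mfderiv h4 ?_)
      ext
      change (dchart J p₀ (Ψ.symm (φ (Ψ q) t))).inverse ((1 : ℝ) • _) = (1 : ℝ) • _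
      rw [one_smul, one_smul]
      exact inverse_dchart (Ψ.map_target h1.1) _
  refine ⟨ε, hε, W, ?_, h0.2.1, ?_⟩
  · filter_upwards [hcontΨ.eventually hφ, extChartAt_source_mem_nhds (I := J) p₀,
      hcurve.eventually_nhds] with q hq hqs hqc t ht
    obtain ⟨h1, -, -, h2⟩ := hq.2.2 t ht
    have hc := hqc.self_of_nhds t ht
    have hm : HasMFDerivAt J J (flow Ω Y t) q
        ((dchart J p₀ (Ψ.symm (φ (Ψ q) t))).inverse.comp ((W (Ψ q) t).comp (dchart J p₀ q))) := by
      have h3 := (hasMFDerivAt_extChartAt_symm h1.1).comp q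
        (h2.hasMFDerivAt.comp q (hasMFDerivAt_extChartAt_dchart hqs))
      refine h3.congr_of_eventuallyEq ?_
      filter_upwards [hqc] with q' hq' using (hq' t ht).2
    have hs : flow Ω Y t q ∈ Ψ.source := by rw [hc.2]; exact Ψ.map_target h1.1
    refine ⟨hc.1, hs, hm.mdifferentiableAt, fun w ↦ ?_⟩
    rw [hm.mfderiv]
    -- The two points are equal only propositionally and `dchart` depends on the point, so the
    -- cancellation is stated for a variable `p'` and proved by substitution.
    have key : ∀ p', p' = Ψ.symm (φ (Ψ q) t) → p' ∈ Ψ.source → ∀ v : G,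
        dchart J p₀ p' ((dchart J p₀ (Ψ.symm (φ (Ψ q) t))).inverse v) = v := by
      rintro p' rfl h v
      exact dchart_inverse h v
    exact key _ hc.2 hs _
  · have := (h0.2.2 0 (by simpa using hε)).2.2.1
    rwa [h0.1, h0.2.1, ContinuousLinearMap.comp_id] at this

/-- Continuation of the flow by a short time. -/
theorem eventually_flow_step
    (hY : ContMDiffOn J J.tangent ∞ (fun p ↦ (⟨p, Y p⟩ : TangentBundle J N)) Ω)
    {p : N} {s r : ℝ} (hs : ∀ᶠ q in nhds p, (s, q) ∈ flowDomain Ω Y)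
    (hsd : MDifferentiableAt J J (flow Ω Y s) p)
    (hr : ∀ᶠ q in nhds (flow Ω Y s p), (r, q) ∈ flowDomain Ω Y)
    (hrd : MDifferentiableAt J J (flow Ω Y r) (flow Ω Y s p)) :
    (∀ᶠ q in nhds p, (s + r, q) ∈ flowDomain Ω Y) ∧
      HasMFDerivAt J J (flow Ω Y (s + r)) p
        ((mfderiv J J (flow Ω Y r) (flow Ω Y s p)).comp (mfderiv J J (flow Ω Y s) p)) := by
  have h := hs.and (hsd.continuousAt.eventually hr)
  refine ⟨h.mono fun q hq ↦ (flow_add hY hq.1 hq.2).1, ?_⟩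
  refine (hrd.hasMFDerivAt.comp p hsd.hasMFDerivAt).congr_of_eventuallyEq ?_
  exact h.mono fun q hq ↦ (flow_add hY hq.1 hq.2).2

/-- The flow domain is open in the initial point, and the flow is differentiable there. -/
theorem eventually_mem_flowDomain_and_mdifferentiableAt
    (hY : ContMDiffOn J J.tangent ∞ (fun p ↦ (⟨p, Y p⟩ : TangentBundle J N)) Ω)
    {p : N} {T : ℝ} (hT : (T, p) ∈ flowDomain Ω Y) :
    (∀ᶠ q in nhds p, (T, q) ∈ flowDomain Ω Y) ∧ MDifferentiableAt J J (flow Ω Y T) p := by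
  obtain ⟨a, b, h0, hTab, -, hΩ, hz, hd⟩ := exists_isMIntegralCurveOn_flow hY hT
  set P : ℝ → Prop := fun s ↦
    (∀ᶠ q in nhds p, (s, q) ∈ flowDomain Ω Y) ∧ MDifferentiableAt J J (flow Ω Y s) p with hP
  -- Times close to `s₀` differ by less than the uniform existence time at `φ_{s₀}(p)`, so a short
  -- flow leads from any of them to any other. Hence `P` is locally constant in time, which makes
  -- the set of good times both open and relatively closed.
  have hloc : ∀ s₀ ∈ Ioo a b, ∃ δ > (0 : ℝ), ∀ s s', |s - s₀| < δ → |s' - s₀| < δ → P s → P s' := by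
    intro s₀ hs₀
    obtain ⟨ε, hε, W, hW, -⟩ := exists_flow_local hY (hΩ s₀ hs₀)
    have hcont : ContinuousAt (fun t ↦ flow Ω Y t p) s₀ := (hd s₀ hs₀).continuousAt
    obtain ⟨δ, hδ, hδ'⟩ := Metric.eventually_nhds_iff.1 (hcont.eventually hW.eventually_nhds)
    refine ⟨min δ (ε / 2), lt_min hδ (by linarith), fun s s' hs hs' hPs ↦ ?_⟩
    have hev := hδ' (y := s) (by rw [Real.dist_eq]; exact hs.trans_le (min_le_left _ _))
    have hss : |s' - s| < ε := by
      have h1 := hs.trans_le (min_le_right _ _)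
      have h2 := hs'.trans_le (min_le_right _ _)
      rw [abs_lt] at *
      constructor <;> linarith [h1.1, h1.2, h2.1, h2.2]
    have := eventually_flow_step hY hPs.1 hPs.2 (r := s' - s)
      (hev.mono fun q hq ↦ (hq _ hss).1) (hev.self_of_nhds _ hss).2.2.1
    rw [add_sub_cancel] at this
    exact ⟨this.1, this.2.mdifferentiableAt⟩
  have hP0 : P 0 := by
    obtain ⟨ε, hε, W, hW, -⟩ := exists_flow_local hY (show p ∈ Ω by rw [← hz]; exact hΩ 0 h0)
    have h0ε : |(0 : ℝ)| < ε := by simpa using hε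
    exact ⟨hW.mono fun q hq ↦ (hq 0 h0ε).1, (hW.self_of_nhds 0 h0ε).2.2.1⟩
  have hsub : Ioo a b ⊆ {s | P s} ∩ Ioo a b := by
    refine isPreconnected_Ioo.subset_of_closure_inter_subset ?_ ⟨0, h0, hP0, h0⟩ ?_
    · rw [isOpen_iff_mem_nhds]
      rintro s₀ ⟨hPs, hs₀⟩
      obtain ⟨δ, hδ, h⟩ := hloc s₀ hs₀
      filter_upwards [Metric.ball_mem_nhds s₀ hδ, Ioo_mem_nhds hs₀.1 hs₀.2] with s hs hs'
      exact ⟨h s₀ s (by simpa using hδ) hs hPs, hs'⟩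
    · rintro s₀ ⟨hc, hs₀⟩
      obtain ⟨δ, hδ, h⟩ := hloc s₀ hs₀
      obtain ⟨s, hs, hs'⟩ := mem_closure_iff_nhds.1 hc _ (Metric.ball_mem_nhds s₀ hδ)
      exact ⟨h s s₀ hs (by simpa using hδ) hs'.1, hs₀⟩
  exact (hsub hTab).1

/-- The cocycle property of the derivative of the flow, for short times. -/
theorem eventually_mfderiv_flow_eq
    (hY : ContMDiffOn J J.tangent ∞ (fun p ↦ (⟨p, Y p⟩ : TangentBundle J N)) Ω)
    {p : N} {s₀ : ℝ} (hs₀ : (s₀, p) ∈ flowDomain Ω Y) :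
    ∀ᶠ r in nhds (0 : ℝ), (r, flow Ω Y s₀ p) ∈ flowDomain Ω Y ∧
      flow Ω Y (s₀ + r) p = flow Ω Y r (flow Ω Y s₀ p) ∧
      HasMFDerivAt J J (flow Ω Y (s₀ + r)) p
        ((mfderiv J J (flow Ω Y r) (flow Ω Y s₀ p)).comp (mfderiv J J (flow Ω Y s₀) p)) := by
  obtain ⟨ε, hε, W, hW, -⟩ := exists_flow_local hY (flow_mem hY hs₀)
  have h := eventually_mem_flowDomain_and_mdifferentiableAt hY hs₀
  filter_upwards [Metric.ball_mem_nhds (0 : ℝ) hε] with r hr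
  have hr' : |r| < ε := by simpa [Real.dist_eq] using hr
  have hrr := (hW.self_of_nhds r hr')
  exact ⟨hrr.1, (flow_add hY hs₀ hrr.1).2,
    (eventually_flow_step hY h.1 h.2 (hW.mono fun q hq ↦ (hq r hr').1) hrr.2.2.1).2⟩

/-- The variational equation at time `0`. -/
theorem hasDerivAt_mfderiv_flow
    (hY : ContMDiffOn J J.tangent ∞ (fun p ↦ (⟨p, Y p⟩ : TangentBundle J N)) Ω)
    {p : N} (hp : p ∈ Ω) (w : TangentSpace J p) :
    HasDerivAt (fun t ↦ dchart J p (flow Ω Y t p) (mfderiv J J (flow Ω Y t) p w))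
      (fderiv ℝ (chartField J p Y) (extChartAt J p p) (dchart J p p w)) 0 := by
  obtain ⟨ε, hε, W, hW, -, hd⟩ := exists_flow_local hY hp
  have h1 := hd.clm_apply (hasDerivAt_const (0 : ℝ) (dchart J p p w))
  simp only [map_zero, add_zero] at h1
  refine h1.congr_of_eventuallyEq ?_
  filter_upwards [Metric.ball_mem_nhds (0 : ℝ) hε] with t ht
  exact (hW.self_of_nhds t (by simpa [Real.dist_eq] using ht)).2.2.2 w

end FlowDerivative

/-! ### The Lie bracket of vector fields in a chart. -/

section LieBracket

variable {G : Type*} [NormedAddCommGroup G] [NormedSpace ℝ G] [CompleteSpace G]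
  {H : Type*} [TopologicalSpace H] {J : ModelWithCorners ℝ G H} [J.Boundaryless]
  {N : Type*} [TopologicalSpace N] [ChartedSpace H N] [IsManifold J ∞ N]

/-- `mpullback` uses the inverse of the derivative of the inverse chart, and `chartField` uses the
derivative of the chart itself; these two maps coincide on the chart target. -/
theorem eventually_mpullback_eq_chartField {x : N} {y : G} (hy : y ∈ (extChartAt J x).target)
    (Y : (p : N) → TangentSpace J p) :
    VectorField.mpullback 𝓘(ℝ, G) J (extChartAt J x).symm Y =ᶠ[nhds y] chartField J x Y := by
  filter_upwards [extChartAt_target_mem_nhds' hy] with z hz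
  have hs := (extChartAt J x).map_target hz
  have h := isInvertible_mfderivWithin_extChartAt_symm (I := J) hz
  rw [J.range_eq_univ, mfderivWithin_univ] at h
  refine h.injective ?_
  have h1 := h.self_apply_inverse (Y ((extChartAt J x).symm z))
  have h2 := inverse_dchart hs (Y ((extChartAt J x).symm z))
  rw [← (hasMFDerivAt_extChartAt_symm hz).mfderiv] at h2
  exact h1.trans h2.symm

/-- The Lie bracket in a chart. -/
theorem dchart_mlieBracket {x : N} {y : G} (hy : y ∈ (extChartAt J x).target)
    {A B : (p : N) → TangentSpace J p}
    (hA : ContMDiffAt J J.tangent ∞ (fun p ↦ (⟨p, A p⟩ : TangentBundle J N))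
      ((extChartAt J x).symm y))
    (hB : ContMDiffAt J J.tangent ∞ (fun p ↦ (⟨p, B p⟩ : TangentBundle J N))
      ((extChartAt J x).symm y)) :
    dchart J x ((extChartAt J x).symm y)
        (VectorField.mlieBracket J A B ((extChartAt J x).symm y)) =
      VectorField.lieBracket ℝ (chartField J x A) (chartField J x B) y := by
  have : IsManifold J (minSmoothness ℝ 2) N := by
    rw [minSmoothness_of_isRCLikeNormedField]
    exact IsManifold.of_le (n := ∞) ENat.LEInfty.out
  have h := VectorField.mpullback_mlieBracket (I := 𝓘(ℝ, G)) (I' := J) (n := ∞)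
    (f := (extChartAt J x).symm) (x₀ := y) (V := A) (W := B)
    (hA.mdifferentiableAt (by simp)) (hB.mdifferentiableAt (by simp))
    (contMDiffAt_extChartAt_symm hy)
    (by rw [minSmoothness_of_isRCLikeNormedField]; exact ENat.LEInfty.out)
  have h1 := (eventually_mpullback_eq_chartField hy (VectorField.mlieBracket J A B)).self_of_nhds
  rw [h, (eventually_mpullback_eq_chartField hy A).mlieBracket_vectorField_eq
    (eventually_mpullback_eq_chartField hy B)] at h1
  have h2 : VectorField.mlieBracketWithin 𝓘(ℝ, G) (chartField J x A) (chartField J x B) univ y =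
      VectorField.lieBracketWithin ℝ (chartField J x A) (chartField J x B) univ y :=
    congrFun VectorField.mlieBracketWithin_eq_lieBracketWithin y
  rw [VectorField.lieBracketWithin_univ] at h2
  exact h1.symm.trans h2

end LieBracket

/-! ### The total space: adapted charts, vertical lifts and sections of the pullback bundle. -/

section Bundle

variable {EB : Type*} [NormedAddCommGroup EB] [NormedSpace ℝ EB]
  {F : Type*} [NormedAddCommGroup F] [NormedSpace ℝ F]
  {M : Type*} [TopologicalSpace M] [ChartedSpace EB M]
  {V : M → Type*} [∀ x, AddCommGroup (V x)] [∀ x, Module ℝ (V x)] [∀ x, TopologicalSpace (V x)]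
  [TopologicalSpace (TotalSpace F V)] [FiberBundle F V]

/-- If the neighbourhoods of `p` and `q` always meet, the base points agree since `M` is Hausdorff.
Both points then lie in the source of one trivialization, which is injective and continuous there
with values in a Hausdorff space. -/
theorem t2Space_totalSpace [T2Space M] : T2Space (TotalSpace F V) := by
  rw [t2_iff_nhds]
  intro p q h
  have hp : Filter.Tendsto (π F V) (nhds p ⊓ nhds q) (nhds p.proj) :=
    (FiberBundle.continuous_proj F V).continuousAt.mono_left inf_le_left
  have hq : Filter.Tendsto (π F V) (nhds p ⊓ nhds q) (nhds q.proj) :=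
    (FiberBundle.continuous_proj F V).continuousAt.mono_left inf_le_right
  have hpq : p.proj = q.proj := tendsto_nhds_unique hp hq
  set e := trivializationAt F V p.proj with he
  have hps : p ∈ e.source := e.mem_source.2 (mem_baseSet_trivializationAt F V _)
  have hqs : q ∈ e.source := e.mem_source.2 (by
    rw [← hpq]; exact mem_baseSet_trivializationAt F V _)
  exact e.injOn hps hqs (tendsto_nhds_unique ((e.continuousAt hps).mono_left inf_le_left)
    ((e.continuousAt hqs).mono_left inf_le_right))

/-- Chart domains of `E` are unions of whole fibres. A single chart at `p` therefore also covers the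
values at `p` of sections of `π^*E`, whichever point of the fibre they are. -/
theorem mem_extChartAt_source_iff {p₀ p : TotalSpace F V} :
    p ∈ (extChartAt (𝓘(ℝ, EB).prod 𝓘(ℝ, F)) p₀).source ↔
      p.proj ∈ (extChartAt 𝓘(ℝ, EB) p₀.proj).source ∧
        p.proj ∈ (trivializationAt F V p₀.proj).baseSet := by
  rw [FiberBundle.extChartAt, PartialEquiv.trans_source]
  constructor
  · rintro ⟨h1, h2⟩
    have h1' : p ∈ (trivializationAt F V p₀.proj).source := h1
    have h3 : (trivializationAt F V p₀.proj p).1 ∈ (extChartAt 𝓘(ℝ, EB) p₀.proj).source := h2.1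
    rw [Trivialization.coe_fst _ h1'] at h3
    exact ⟨h3, (Trivialization.mem_source _).1 h1'⟩
  · rintro ⟨h1, h2⟩
    have h1' : p ∈ (trivializationAt F V p₀.proj).source := (Trivialization.mem_source _).2 h2
    refine ⟨h1', ?_, mem_univ _⟩
    change (trivializationAt F V p₀.proj p).1 ∈ (extChartAt 𝓘(ℝ, EB) p₀.proj).source
    rwa [Trivialization.coe_fst _ h1']

theorem extChartAt_snd (p₀ p : TotalSpace F V) :
    (extChartAt (𝓘(ℝ, EB).prod 𝓘(ℝ, F)) p₀ p).2 = (trivializationAt F V p₀.proj p).2 := by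
  rw [FiberBundle.extChartAt]
  rfl

theorem extChartAt_fst {p₀ p : TotalSpace F V}
    (hp : p ∈ (extChartAt (𝓘(ℝ, EB).prod 𝓘(ℝ, F)) p₀).source) :
    (extChartAt (𝓘(ℝ, EB).prod 𝓘(ℝ, F)) p₀ p).1 = extChartAt 𝓘(ℝ, EB) p₀.proj p.proj := by
  have h : (extChartAt (𝓘(ℝ, EB).prod 𝓘(ℝ, F)) p₀ p).1 =
      extChartAt 𝓘(ℝ, EB) p₀.proj (trivializationAt F V p₀.proj p).1 := by
    rw [FiberBundle.extChartAt]
    rfl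
  rw [h, Trivialization.coe_fst _
    ((Trivialization.mem_source _).2 (mem_extChartAt_source_iff.1 hp).2)]

variable [VectorBundle ℝ F V] [IsManifold 𝓘(ℝ, EB) ∞ M] [ContMDiffVectorBundle ∞ F V 𝓘(ℝ, EB)]

/-- The tangent map of the projection in a chart of the total space. -/
theorem dchart_fst {p₀ p : TotalSpace F V}
    (hp : p ∈ (extChartAt (𝓘(ℝ, EB).prod 𝓘(ℝ, F)) p₀).source) (w : TE EB p) :
    (dchart (𝓘(ℝ, EB).prod 𝓘(ℝ, F)) p₀ p w).1 =
      dchart 𝓘(ℝ, EB) p₀.proj p.proj (tproj EB p w) := by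
  have h1 := (ContinuousLinearMap.fst ℝ EB F).hasMFDerivAt.comp p
    (hasMFDerivAt_extChartAt_dchart hp)
  have hπ : HasMFDerivAt (𝓘(ℝ, EB).prod 𝓘(ℝ, F)) 𝓘(ℝ, EB) (π F V) p (tproj EB p) :=
    ((Bundle.contMDiff_proj V (n := ∞)).mdifferentiableAt (by simp)).hasMFDerivAt
  have h2 := (hasMFDerivAt_extChartAt_dchart (mem_extChartAt_source_iff.1 hp).1).comp p hπ
  have h3 : (extChartAt 𝓘(ℝ, EB) p₀.proj ∘ π F V) =ᶠ[nhds p]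
      (ContinuousLinearMap.fst ℝ EB F ∘ extChartAt (𝓘(ℝ, EB).prod 𝓘(ℝ, F)) p₀) := by
    filter_upwards [extChartAt_source_mem_nhds' hp] with q hq
    exact (extChartAt_fst hq).symm
  exact DFunLike.congr_fun (hasMFDerivAt_unique (h1.congr_of_eventuallyEq h3) h2) w

/-- The trivialization of a fibre near `x₀`. -/
noncomputable abbrev fiberTriv (x₀ x : M) : V x →L[ℝ] F :=
  (trivializationAt F V x₀).continuousLinearMapAt ℝ x

theorem fiberTriv_apply {x₀ x : M} (hx : x ∈ (trivializationAt F V x₀).baseSet) (b : V x) :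
    fiberTriv x₀ x b = (trivializationAt F V x₀ ⟨x, b⟩).2 := by
  rw [Trivialization.continuousLinearMapAt_apply, Trivialization.linearMapAt_apply, if_pos hx]

theorem fiberTriv_injective {x₀ x : M} (hx : x ∈ (trivializationAt F V x₀).baseSet) :
    Function.Injective (fiberTriv (F := F) (V := V) x₀ x) :=
  Function.LeftInverse.injective (g := (trivializationAt F V x₀).symmL ℝ x) fun b ↦
    Trivialization.symmL_continuousLinearMapAt _ hx b

theorem extChartAt_mk {p₀ : TotalSpace F V} {x : M} {b : V x}
    (hp : (⟨x, b⟩ : TotalSpace F V) ∈ (extChartAt (𝓘(ℝ, EB).prod 𝓘(ℝ, F)) p₀).source) :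
    extChartAt (𝓘(ℝ, EB).prod 𝓘(ℝ, F)) p₀ ⟨x, b⟩ =
      (extChartAt 𝓘(ℝ, EB) p₀.proj x, fiberTriv p₀.proj x b) := by
  refine Prod.ext (extChartAt_fst hp) ?_
  rw [extChartAt_snd, fiberTriv_apply (mem_extChartAt_source_iff.1 hp).2]

theorem contMDiff_fiber_line (p : TotalSpace F V) (b : V p.proj) :
    ContMDiff 𝓘(ℝ, ℝ) (𝓘(ℝ, EB).prod 𝓘(ℝ, F)) ∞
      (fun s : ℝ ↦ (⟨p.proj, p.2 + s • b⟩ : TotalSpace F V)) := by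
  intro s
  rw [Bundle.contMDiffAt_totalSpace]
  refine ⟨contMDiffAt_const, ?_⟩
  have hx := mem_baseSet_trivializationAt F V p.proj
  have : (fun s : ℝ ↦ (trivializationAt F V p.proj
      (⟨p.proj, p.2 + s • b⟩ : TotalSpace F V)).2) =
      fun s : ℝ ↦ fiberTriv p.proj p.proj p.2 + s • fiberTriv p.proj p.proj b := by
    funext s
    rw [← fiberTriv_apply hx, map_add, map_smul]
  rw [this]
  exact ContDiffAt.contMDiffAt (by fun_prop)

theorem hasMFDerivAt_fiber_line (p : TotalSpace F V) (b : V p.proj) :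
    HasMFDerivAt 𝓘(ℝ, ℝ) (𝓘(ℝ, EB).prod 𝓘(ℝ, F))
      (fun s : ℝ ↦ (⟨p.proj, p.2 + s • b⟩ : TotalSpace F V)) 0
      ((1 : ℝ →L[ℝ] ℝ).smulRight (verticalLift EB p b)) := by
  refine ((contMDiff_fiber_line p b 0).mdifferentiableAt (by simp)).hasMFDerivAt.congr_mfderiv ?_
  ext
  change _ = (1 : ℝ) • verticalLift EB p b
  rw [one_smul]
  rfl

theorem dchart_verticalLift {p₀ p : TotalSpace F V}
    (hp : p ∈ (extChartAt (𝓘(ℝ, EB).prod 𝓘(ℝ, F)) p₀).source) (b : V p.proj) :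
    dchart (𝓘(ℝ, EB).prod 𝓘(ℝ, F)) p₀ p (verticalLift EB p b) =
      ((0 : EB), fiberTriv p₀.proj p.proj b) := by
  have hp' := mem_extChartAt_source_iff.1 hp
  -- The line passes through `p` at time `0` only up to a propositional equality, so the derivative
  -- of the chart is restated at the literal point before composing.
  have hp0 : (⟨p.proj, p.2 + (0 : ℝ) • b⟩ : TotalSpace F V) = p := by
    rw [zero_smul, add_zero]
  have h1 : HasMFDerivAt (𝓘(ℝ, EB).prod 𝓘(ℝ, F)) 𝓘(ℝ, EB × F)
      (extChartAt (𝓘(ℝ, EB).prod 𝓘(ℝ, F)) p₀) (⟨p.proj, p.2 + (0 : ℝ) • b⟩ : TotalSpace F V)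
      (dchart (𝓘(ℝ, EB).prod 𝓘(ℝ, F)) p₀ p) := by
    rw [hp0]
    exact hasMFDerivAt_extChartAt_dchart hp
  have h2 := h1.comp (0 : ℝ) (hasMFDerivAt_fiber_line (EB := EB) p b)
  have h3 : HasMFDerivAt 𝓘(ℝ, ℝ) 𝓘(ℝ, EB × F)
      (extChartAt (𝓘(ℝ, EB).prod 𝓘(ℝ, F)) p₀ ∘
        fun s : ℝ ↦ (⟨p.proj, p.2 + s • b⟩ : TotalSpace F V)) 0
      ((1 : ℝ →L[ℝ] ℝ).smulRight ((0 : EB), fiberTriv p₀.proj p.proj b)) := by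
    have : (extChartAt (𝓘(ℝ, EB).prod 𝓘(ℝ, F)) p₀ ∘
        fun s : ℝ ↦ (⟨p.proj, p.2 + s • b⟩ : TotalSpace F V)) = fun s : ℝ ↦
        (extChartAt 𝓘(ℝ, EB) p₀.proj p.proj,
          fiberTriv p₀.proj p.proj p.2 + s • fiberTriv p₀.proj p.proj b) := by
      funext s
      rw [Function.comp_apply, extChartAt_mk (b := p.2 + s • b) (mem_extChartAt_source_iff.2 hp'),
        map_add, map_smul]
    rw [this]
    have h4 : HasDerivAt (fun s : ℝ ↦ fiberTriv p₀.proj p.proj p.2 + s • fiberTriv p₀.proj p.proj b)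
        (fiberTriv (F := F) p₀.proj p.proj b) 0 := by
      simpa using ((hasDerivAt_id (0 : ℝ)).smul_const (fiberTriv p₀.proj p.proj b)).const_add
        (fiberTriv p₀.proj p.proj p.2)
    have h5 : HasDerivAt (fun s : ℝ ↦ (extChartAt 𝓘(ℝ, EB) p₀.proj p.proj,
        fiberTriv p₀.proj p.proj p.2 + s • fiberTriv p₀.proj p.proj b))
        ((0 : EB), fiberTriv (F := F) p₀.proj p.proj b) 0 := (hasDerivAt_const _ _).prodMk h4
    refine h5.hasFDerivAt.hasMFDerivAt.congr_mfderiv ?_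
    ext
    · rfl
    · rfl
  have h4 := DFunLike.congr_fun (hasMFDerivAt_unique h2 h3) (1 : ℝ)
  have h5 : dchart (𝓘(ℝ, EB).prod 𝓘(ℝ, F)) p₀ p ((1 : ℝ) • verticalLift EB p b) =
    (1 : ℝ) • ((0 : EB), fiberTriv p₀.proj p.proj b) := h4
  rwa [one_smul, one_smul] at h5

/-- The coordinate representation of a section of `π^*E`. -/
noncomputable def secRep (EB : Type*) [NormedAddCommGroup EB] [NormedSpace ℝ EB]
    [ChartedSpace EB M] (p₀ : TotalSpace F V) (σ : (p : TotalSpace F V) → V p.proj) (y : EB × F) :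
    F :=
  fiberTriv p₀.proj ((extChartAt (𝓘(ℝ, EB).prod 𝓘(ℝ, F)) p₀).symm y).proj
    (σ ((extChartAt (𝓘(ℝ, EB).prod 𝓘(ℝ, F)) p₀).symm y))

theorem secRep_extChartAt {p₀ p : TotalSpace F V}
    (hp : p ∈ (extChartAt (𝓘(ℝ, EB).prod 𝓘(ℝ, F)) p₀).source)
    (σ : (p : TotalSpace F V) → V p.proj) :
    secRep EB p₀ σ (extChartAt (𝓘(ℝ, EB).prod 𝓘(ℝ, F)) p₀ p) = fiberTriv p₀.proj p.proj (σ p) := by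
  rw [secRep, (extChartAt (𝓘(ℝ, EB).prod 𝓘(ℝ, F)) p₀).left_inv hp]

/-- The base component of `asMap σ` is `π`, which is smooth, so only the fibre component has to be
tested. -/
theorem contMDiffAt_asMap_iff {p₀ p : TotalSpace F V}
    (hp : p ∈ (extChartAt (𝓘(ℝ, EB).prod 𝓘(ℝ, F)) p₀).source)
    {σ : (p : TotalSpace F V) → V p.proj} :
    ContMDiffAt (𝓘(ℝ, EB).prod 𝓘(ℝ, F)) (𝓘(ℝ, EB).prod 𝓘(ℝ, F)) ∞ (asMap σ) p ↔
      ContDiffAt ℝ ∞ (secRep EB p₀ σ) (extChartAt (𝓘(ℝ, EB).prod 𝓘(ℝ, F)) p₀ p) := by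
  have hp' := mem_extChartAt_source_iff.1 hp
  have h := (trivializationAt F V p₀.proj).contMDiffAt_iff (IM := 𝓘(ℝ, EB).prod 𝓘(ℝ, F))
    (IB := 𝓘(ℝ, EB)) (n := ∞) (f := asMap σ) (x₀ := p)
    ((Trivialization.mem_source _).2 hp'.2)
  rw [h, and_iff_right (show ContMDiffAt _ _ _ (fun q ↦ (asMap σ q).proj) p from
    Bundle.contMDiffAt_proj V)]
  have h2 := contDiffAt_comp_extChartAt_symm (J := 𝓘(ℝ, EB).prod 𝓘(ℝ, F)) hp
    (g := fun q ↦ fiberTriv (F := F) p₀.proj q.proj (σ q))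
  refine Iff.trans (Filter.EventuallyEq.contMDiffAt_iff ?_) h2.symm
  filter_upwards [extChartAt_source_mem_nhds' hp] with q hq
  exact (fiberTriv_apply (mem_extChartAt_source_iff.1 hq).2 _).symm

theorem asMap_mem_source {p₀ p : TotalSpace F V}
    (hp : p ∈ (extChartAt (𝓘(ℝ, EB).prod 𝓘(ℝ, F)) p₀).source)
    (σ : (p : TotalSpace F V) → V p.proj) :
    asMap σ p ∈ (extChartAt (𝓘(ℝ, EB).prod 𝓘(ℝ, F)) p₀).source :=
  mem_extChartAt_source_iff.2 (mem_extChartAt_source_iff.1 hp :)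

/-- The tangent map of a section of `π^*E` in a chart. -/
theorem dchart_mfderiv_asMap {p₀ p : TotalSpace F V}
    (hp : p ∈ (extChartAt (𝓘(ℝ, EB).prod 𝓘(ℝ, F)) p₀).source)
    {σ : (p : TotalSpace F V) → V p.proj}
    (hσ : ContMDiffAt (𝓘(ℝ, EB).prod 𝓘(ℝ, F)) (𝓘(ℝ, EB).prod 𝓘(ℝ, F)) ∞ (asMap σ) p)
    (w : TE EB p) :
    dchart (𝓘(ℝ, EB).prod 𝓘(ℝ, F)) p₀ (asMap σ p)
        (mfderiv (𝓘(ℝ, EB).prod 𝓘(ℝ, F)) (𝓘(ℝ, EB).prod 𝓘(ℝ, F)) (asMap σ) p w) =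
      ((dchart (𝓘(ℝ, EB).prod 𝓘(ℝ, F)) p₀ p w).1,
        fderiv ℝ (secRep EB p₀ σ) (extChartAt (𝓘(ℝ, EB).prod 𝓘(ℝ, F)) p₀ p)
          (dchart (𝓘(ℝ, EB).prod 𝓘(ℝ, F)) p₀ p w)) := by
  have h1 := (hasMFDerivAt_extChartAt_dchart (asMap_mem_source hp σ)).comp p
    (hσ.mdifferentiableAt (by simp)).hasMFDerivAt
  have hd : DifferentiableAt ℝ (secRep EB p₀ σ) (extChartAt (𝓘(ℝ, EB).prod 𝓘(ℝ, F)) p₀ p) :=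
    ((contMDiffAt_asMap_iff hp).1 hσ).differentiableAt (by simp)
  have h2 := (((ContinuousLinearMap.fst ℝ EB F).hasFDerivAt.prodMk
    hd.hasFDerivAt).hasMFDerivAt).comp p (hasMFDerivAt_extChartAt_dchart hp)
  -- In the chart the section is `(x, y) ↦ (x, σ(x, y))`.
  have h3 : (extChartAt (𝓘(ℝ, EB).prod 𝓘(ℝ, F)) p₀ ∘ asMap σ) =ᶠ[nhds p]
      ((fun y : EB × F ↦ (ContinuousLinearMap.fst ℝ EB F y, secRep EB p₀ σ y)) ∘
        extChartAt (𝓘(ℝ, EB).prod 𝓘(ℝ, F)) p₀) := by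
    filter_upwards [extChartAt_source_mem_nhds' hp] with q hq
    rw [Function.comp_apply, Function.comp_apply, secRep_extChartAt hq, asMap,
      extChartAt_mk (asMap_mem_source hq σ), ContinuousLinearMap.coe_fst', extChartAt_fst hq]
  exact DFunLike.congr_fun (hasMFDerivAt_unique h1 (h2.congr_of_eventuallyEq h3)) w

end Bundle

/-! ### The connection, the connector and the two projections in a chart. -/

section Coordinates

variable {EB : Type*} [NormedAddCommGroup EB] [NormedSpace ℝ EB]
  {F : Type*} [NormedAddCommGroup F] [NormedSpace ℝ F]
  {M : Type*} [TopologicalSpace M] [ChartedSpace EB M]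
  {V : M → Type*} [∀ x, AddCommGroup (V x)] [∀ x, Module ℝ (V x)] [∀ x, TopologicalSpace (V x)]
  [TopologicalSpace (TotalSpace F V)] [FiberBundle F V]
  [VectorBundle ℝ F V] [IsManifold 𝓘(ℝ, EB) ∞ M] [ContMDiffVectorBundle ∞ F V 𝓘(ℝ, EB)]
  {Ω : Opens (TotalSpace F V)} (C : NonlinearConnection EB Ω)

theorem tproj_eq_zero_of_dchart_fst {p₀ p : TotalSpace F V}
    (hp : p ∈ (extChartAt (𝓘(ℝ, EB).prod 𝓘(ℝ, F)) p₀).source) {w : TE EB p}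
    (hw : (dchart (𝓘(ℝ, EB).prod 𝓘(ℝ, F)) p₀ p w).1 = 0) : tproj EB p w = 0 := by
  rw [dchart_fst hp] at hw
  exact dchart_injective (mem_extChartAt_source_iff.1 hp).1 (hw.trans (map_zero _).symm)

theorem smoothField_contMDiffAt {U : (p : TotalSpace F V) → TE EB p} (hU : SmoothField EB Ω U)
    {p : TotalSpace F V} (hp : p ∈ Ω) :
    ContMDiffAt (𝓘(ℝ, EB).prod 𝓘(ℝ, F)) (𝓘(ℝ, EB).prod 𝓘(ℝ, F)).tangent ∞
      (fun p ↦ (⟨p, U p⟩ : TangentBundle (𝓘(ℝ, EB).prod 𝓘(ℝ, F)) (TotalSpace F V))) p :=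
  ContMDiffOn.contMDiffAt hU (Ω.isOpen.mem_nhds hp)

theorem smoothSection_contMDiffAt {σ : (p : TotalSpace F V) → V p.proj}
    (hσ : SmoothSection EB Ω σ) {p : TotalSpace F V} (hp : p ∈ Ω) :
    ContMDiffAt (𝓘(ℝ, EB).prod 𝓘(ℝ, F)) (𝓘(ℝ, EB).prod 𝓘(ℝ, F)) ∞ (asMap σ) p :=
  ContMDiffOn.contMDiffAt hσ (Ω.isOpen.mem_nhds hp)

namespace NonlinearConnection

/-- The coefficient `A(x, y)` of the connection in a chart: horizontal vectors are
`(v, A(x, y) v)`. -/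
noncomputable def coef (p₀ : TotalSpace F V) (y : EB × F) : EB →L[ℝ] F :=
  ((ContinuousLinearMap.snd ℝ EB F).comp (dchart (𝓘(ℝ, EB).prod 𝓘(ℝ, F)) p₀
    ((extChartAt (𝓘(ℝ, EB).prod 𝓘(ℝ, F)) p₀).symm y))).comp
      ((C.hlift ((extChartAt (𝓘(ℝ, EB).prod 𝓘(ℝ, F)) p₀).symm y)).comp
        (dchart 𝓘(ℝ, EB) p₀.proj
          ((extChartAt (𝓘(ℝ, EB).prod 𝓘(ℝ, F)) p₀).symm y).proj).inverse)

theorem coef_extChartAt {p₀ p : TotalSpace F V}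
    (hp : p ∈ (extChartAt (𝓘(ℝ, EB).prod 𝓘(ℝ, F)) p₀).source) (v : EB) :
    C.coef p₀ (extChartAt (𝓘(ℝ, EB).prod 𝓘(ℝ, F)) p₀ p) v =
      (dchart (𝓘(ℝ, EB).prod 𝓘(ℝ, F)) p₀ p
        (C.hlift p ((dchart 𝓘(ℝ, EB) p₀.proj p.proj).inverse v))).2 := by
  rw [coef, (extChartAt (𝓘(ℝ, EB).prod 𝓘(ℝ, F)) p₀).left_inv hp]
  rfl

theorem dchart_hlift {p₀ p : TotalSpace F V}
    (hp : p ∈ (extChartAt (𝓘(ℝ, EB).prod 𝓘(ℝ, F)) p₀).source) (hpΩ : p ∈ Ω)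
    (v : TangentSpace 𝓘(ℝ, EB) p.proj) :
    dchart (𝓘(ℝ, EB).prod 𝓘(ℝ, F)) p₀ p (C.hlift p v) =
      (dchart 𝓘(ℝ, EB) p₀.proj p.proj v,
        C.coef p₀ (extChartAt (𝓘(ℝ, EB).prod 𝓘(ℝ, F)) p₀ p)
          (dchart 𝓘(ℝ, EB) p₀.proj p.proj v)) := by
  refine Prod.ext ?_ ?_
  · rw [dchart_fst hp, C.tproj_hlift p hpΩ]
  · rw [C.coef_extChartAt hp, inverse_dchart (mem_extChartAt_source_iff.1 hp).1]

theorem fiberTriv_connector {p₀ p : TotalSpace F V}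
    (hp : p ∈ (extChartAt (𝓘(ℝ, EB).prod 𝓘(ℝ, F)) p₀).source) (hpΩ : p ∈ Ω) (w : TE EB p) :
    fiberTriv p₀.proj p.proj (C.connector p w) =
      (dchart (𝓘(ℝ, EB).prod 𝓘(ℝ, F)) p₀ p w).2 -
        C.coef p₀ (extChartAt (𝓘(ℝ, EB).prod 𝓘(ℝ, F)) p₀ p)
          (dchart (𝓘(ℝ, EB).prod 𝓘(ℝ, F)) p₀ p w).1 := by
  have h1 := dchart_verticalLift hp (C.connector p w)
  rw [C.verticalLift_connector hpΩ, map_sub, C.dchart_hlift hp hpΩ, ← dchart_fst hp] at h1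
  exact (congrArg Prod.snd h1).symm

/-- On vertical vectors the connection does not enter. This covers base points outside `Ω`, where
the value of a section may well lie. -/
theorem fiberTriv_connector_of_tproj_eq_zero {p₀ p : TotalSpace F V}
    (hp : p ∈ (extChartAt (𝓘(ℝ, EB).prod 𝓘(ℝ, F)) p₀).source) {w : TE EB p}
    (hw : tproj EB p w = 0) :
    fiberTriv p₀.proj p.proj (C.connector p w) =
      (dchart (𝓘(ℝ, EB).prod 𝓘(ℝ, F)) p₀ p w).2 := by
  obtain ⟨b, rfl⟩ := (exists_verticalLift_eq_iff EB p w).2 hw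
  rw [C.connector_verticalLift, dchart_verticalLift hp]

/-- The horizontal lift of a smooth vector field is smooth. -/
theorem contMDiffAt_horizontalLift {X : (x : M) → TangentSpace 𝓘(ℝ, EB) x} {p : TotalSpace F V}
    (hp : p ∈ Ω)
    (hX : ContMDiffAt 𝓘(ℝ, EB) 𝓘(ℝ, EB).tangent ∞
      (fun x ↦ (⟨x, X x⟩ : TangentBundle 𝓘(ℝ, EB) M)) p.proj) :
    ContMDiffAt (𝓘(ℝ, EB).prod 𝓘(ℝ, F)) (𝓘(ℝ, EB).prod 𝓘(ℝ, F)).tangent ∞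
      (fun p ↦ (⟨p, C.horizontalLift X p⟩ :
        TangentBundle (𝓘(ℝ, EB).prod 𝓘(ℝ, F)) (TotalSpace F V))) p := by
  have hs : ContMDiffAt (𝓘(ℝ, EB).prod 𝓘(ℝ, F)) ((𝓘(ℝ, EB).prod 𝓘(ℝ, F)).prod 𝓘(ℝ, EB)) ∞
      (fun p : TotalSpace F V ↦ (⟨p, X p.proj⟩ : TotalSpace EB (projMap EB (F := F) (V := V) *ᵖ
        (TangentSpace 𝓘(ℝ, EB) : M → Type _)))) p := by
    have h1 := (Bundle.contMDiffAt_section (IB := 𝓘(ℝ, EB)) (n := ∞) (s := X) p.proj).1 hX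
    have h2 := h1.comp p (Bundle.contMDiffAt_proj V (n := ∞) (IB := 𝓘(ℝ, EB)) (p := p))
    exact (Bundle.contMDiffAt_section (IB := 𝓘(ℝ, EB).prod 𝓘(ℝ, F)) (n := ∞) (F := EB)
      (E := projMap EB (F := F) (V := V) *ᵖ (TangentSpace 𝓘(ℝ, EB) : M → Type _))
      (s := fun p : TotalSpace F V ↦ X p.proj) p).2 h2
  have hopen : {q : TotalSpace EB (projMap EB (F := F) (V := V) *ᵖ
      (TangentSpace 𝓘(ℝ, EB) : M → Type _)) | q.proj ∈ Ω} ∈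
      nhds (⟨p, X p.proj⟩ : TotalSpace EB (projMap EB (F := F) (V := V) *ᵖ
        (TangentSpace 𝓘(ℝ, EB) : M → Type _))) :=
    (Ω.isOpen.preimage (FiberBundle.continuous_proj EB (projMap EB (F := F) (V := V) *ᵖ
      (TangentSpace 𝓘(ℝ, EB) : M → Type _)))).mem_nhds hp
  exact (C.smooth_hlift.contMDiffAt hopen).comp p hs

/-- As `EB` is finite-dimensional, smoothness of the operator-valued map may be tested on each
vector `v`; there `A(x, y) v` is the fibre component of the horizontal lift of the field with
constant coordinate `v`. -/
theorem contDiffAt_coef [FiniteDimensional ℝ EB] {p₀ p : TotalSpace F V}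
    (hp : p ∈ (extChartAt (𝓘(ℝ, EB).prod 𝓘(ℝ, F)) p₀).source) (hpΩ : p ∈ Ω) :
    ContDiffAt ℝ ∞ (C.coef p₀) (extChartAt (𝓘(ℝ, EB).prod 𝓘(ℝ, F)) p₀ p) := by
  have hpt : ∀ v : EB, ∀ q ∈ (extChartAt (𝓘(ℝ, EB).prod 𝓘(ℝ, F)) p₀).source ∩ Ω,
      ContDiffAt ℝ ∞ (fun y ↦ C.coef p₀ y v) (extChartAt (𝓘(ℝ, EB).prod 𝓘(ℝ, F)) p₀ q) := by
    rintro v q ⟨hq, hqΩ⟩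
    have hq' := (mem_extChartAt_source_iff.1 hq).1
    have hX : ContMDiffAt 𝓘(ℝ, EB) 𝓘(ℝ, EB).tangent ∞
        (fun x ↦ (⟨x, (dchart 𝓘(ℝ, EB) p₀.proj x).inverse v⟩ : TangentBundle 𝓘(ℝ, EB) M))
        q.proj := by
      rw [contMDiffAt_field_iff hq']
      refine (contMDiffAt_const (c := v)).congr_of_eventuallyEq ?_
      filter_upwards [extChartAt_source_mem_nhds' hq'] with x hx
      exact dchart_inverse hx v
    have h1 := contDiffAt_chartField hq (C.contMDiffAt_horizontalLift hqΩ hX)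
    exact h1.snd
  have hS : (extChartAt (𝓘(ℝ, EB).prod 𝓘(ℝ, F)) p₀).target ∩
      (extChartAt (𝓘(ℝ, EB).prod 𝓘(ℝ, F)) p₀).symm ⁻¹' Ω ∈
      nhds (extChartAt (𝓘(ℝ, EB).prod 𝓘(ℝ, F)) p₀ p) := by
    have ht := (extChartAt (𝓘(ℝ, EB).prod 𝓘(ℝ, F)) p₀).map_source hp
    refine Filter.inter_mem (extChartAt_target_mem_nhds' ht) ?_
    refine (contMDiffAt_extChartAt_symm ht).continuousAt.preimage_mem_nhds ?_
    rw [(extChartAt (𝓘(ℝ, EB).prod 𝓘(ℝ, F)) p₀).left_inv hp]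
    exact Ω.isOpen.mem_nhds hpΩ
  refine ContDiffOn.contDiffAt ?_ hS
  rw [contDiffOn_clm_apply]
  rintro v y ⟨hy, hyΩ⟩
  have h2 := hpt v _ ⟨(extChartAt (𝓘(ℝ, EB).prod 𝓘(ℝ, F)) p₀).map_target hy, hyΩ⟩
  rw [(extChartAt (𝓘(ℝ, EB).prod 𝓘(ℝ, F)) p₀).right_inv hy] at h2
  exact h2.contDiffWithinAt

theorem dchart_horPart {p₀ p : TotalSpace F V}
    (hp : p ∈ (extChartAt (𝓘(ℝ, EB).prod 𝓘(ℝ, F)) p₀).source) (hpΩ : p ∈ Ω)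
    (U : (p : TotalSpace F V) → TE EB p) :
    dchart (𝓘(ℝ, EB).prod 𝓘(ℝ, F)) p₀ p (C.horPart U p) =
      ((dchart (𝓘(ℝ, EB).prod 𝓘(ℝ, F)) p₀ p (U p)).1,
        C.coef p₀ (extChartAt (𝓘(ℝ, EB).prod 𝓘(ℝ, F)) p₀ p)
          (dchart (𝓘(ℝ, EB).prod 𝓘(ℝ, F)) p₀ p (U p)).1) := by
  rw [horPart, C.dchart_hlift hp hpΩ, dchart_fst hp]

theorem dchart_verPart {p₀ p : TotalSpace F V}
    (hp : p ∈ (extChartAt (𝓘(ℝ, EB).prod 𝓘(ℝ, F)) p₀).source) (hpΩ : p ∈ Ω)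
    (U : (p : TotalSpace F V) → TE EB p) :
    dchart (𝓘(ℝ, EB).prod 𝓘(ℝ, F)) p₀ p (C.verPart U p) =
      ((0 : EB), (dchart (𝓘(ℝ, EB).prod 𝓘(ℝ, F)) p₀ p (U p)).2 -
        C.coef p₀ (extChartAt (𝓘(ℝ, EB).prod 𝓘(ℝ, F)) p₀ p)
          (dchart (𝓘(ℝ, EB).prod 𝓘(ℝ, F)) p₀ p (U p)).1) := by
  rw [verPart, dchart_verticalLift hp, C.fiberTriv_connector hp hpΩ]

/-- `Tσ` covers the identity of `M`, so it sends the vertical vector `P_V(U)` to a vertical one, and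
`κ` reads off its fibre coordinate, the derivative of the section in the direction `P_V(U)`. -/
theorem fiberTriv_connectorTangent_verPart {p₀ p : TotalSpace F V}
    (hp : p ∈ (extChartAt (𝓘(ℝ, EB).prod 𝓘(ℝ, F)) p₀).source) (hpΩ : p ∈ Ω)
    (U : (p : TotalSpace F V) → TE EB p) {σ : (p : TotalSpace F V) → V p.proj}
    (hσ : ContMDiffAt (𝓘(ℝ, EB).prod 𝓘(ℝ, F)) (𝓘(ℝ, EB).prod 𝓘(ℝ, F)) ∞ (asMap σ) p) :
    fiberTriv p₀.proj p.proj (C.connectorTangent σ p (C.verPart U p)) =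
      fderiv ℝ (secRep EB p₀ σ) (extChartAt (𝓘(ℝ, EB).prod 𝓘(ℝ, F)) p₀ p)
        ((0 : EB), (dchart (𝓘(ℝ, EB).prod 𝓘(ℝ, F)) p₀ p (U p)).2 -
        C.coef p₀ (extChartAt (𝓘(ℝ, EB).prod 𝓘(ℝ, F)) p₀ p)
          (dchart (𝓘(ℝ, EB).prod 𝓘(ℝ, F)) p₀ p (U p)).1) := by
  have h1 := dchart_mfderiv_asMap hp hσ (C.verPart U p)
  rw [C.dchart_verPart hp hpΩ] at h1
  have h2 := C.fiberTriv_connector_of_tproj_eq_zero (asMap_mem_source hp σ)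
    (tproj_eq_zero_of_dchart_fst (asMap_mem_source hp σ) (congrArg Prod.fst h1))
  rw [h1] at h2
  exact h2

end NonlinearConnection

end Coordinates

/-! ### The bracket of a horizontal and a vertical field in a product of normed spaces. -/

section Bracket

variable {G₁ G₂ : Type*} [NormedAddCommGroup G₁] [NormedSpace ℝ G₁]
  [NormedAddCommGroup G₂] [NormedSpace ℝ G₂]

/-- The bracket of a horizontal field `(u, a u)` with a vertical field `(0, s)`. -/
theorem lieBracket_horizontal_vertical {u : G₁ × G₂ → G₁} {a : G₁ × G₂ → G₁ →L[ℝ] G₂}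
    {s : G₁ × G₂ → G₂} {y : G₁ × G₂} (hu : DifferentiableAt ℝ u y) (ha : DifferentiableAt ℝ a y)
    (hs : DifferentiableAt ℝ s y) :
    (VectorField.lieBracket ℝ (fun z ↦ (u z, a z (u z))) (fun z ↦ ((0 : G₁), s z)) y).2 -
      a y (VectorField.lieBracket ℝ (fun z ↦ (u z, a z (u z))) (fun z ↦ ((0 : G₁), s z)) y).1 =
    fderiv ℝ s y (u y, a y (u y)) - fderiv ℝ a y (0, s y) (u y) := by
  have h1 := ((hasFDerivAt_const (0 : G₁) y).prodMk hs.hasFDerivAt).fderiv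
  have h2 := (hu.hasFDerivAt.prodMk (ha.hasFDerivAt.clm_apply hu.hasFDerivAt)).fderiv
  -- The first component of the bracket is `-Du(0, s)`; subtracting `a` applied to it cancels the
  -- term of the second component in which `u` is differentiated.
  simp only [VectorField.lieBracket, h1, h2, ContinuousLinearMap.prod_apply, Prod.fst_sub,
    Prod.snd_sub, zero_apply, add_apply,
    ContinuousLinearMap.comp_apply, ContinuousLinearMap.flip_apply, zero_sub, map_neg]
  abel

end Bracket

/-! ### The coordinate formula for the linearization. -/

section Linearization

variable {EB : Type*} [NormedAddCommGroup EB] [NormedSpace ℝ EB] [FiniteDimensional ℝ EB]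
  {F : Type*} [NormedAddCommGroup F] [NormedSpace ℝ F] [FiniteDimensional ℝ F]
  {M : Type*} [TopologicalSpace M] [ChartedSpace EB M]
  {V : M → Type*} [∀ x, AddCommGroup (V x)] [∀ x, Module ℝ (V x)] [∀ x, TopologicalSpace (V x)]
  [TopologicalSpace (TotalSpace F V)] [FiberBundle F V]
  [VectorBundle ℝ F V] [IsManifold 𝓘(ℝ, EB) ∞ M] [ContMDiffVectorBundle ∞ F V 𝓘(ℝ, EB)]
  {Ω : Opens (TotalSpace F V)} (C : NonlinearConnection EB Ω)

namespace NonlinearConnection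

/-- The chart representation is `(U₁, A U₁)`, with both `U₁` and `A` smooth. -/
theorem contMDiffAt_horPart {U : (p : TotalSpace F V) → TE EB p} (hU : SmoothField EB Ω U)
    {p : TotalSpace F V} (hpΩ : p ∈ Ω) :
    ContMDiffAt (𝓘(ℝ, EB).prod 𝓘(ℝ, F)) (𝓘(ℝ, EB).prod 𝓘(ℝ, F)).tangent ∞
      (fun p ↦ (⟨p, C.horPart U p⟩ :
        TangentBundle (𝓘(ℝ, EB).prod 𝓘(ℝ, F)) (TotalSpace F V))) p := by
  have hp : p ∈ (extChartAt (𝓘(ℝ, EB).prod 𝓘(ℝ, F)) p).source := mem_extChartAt_source p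
  rw [contMDiffAt_field_iff hp, ← contDiffAt_comp_extChartAt_symm hp]
  have h1 := contDiffAt_chartField hp (smoothField_contMDiffAt hU hpΩ)
  have h2 : ContDiffAt ℝ ∞ (fun y ↦ ((chartField (𝓘(ℝ, EB).prod 𝓘(ℝ, F)) p U y).1,
      C.coef p y (chartField (𝓘(ℝ, EB).prod 𝓘(ℝ, F)) p U y).1))
      (extChartAt (𝓘(ℝ, EB).prod 𝓘(ℝ, F)) p p) :=
    h1.fst.prodMk ((C.contDiffAt_coef hp hpΩ).clm_apply h1.fst)
  rw [contDiffAt_comp_extChartAt_symm hp]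
  have h3 := (contDiffAt_comp_extChartAt_symm hp (g := fun q ↦
    ((dchart (𝓘(ℝ, EB).prod 𝓘(ℝ, F)) p q (U q)).1,
      C.coef p (extChartAt (𝓘(ℝ, EB).prod 𝓘(ℝ, F)) p q)
        (dchart (𝓘(ℝ, EB).prod 𝓘(ℝ, F)) p q (U q)).1))).1 (h2.congr_of_eventuallyEq ?_)
  · refine h3.congr_of_eventuallyEq ?_
    filter_upwards [extChartAt_source_mem_nhds' hp, Ω.isOpen.mem_nhds hpΩ] with q hq hqΩ
    exact C.dchart_horPart hq hqΩ U
  · filter_upwards [extChartAt_target_mem_nhds p] with y hy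
    simp only [Function.comp_apply, chartField,
      (extChartAt (𝓘(ℝ, EB).prod 𝓘(ℝ, F)) p).right_inv hy]

theorem contMDiffAt_verticalField {σ : (p : TotalSpace F V) → V p.proj}
    {p : TotalSpace F V}
    (hσ : ContMDiffAt (𝓘(ℝ, EB).prod 𝓘(ℝ, F)) (𝓘(ℝ, EB).prod 𝓘(ℝ, F)) ∞ (asMap σ) p) :
    ContMDiffAt (𝓘(ℝ, EB).prod 𝓘(ℝ, F)) (𝓘(ℝ, EB).prod 𝓘(ℝ, F)).tangent ∞
      (fun q ↦ (⟨q, verticalLift EB q (σ q)⟩ :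
        TangentBundle (𝓘(ℝ, EB).prod 𝓘(ℝ, F)) (TotalSpace F V))) p := by
  have hp : p ∈ (extChartAt (𝓘(ℝ, EB).prod 𝓘(ℝ, F)) p).source := mem_extChartAt_source p
  rw [contMDiffAt_field_iff hp, ← contDiffAt_comp_extChartAt_symm hp]
  have h1 : ContDiffAt ℝ ∞ (fun y ↦ ((0 : EB), secRep EB p σ y))
      (extChartAt (𝓘(ℝ, EB).prod 𝓘(ℝ, F)) p p) :=
    contDiffAt_const.prodMk ((contMDiffAt_asMap_iff hp).1 hσ)
  refine h1.congr_of_eventuallyEq ?_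
  filter_upwards [extChartAt_target_mem_nhds p] with y hy
  exact dchart_verticalLift ((extChartAt (𝓘(ℝ, EB).prod 𝓘(ℝ, F)) p).map_target hy) _

/-- The linearization in a chart:
`D_U σ = dσ(U) - (∂_y A(x, y) σ) U₁`. -/
theorem fiberTriv_linearization {p₀ p : TotalSpace F V}
    (hp : p ∈ (extChartAt (𝓘(ℝ, EB).prod 𝓘(ℝ, F)) p₀).source) (hpΩ : p ∈ Ω)
    {U : (p : TotalSpace F V) → TE EB p} (hU : SmoothField EB Ω U)
    {σ : (p : TotalSpace F V) → V p.proj} (hσ : SmoothSection EB Ω σ) :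
    fiberTriv p₀.proj p.proj (C.linearization U σ p) =
      fderiv ℝ (secRep EB p₀ σ) (extChartAt (𝓘(ℝ, EB).prod 𝓘(ℝ, F)) p₀ p)
          (dchart (𝓘(ℝ, EB).prod 𝓘(ℝ, F)) p₀ p (U p)) -
        fderiv ℝ (C.coef p₀) (extChartAt (𝓘(ℝ, EB).prod 𝓘(ℝ, F)) p₀ p)
          (0, fiberTriv p₀.proj p.proj (σ p)) (dchart (𝓘(ℝ, EB).prod 𝓘(ℝ, F)) p₀ p (U p)).1 := by
  have hσp := smoothSection_contMDiffAt hσ hpΩ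
  set Ψ := extChartAt (𝓘(ℝ, EB).prod 𝓘(ℝ, F)) p₀ with hΨ
  have ht := Ψ.map_source hp
  have hl : Ψ.symm (Ψ p) = p := Ψ.left_inv hp
  have hbr := dchart_mlieBracket (x := p₀) (y := Ψ p) (A := C.horPart U)
    (B := fun q ↦ verticalLift EB q (σ q)) ht
    (by rw [← hΨ, hl]; exact C.contMDiffAt_horPart hU hpΩ)
    (by rw [← hΨ, hl]; exact contMDiffAt_verticalField hσp)
  rw [← hΨ, hl] at hbr
  set u : EB × F → EB := fun y ↦ (chartField (𝓘(ℝ, EB).prod 𝓘(ℝ, F)) p₀ U y).1 with hu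
  have hU' := contDiffAt_chartField hp (smoothField_contMDiffAt hU hpΩ)
  have hmem : ∀ᶠ y in nhds (Ψ p), Ψ.symm y ∈ Ω := by
    refine (contMDiffAt_extChartAt_symm ht).continuousAt.eventually_mem ?_
    rw [← hΨ, hl]
    exact Ω.isOpen.mem_nhds hpΩ
  have h1 : chartField (𝓘(ℝ, EB).prod 𝓘(ℝ, F)) p₀ (C.horPart U) =ᶠ[nhds (Ψ p)]
      fun y ↦ (u y, C.coef p₀ y (u y)) := by
    filter_upwards [extChartAt_target_mem_nhds' ht, hmem] with y hy hyΩ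
    have := C.dchart_horPart (Ψ.map_target hy) hyΩ U
    rw [← hΨ, Ψ.right_inv hy] at this
    exact this
  have h2 : chartField (𝓘(ℝ, EB).prod 𝓘(ℝ, F)) p₀ (fun q ↦ verticalLift EB q (σ q)) =ᶠ[nhds (Ψ p)]
      fun y ↦ ((0 : EB), secRep EB p₀ σ y) := by
    filter_upwards [extChartAt_target_mem_nhds' ht] with y hy
    exact dchart_verticalLift (Ψ.map_target hy) _
  rw [h1.lieBracket_vectorField_eq h2] at hbr
  have hup : u (Ψ p) = (dchart (𝓘(ℝ, EB).prod 𝓘(ℝ, F)) p₀ p (U p)).1 := by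
    rw [hu]
    change (dchart _ p₀ (Ψ.symm (Ψ p)) (U (Ψ.symm (Ψ p)))).1 = _
    rw [hl]
  have h3 := lieBracket_horizontal_vertical (u := u) (a := C.coef p₀) (s := secRep EB p₀ σ)
    (y := Ψ p) (hU'.fst.differentiableAt (by simp))
    ((C.contDiffAt_coef hp hpΩ).differentiableAt (by simp))
    (((contMDiffAt_asMap_iff hp).1 hσp).differentiableAt (by simp))
  rw [hup, secRep_extChartAt hp] at h3
  -- The two first-order terms `dσ(U₁, A U₁)` and `dσ(0, U₂ - A U₁)` add up to `dσ(U)`.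
  rw [linearization, map_add, C.fiberTriv_connectorTangent_verPart hp hpΩ U hσp,
    C.fiberTriv_connector hp hpΩ, ← hΨ, hbr, h3, sub_add_eq_add_sub, ← map_add]
  congr 2
  refine Prod.ext ?_ ?_ <;> simp

end NonlinearConnection

end Linearization

/-! ### The linearization is a covariant derivative. -/

section CovariantDerivative

variable {EB : Type*} [NormedAddCommGroup EB] [NormedSpace ℝ EB]
  {F : Type*} [NormedAddCommGroup F] [NormedSpace ℝ F]
  {M : Type*} [TopologicalSpace M] [ChartedSpace EB M]
  {V : M → Type*} [∀ x, AddCommGroup (V x)] [∀ x, Module ℝ (V x)] [∀ x, TopologicalSpace (V x)]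
  [TopologicalSpace (TotalSpace F V)] [FiberBundle F V]
  [VectorBundle ℝ F V] [IsManifold 𝓘(ℝ, EB) ∞ M] [ContMDiffVectorBundle ∞ F V 𝓘(ℝ, EB)]
  {Ω : Opens (TotalSpace F V)}

theorem smoothField_iff {U : (p : TotalSpace F V) → TE EB p} :
    SmoothField EB Ω U ↔ ∀ p ∈ Ω, ContMDiffAt (𝓘(ℝ, EB).prod 𝓘(ℝ, F)) 𝓘(ℝ, EB × F) ∞
      (fun q ↦ dchart (𝓘(ℝ, EB).prod 𝓘(ℝ, F)) p q (U q)) p :=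
  ⟨fun h _ hp ↦ (contMDiffAt_field_iff (mem_extChartAt_source _)).1 (smoothField_contMDiffAt h hp),
    fun h p hp ↦ ((contMDiffAt_field_iff (mem_extChartAt_source _)).2 (h p hp)).contMDiffWithinAt⟩

theorem smoothSection_iff {σ : (p : TotalSpace F V) → V p.proj} :
    SmoothSection EB Ω σ ↔ ∀ p ∈ Ω,
      ContDiffAt ℝ ∞ (secRep EB p σ) (extChartAt (𝓘(ℝ, EB).prod 𝓘(ℝ, F)) p p) :=
  ⟨fun h _ hp ↦ (contMDiffAt_asMap_iff (mem_extChartAt_source _)).1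
      (smoothSection_contMDiffAt h hp),
    fun h p hp ↦ ((contMDiffAt_asMap_iff (mem_extChartAt_source _)).2 (h p hp)).contMDiffWithinAt⟩

theorem SmoothField.add {U U' : (p : TotalSpace F V) → TE EB p} (hU : SmoothField EB Ω U)
    (hU' : SmoothField EB Ω U') : SmoothField EB Ω (fun q ↦ U q + U' q) := by
  rw [smoothField_iff] at *
  intro p hp
  exact ((hU p hp).add (hU' p hp)).congr_of_eventuallyEq
    (Filter.Eventually.of_forall fun q ↦ map_add _ _ _)

theorem SmoothField.smul {f : TotalSpace F V → ℝ} {U : (p : TotalSpace F V) → TE EB p}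
    (hf : ContMDiffOn (𝓘(ℝ, EB).prod 𝓘(ℝ, F)) 𝓘(ℝ, ℝ) ∞ f Ω) (hU : SmoothField EB Ω U) :
    SmoothField EB Ω (fun q ↦ f q • U q) := by
  rw [smoothField_iff] at *
  intro p hp
  exact ((hf.contMDiffAt (Ω.isOpen.mem_nhds hp)).smul (hU p hp)).congr_of_eventuallyEq
    (Filter.Eventually.of_forall fun q ↦ map_smul _ _ _)

theorem secRep_add (p₀ : TotalSpace F V) (σ σ' : (p : TotalSpace F V) → V p.proj) :
    secRep EB p₀ (fun q ↦ σ q + σ' q) = fun y ↦ secRep EB p₀ σ y + secRep EB p₀ σ' y := by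
  funext y
  exact map_add _ _ _

theorem secRep_smul (p₀ : TotalSpace F V) (f : TotalSpace F V → ℝ)
    (σ : (p : TotalSpace F V) → V p.proj) :
    secRep EB p₀ (fun q ↦ f q • σ q) =
      fun y ↦ (f ∘ (extChartAt (𝓘(ℝ, EB).prod 𝓘(ℝ, F)) p₀).symm) y • secRep EB p₀ σ y := by
  funext y
  exact map_smul _ _ _

theorem SmoothSection.add {σ σ' : (p : TotalSpace F V) → V p.proj} (hσ : SmoothSection EB Ω σ)
    (hσ' : SmoothSection EB Ω σ') : SmoothSection EB Ω (fun q ↦ σ q + σ' q) := by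
  rw [smoothSection_iff] at *
  intro p hp
  rw [secRep_add]
  exact (hσ p hp).add (hσ' p hp)

theorem SmoothSection.smul {f : TotalSpace F V → ℝ} {σ : (p : TotalSpace F V) → V p.proj}
    (hf : ContMDiffOn (𝓘(ℝ, EB).prod 𝓘(ℝ, F)) 𝓘(ℝ, ℝ) ∞ f Ω) (hσ : SmoothSection EB Ω σ) :
    SmoothSection EB Ω (fun q ↦ f q • σ q) := by
  rw [smoothSection_iff] at *
  intro p hp
  rw [secRep_smul]
  exact ((contDiffAt_comp_extChartAt_symm (mem_extChartAt_source p)).2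
    (hf.contMDiffAt (Ω.isOpen.mem_nhds hp))).smul (hσ p hp)

theorem fderiv_comp_extChartAt_symm {p : TotalSpace F V} {f : TotalSpace F V → ℝ}
    (hf : ContMDiffAt (𝓘(ℝ, EB).prod 𝓘(ℝ, F)) 𝓘(ℝ, ℝ) ∞ f p) (w : TE EB p) :
    fderiv ℝ (f ∘ (extChartAt (𝓘(ℝ, EB).prod 𝓘(ℝ, F)) p).symm)
      (extChartAt (𝓘(ℝ, EB).prod 𝓘(ℝ, F)) p p) (dchart (𝓘(ℝ, EB).prod 𝓘(ℝ, F)) p p w) =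
      mvfderiv (𝓘(ℝ, EB).prod 𝓘(ℝ, F)) f p w := by
  have hp : p ∈ (extChartAt (𝓘(ℝ, EB).prod 𝓘(ℝ, F)) p).source := mem_extChartAt_source p
  have h1 := ((contDiffAt_comp_extChartAt_symm hp).2 hf).differentiableAt (by simp)
  have h2 := h1.hasFDerivAt.hasMFDerivAt.comp p (hasMFDerivAt_extChartAt_dchart hp)
  have h3 : f =ᶠ[nhds p] (f ∘ (extChartAt (𝓘(ℝ, EB).prod 𝓘(ℝ, F)) p).symm) ∘
      extChartAt (𝓘(ℝ, EB).prod 𝓘(ℝ, F)) p := by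
    filter_upwards [extChartAt_source_mem_nhds' hp] with q hq
    exact (congrArg f ((extChartAt (𝓘(ℝ, EB).prod 𝓘(ℝ, F)) p).left_inv hq)).symm
  have h4 := (h2.congr_of_eventuallyEq h3).mfderiv
  rw [mvfderiv, h4]
  rfl

variable [FiniteDimensional ℝ EB] [FiniteDimensional ℝ F] (C : NonlinearConnection EB Ω)

/-- Each axiom is checked on the coordinate formula: `U` enters linearly through its value, and `σ`
through its derivative along `U` and a term linear in its value. -/
theorem isCovariantDerivative_linearization : IsCovariantDerivative EB Ω C.linearization where
  smooth U σ hU hσ := by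
    rw [smoothSection_iff]
    intro p hpΩ
    have hp : p ∈ (extChartAt (𝓘(ℝ, EB).prod 𝓘(ℝ, F)) p).source := mem_extChartAt_source p
    have hU' := contDiffAt_chartField hp (smoothField_contMDiffAt hU hpΩ)
    have hσ' := smoothSection_iff.1 hσ p hpΩ
    have h1 : ContDiffAt ℝ ∞ (fun y ↦ fderiv ℝ (secRep EB p σ) y
        (chartField (𝓘(ℝ, EB).prod 𝓘(ℝ, F)) p U y) - fderiv ℝ (C.coef p) y (0, secRep EB p σ y)
          (chartField (𝓘(ℝ, EB).prod 𝓘(ℝ, F)) p U y).1)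
        (extChartAt (𝓘(ℝ, EB).prod 𝓘(ℝ, F)) p p) :=
      ((hσ'.fderiv_right (by simp)).clm_apply hU').sub
        ((((C.contDiffAt_coef hp hpΩ).fderiv_right (by simp)).clm_apply
          (contDiffAt_const.prodMk hσ')).clm_apply hU'.fst)
    refine h1.congr_of_eventuallyEq ?_
    have ht := mem_extChartAt_target (I := 𝓘(ℝ, EB).prod 𝓘(ℝ, F)) p
    have hmem : ∀ᶠ y in nhds (extChartAt (𝓘(ℝ, EB).prod 𝓘(ℝ, F)) p p),
        (extChartAt (𝓘(ℝ, EB).prod 𝓘(ℝ, F)) p).symm y ∈ Ω := by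
      refine (contMDiffAt_extChartAt_symm ht).continuousAt.eventually_mem ?_
      rw [extChartAt_to_inv]
      exact Ω.isOpen.mem_nhds hpΩ
    filter_upwards [extChartAt_target_mem_nhds p, hmem] with y hy hyΩ
    have := C.fiberTriv_linearization
      ((extChartAt (𝓘(ℝ, EB).prod 𝓘(ℝ, F)) p).map_target hy) hyΩ hU hσ
    rw [(extChartAt (𝓘(ℝ, EB).prod 𝓘(ℝ, F)) p).right_inv hy] at this
    exact this
  add_field U U' σ hU hU' hσ p hpΩ := by
    have hp : p ∈ (extChartAt (𝓘(ℝ, EB).prod 𝓘(ℝ, F)) p).source := mem_extChartAt_source p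
    refine fiberTriv_injective (mem_baseSet_trivializationAt F V p.proj) ?_
    rw [map_add, C.fiberTriv_linearization hp hpΩ (hU.add hU') hσ,
      C.fiberTriv_linearization hp hpΩ hU hσ, C.fiberTriv_linearization hp hpΩ hU' hσ]
    simp only [map_add, Prod.fst_add]
    abel
  smul_field f U σ hf hU hσ p hpΩ := by
    have hp : p ∈ (extChartAt (𝓘(ℝ, EB).prod 𝓘(ℝ, F)) p).source := mem_extChartAt_source p
    refine fiberTriv_injective (mem_baseSet_trivializationAt F V p.proj) ?_
    rw [map_smul, C.fiberTriv_linearization hp hpΩ (hU.smul hf) hσ,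
      C.fiberTriv_linearization hp hpΩ hU hσ]
    simp only [map_smul, Prod.smul_fst, smul_sub]
  add_section U σ σ' hU hσ hσ' p hpΩ := by
    have hp : p ∈ (extChartAt (𝓘(ℝ, EB).prod 𝓘(ℝ, F)) p).source := mem_extChartAt_source p
    refine fiberTriv_injective (mem_baseSet_trivializationAt F V p.proj) ?_
    rw [map_add, C.fiberTriv_linearization hp hpΩ hU (hσ.add hσ'),
      C.fiberTriv_linearization hp hpΩ hU hσ, C.fiberTriv_linearization hp hpΩ hU hσ',
      secRep_add, fderiv_fun_add ((smoothSection_iff.1 hσ p hpΩ).differentiableAt (by simp))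
        ((smoothSection_iff.1 hσ' p hpΩ).differentiableAt (by simp)), map_add,
      show ((0 : EB), fiberTriv (F := F) p.proj p.proj (σ p) + fiberTriv p.proj p.proj (σ' p)) =
        (0, fiberTriv p.proj p.proj (σ p)) + (0, fiberTriv p.proj p.proj (σ' p)) by simp, map_add]
    simp only [add_apply]
    abel
  leibniz f U σ hf hU hσ p hpΩ := by
    have hp : p ∈ (extChartAt (𝓘(ℝ, EB).prod 𝓘(ℝ, F)) p).source := mem_extChartAt_source p
    have hfp := hf.contMDiffAt (Ω.isOpen.mem_nhds hpΩ)
    refine fiberTriv_injective (mem_baseSet_trivializationAt F V p.proj) ?_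
    rw [map_add, map_smul, map_smul, C.fiberTriv_linearization hp hpΩ hU (hσ.smul hf),
      C.fiberTriv_linearization hp hpΩ hU hσ,
      secRep_smul, fderiv_fun_smul (((contDiffAt_comp_extChartAt_symm hp).2 hfp).differentiableAt
        (by simp)) ((smoothSection_iff.1 hσ p hpΩ).differentiableAt (by simp)), map_smul,
      show ((0 : EB), f p • fiberTriv (F := F) p.proj p.proj (σ p)) =
        f p • (0, fiberTriv p.proj p.proj (σ p)) by simp, map_smul,
      ← fderiv_comp_extChartAt_symm hfp, secRep_extChartAt hp]
    simp only [add_apply, smul_apply, ContinuousLinearMap.smulRight_apply,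
      Function.comp_apply, extChartAt_to_inv, smul_sub]
    abel

end CovariantDerivative

/-! ### Global smooth objects by cutting off with bump functions. -/

section Bump

variable {G : Type*} [NormedAddCommGroup G] [NormedSpace ℝ G] [FiniteDimensional ℝ G]
  {H : Type*} [TopologicalSpace H] {J : ModelWithCorners ℝ G H}
  {N : Type*} [TopologicalSpace N] [ChartedSpace H N] [IsManifold J ∞ N] [T2Space N]

/-- The support of the bump function lies in the chart domain and off the support the product
vanishes locally, so `g` need only be smooth on the chart domain. -/
theorem contMDiffAt_bump_smul {Z : Type*} [NormedAddCommGroup Z] [NormedSpace ℝ Z] {x q : N}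
    (χ : SmoothBumpFunction J x) {g : N → Z}
    (hg : q ∈ (extChartAt J x).source → ContMDiffAt J 𝓘(ℝ, Z) ∞ g q) :
    ContMDiffAt J 𝓘(ℝ, Z) ∞ (fun q ↦ χ q • g q) q := by
  by_cases hq : q ∈ tsupport χ
  · exact (χ.contMDiff q).smul (hg (by
      rw [extChartAt_source]; exact χ.tsupport_subset_chartAt_source hq))
  · refine (contMDiffAt_const (c := (0 : Z))).congr_of_eventuallyEq ?_
    filter_upwards [notMem_tsupport_iff_eventuallyEq.1 hq] with q' hq'
    simp [hq']

theorem contMDiffAt_bump_smul_field {x q : N} (χ : SmoothBumpFunction J x)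
    {Y : (p : N) → TangentSpace J p}
    (hY : q ∈ (extChartAt J x).source →
      ContMDiffAt J J.tangent ∞ (fun p ↦ (⟨p, Y p⟩ : TangentBundle J N)) q) :
    ContMDiffAt J J.tangent ∞ (fun p ↦ (⟨p, χ p • Y p⟩ : TangentBundle J N)) q := by
  rw [contMDiffAt_field_iff (mem_extChartAt_source q)] at hY ⊢
  exact (contMDiffAt_bump_smul χ hY).congr_of_eventuallyEq
    (Filter.Eventually.of_forall fun q' ↦ map_smul _ _ _)

theorem contMDiffAt_inverse_dchart {x q : N} (hq : q ∈ (extChartAt J x).source) (v : G) :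
    ContMDiffAt J J.tangent ∞
      (fun p ↦ (⟨p, (dchart J x p).inverse v⟩ : TangentBundle J N)) q := by
  rw [contMDiffAt_field_iff hq]
  refine (contMDiffAt_const (c := v)).congr_of_eventuallyEq ?_
  filter_upwards [extChartAt_source_mem_nhds' hq] with p hp
  exact dchart_inverse hp v

/-- The field with constant coordinates in the chart at `x`, cut off by a bump function equal to `1`
at `x`. -/
theorem exists_contMDiff_field (x : N) (z : TangentSpace J x) :
    ∃ Y : (p : N) → TangentSpace J p,
      ContMDiff J J.tangent ∞ (fun p ↦ (⟨p, Y p⟩ : TangentBundle J N)) ∧ Y x = z := by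
  obtain ⟨χ⟩ : Nonempty (SmoothBumpFunction J x) := inferInstance
  refine ⟨fun p ↦ χ p • (dchart J x p).inverse (dchart J x x z), fun q ↦
    contMDiffAt_bump_smul_field χ fun hq ↦ contMDiffAt_inverse_dchart hq _, ?_⟩
  simp only [χ.eq_one, one_smul]
  exact inverse_dchart (mem_extChartAt_source x) z

end Bump

/-! ### The horizontal vectors of the linearization in coordinates. -/

section Horizontal

variable {EB : Type*} [NormedAddCommGroup EB] [NormedSpace ℝ EB] [FiniteDimensional ℝ EB]
  {F : Type*} [NormedAddCommGroup F] [NormedSpace ℝ F] [FiniteDimensional ℝ F]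
  {M : Type*} [TopologicalSpace M] [ChartedSpace EB M]
  {V : M → Type*} [∀ x, AddCommGroup (V x)] [∀ x, Module ℝ (V x)] [∀ x, TopologicalSpace (V x)]
  [TopologicalSpace (TotalSpace F V)] [FiberBundle F V]
  [VectorBundle ℝ F V] [IsManifold 𝓘(ℝ, EB) ∞ M] [ContMDiffVectorBundle ∞ F V 𝓘(ℝ, EB)]
  [T2Space (TotalSpace F V)]

theorem contMDiffAt_bump_smul_section {p q : TotalSpace F V}
    (χ : SmoothBumpFunction (𝓘(ℝ, EB).prod 𝓘(ℝ, F)) p) {σ : (p : TotalSpace F V) → V p.proj}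
    (hσ : q ∈ (extChartAt (𝓘(ℝ, EB).prod 𝓘(ℝ, F)) p).source →
      ContDiffAt ℝ ∞ (secRep EB p σ) (extChartAt (𝓘(ℝ, EB).prod 𝓘(ℝ, F)) p q)) :
    ContMDiffAt (𝓘(ℝ, EB).prod 𝓘(ℝ, F)) (𝓘(ℝ, EB).prod 𝓘(ℝ, F)) ∞
      (asMap fun q ↦ χ q • σ q) q := by
  have hqs : q ∈ (extChartAt (𝓘(ℝ, EB).prod 𝓘(ℝ, F)) q).source := mem_extChartAt_source q
  rw [contMDiffAt_asMap_iff hqs]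
  refine (contDiffAt_comp_extChartAt_symm hqs (g := fun q' ↦ fiberTriv q.proj q'.proj
    (χ q' • σ q'))).2 ?_
  refine (contMDiffAt_bump_smul χ (g := fun q' ↦ fiberTriv q.proj q'.proj (σ q')) fun hq ↦
    ?_).congr_of_eventuallyEq (Filter.Eventually.of_forall fun q' ↦ map_smul _ _ _)
  refine (contDiffAt_comp_extChartAt_symm hqs).1 ((contMDiffAt_asMap_iff hqs).1
    ((contMDiffAt_asMap_iff hq).2 (hσ hq)))

/-- There are sections of `π^*E` with a prescribed value and derivative at a point. -/
theorem exists_section_fderiv (p : TotalSpace F V) (v : V p.proj) (ℓ : EB × F →L[ℝ] F) :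
    ∃ σ : (p : TotalSpace F V) → V p.proj,
      ContMDiff (𝓘(ℝ, EB).prod 𝓘(ℝ, F)) (𝓘(ℝ, EB).prod 𝓘(ℝ, F)) ∞ (asMap σ) ∧ σ p = v ∧
      fderiv ℝ (secRep EB p σ) (extChartAt (𝓘(ℝ, EB).prod 𝓘(ℝ, F)) p p) = ℓ := by
  obtain ⟨χ⟩ : Nonempty (SmoothBumpFunction (𝓘(ℝ, EB).prod 𝓘(ℝ, F)) p) := inferInstance
  set Ψ := extChartAt (𝓘(ℝ, EB).prod 𝓘(ℝ, F)) p with hΨ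
  -- `τ` is affine in the chart, with linear part `ℓ`; the bump function equals `1` near `p` and so
  -- does not change the derivative there.
  set τ : (q : TotalSpace F V) → V q.proj := fun q ↦
    (trivializationAt F V p.proj).symmL ℝ q.proj
      (fiberTriv p.proj p.proj v + ℓ (Ψ q - Ψ p)) with hτ
  have hrep : ∀ q ∈ Ψ.source, ∀ᶠ y in nhds (Ψ q), Ψ.symm y ∈ Ψ.source ∧ secRep EB p τ y =
      fiberTriv p.proj p.proj v + ℓ (y - Ψ p) := by
    intro q hq
    filter_upwards [extChartAt_target_mem_nhds' (Ψ.map_source hq)] with y hy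
    have hs := Ψ.map_target hy
    refine ⟨hs, ?_⟩
    rw [secRep, hτ]
    simp only
    rw [Trivialization.continuousLinearMapAt_symmL _ (mem_extChartAt_source_iff.1 hs).2, ← hΨ,
      Ψ.right_inv hy]
  have hsm : ∀ q ∈ Ψ.source, ContDiffAt ℝ ∞ (secRep EB p τ) (Ψ q) := fun q hq ↦
    (show ContDiffAt ℝ ∞ (fun y ↦ fiberTriv (F := F) p.proj p.proj v + ℓ (y - Ψ p)) (Ψ q) by
      fun_prop).congr_of_eventuallyEq ((hrep q hq).mono fun y hy ↦ hy.2)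
  refine ⟨fun q ↦ χ q • τ q, fun q ↦ contMDiffAt_bump_smul_section χ (hsm q), ?_, ?_⟩
  · simp only [χ.eq_one, one_smul, hτ, sub_self, map_zero, add_zero]
    exact Trivialization.symmL_continuousLinearMapAt _ (mem_baseSet_trivializationAt F V p.proj) v
  · have hps : p ∈ Ψ.source := mem_extChartAt_source p
    have h1 : secRep EB p (fun q ↦ χ q • τ q) =ᶠ[nhds (Ψ p)]
        fun y ↦ fiberTriv p.proj p.proj v + ℓ (y - Ψ p) := by
      have hc : ContinuousAt Ψ.symm (Ψ p) := continuousAt_extChartAt_symm p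
      rw [ContinuousAt, hΨ, extChartAt_to_inv] at hc
      have h2 : ∀ᶠ y in nhds (Ψ p), χ (Ψ.symm y) = 1 := hc.eventually χ.eventuallyEq_one
      filter_upwards [h2, hrep p hps] with y hy hy'
      rw [secRep_smul]
      simp only [Function.comp_apply]
      rw [← hΨ, hy, one_smul, hy'.2]
    rw [h1.fderiv_eq]
    have h3 : HasFDerivAt (fun y ↦ fiberTriv (F := F) p.proj p.proj v + ℓ (y - Ψ p)) ℓ (Ψ p) :=
      (ℓ.hasFDerivAt.comp (Ψ p) ((hasFDerivAt_id (𝕜 := ℝ) (Ψ p)).sub_const (Ψ p))).const_add _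
    exact h3.fderiv

variable {Ω : Opens (TotalSpace F V)} (C : NonlinearConnection EB Ω)

namespace NonlinearConnection

/-- Horizontal vectors of the linearization in a chart. -/
theorem dchart_of_mem_horizontalSet {p q : TotalSpace F V} {z : TE EB p} {z' : TE EB q}
    (h : ((⟨p, z⟩, ⟨q, z'⟩) :
      TangentBundle (𝓘(ℝ, EB).prod 𝓘(ℝ, F)) (TotalSpace F V) ×
        TangentBundle (𝓘(ℝ, EB).prod 𝓘(ℝ, F)) (TotalSpace F V)) ∈
        horizontalSet EB Ω C.linearization) :
    p ∈ Ω ∧ q.proj = p.proj ∧ ∀ p₀ : TotalSpace F V,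
      p ∈ (extChartAt (𝓘(ℝ, EB).prod 𝓘(ℝ, F)) p₀).source →
      dchart (𝓘(ℝ, EB).prod 𝓘(ℝ, F)) p₀ q z' =
        ((dchart (𝓘(ℝ, EB).prod 𝓘(ℝ, F)) p₀ p z).1,
          fderiv ℝ (C.coef p₀) (extChartAt (𝓘(ℝ, EB).prod 𝓘(ℝ, F)) p₀ p)
            (0, (extChartAt (𝓘(ℝ, EB).prod 𝓘(ℝ, F)) p₀ q).2)
            (dchart (𝓘(ℝ, EB).prod 𝓘(ℝ, F)) p₀ p z).1) := by
  obtain ⟨p', hp', U, σ, hU, hσ, h0, h1, h2⟩ := h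
  have hpp : p = p' := congrArg TotalSpace.proj h1
  subst hpp
  have hz : z = U p := by simpa using h1
  subst hz
  have hq : q = asMap σ p := congrArg TotalSpace.proj h2
  subst hq
  have hz' : z' = mfderiv (𝓘(ℝ, EB).prod 𝓘(ℝ, F)) (𝓘(ℝ, EB).prod 𝓘(ℝ, F)) (asMap σ) p (U p) := by
    simpa [tangentMap] using h2
  subst hz'
  refine ⟨hp', rfl, fun p₀ hp ↦ ?_⟩
  have h3 := C.fiberTriv_linearization hp hp' hU hσ
  rw [h0, map_zero] at h3
  rw [dchart_mfderiv_asMap hp (smoothSection_contMDiffAt hσ hp'), asMap,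
    extChartAt_mk (asMap_mem_source hp σ)]
  exact Prod.ext rfl (sub_eq_zero.1 h3.symm)

/-- Choosing `σ` with value `q` and derivative `v ↦ (∂_y A · q) v₁` at `p` makes the coordinate
formula vanish for every field; the field is then taken with value `z`. -/
theorem mem_horizontalSet_of_dchart {p q : TotalSpace F V} {z : TE EB p} {z' : TE EB q}
    (hpΩ : p ∈ Ω) (hq : q.proj = p.proj)
    (h : dchart (𝓘(ℝ, EB).prod 𝓘(ℝ, F)) p q z' =
        ((dchart (𝓘(ℝ, EB).prod 𝓘(ℝ, F)) p p z).1,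
          fderiv ℝ (C.coef p) (extChartAt (𝓘(ℝ, EB).prod 𝓘(ℝ, F)) p p)
            (0, (extChartAt (𝓘(ℝ, EB).prod 𝓘(ℝ, F)) p q).2)
            (dchart (𝓘(ℝ, EB).prod 𝓘(ℝ, F)) p p z).1)) :
    ((⟨p, z⟩, ⟨q, z'⟩) :
      TangentBundle (𝓘(ℝ, EB).prod 𝓘(ℝ, F)) (TotalSpace F V) ×
        TangentBundle (𝓘(ℝ, EB).prod 𝓘(ℝ, F)) (TotalSpace F V)) ∈
        horizontalSet EB Ω C.linearization := by
  obtain ⟨x, v⟩ := q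
  obtain rfl : x = p.proj := hq
  have hp : p ∈ (extChartAt (𝓘(ℝ, EB).prod 𝓘(ℝ, F)) p).source := mem_extChartAt_source p
  obtain ⟨U, hU, rfl⟩ := exists_contMDiff_field (J := 𝓘(ℝ, EB).prod 𝓘(ℝ, F)) p z
  obtain ⟨σ, hσ, rfl, hℓ⟩ := exists_section_fderiv p v
    ((fderiv ℝ (C.coef p) (extChartAt (𝓘(ℝ, EB).prod 𝓘(ℝ, F)) p p)
      (0, (extChartAt (𝓘(ℝ, EB).prod 𝓘(ℝ, F)) p ⟨p.proj, v⟩).2)).comp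
        (ContinuousLinearMap.fst ℝ EB F))
  have hU' : SmoothField EB Ω U := hU.contMDiffOn
  have hσ' : SmoothSection EB Ω σ := hσ.contMDiffOn
  have hps : (⟨p.proj, σ p⟩ : TotalSpace F V) ∈
    (extChartAt (𝓘(ℝ, EB).prod 𝓘(ℝ, F)) p).source := asMap_mem_source hp σ
  refine ⟨p, hpΩ, U, σ, hU', hσ', ?_, rfl, ?_⟩
  · refine fiberTriv_injective (mem_baseSet_trivializationAt F V p.proj) ?_
    rw [map_zero, C.fiberTriv_linearization hp hpΩ hU' hσ', hℓ, extChartAt_mk hps]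
    exact sub_self _
  · have h1 := dchart_mfderiv_asMap hp (hσ p) (U p)
    rw [hℓ] at h1
    have h2 : z' = mfderiv (𝓘(ℝ, EB).prod 𝓘(ℝ, F)) (𝓘(ℝ, EB).prod 𝓘(ℝ, F)) (asMap σ) p (U p) :=
      dchart_injective hps (h.trans h1.symm)
    rw [h2]
    rfl

/-- Membership only provides some other pair `(U', σ')` with the same tangent vectors. The
coordinate condition involves these vectors alone, so it passes to the given pair. -/
theorem linearization_eq_zero_of_mem_horizontalSet {p : TotalSpace F V}
    {U : (p : TotalSpace F V) → TE EB p} (hU : SmoothField EB Ω U)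
    {σ : (p : TotalSpace F V) → V p.proj} (hσ : SmoothSection EB Ω σ)
    (h : ((⟨p, U p⟩, tangentMap (𝓘(ℝ, EB).prod 𝓘(ℝ, F)) (𝓘(ℝ, EB).prod 𝓘(ℝ, F)) (asMap σ)
        ⟨p, U p⟩) :
      TangentBundle (𝓘(ℝ, EB).prod 𝓘(ℝ, F)) (TotalSpace F V) ×
        TangentBundle (𝓘(ℝ, EB).prod 𝓘(ℝ, F)) (TotalSpace F V)) ∈
        horizontalSet EB Ω C.linearization) :
    C.linearization U σ p = 0 := by
  obtain ⟨hpΩ, -, h1⟩ := C.dchart_of_mem_horizontalSet h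
  have hp : p ∈ (extChartAt (𝓘(ℝ, EB).prod 𝓘(ℝ, F)) p).source := mem_extChartAt_source p
  have h2 := h1 p hp
  have h3 := (dchart_mfderiv_asMap hp (smoothSection_contMDiffAt hσ hpΩ) (U p)).symm.trans h2
  refine fiberTriv_injective (mem_baseSet_trivializationAt F V p.proj) ?_
  rw [map_zero, C.fiberTriv_linearization hp hpΩ hU hσ, sub_eq_zero]
  refine (congrArg Prod.snd h3).trans ?_
  rw [asMap, extChartAt_mk (asMap_mem_source hp σ)]

end NonlinearConnection

end Horizontal

/-! ### Grönwall uniqueness on an arbitrary interval. -/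

section Gronwall

variable {Z : Type*} [NormedAddCommGroup Z] [NormedSpace ℝ Z]

/-- Derivatives are taken within `S` because parallel sections are only controlled on a closed
segment, end points included. -/
theorem eq_zero_of_norm_hasDerivWithinAt_le_right {S : Set ℝ} (hS : S.OrdConnected) {f f' : ℝ → Z}
    {K : ℝ} (hf : ∀ t ∈ S, HasDerivWithinAt f (f' t) S t) (hK : ∀ t ∈ S, ‖f' t‖ ≤ K * ‖f t‖)
    {t₀ t : ℝ} (ht₀ : t₀ ∈ S) (ht : t ∈ S) (h : f t₀ = 0) (hle : t₀ ≤ t) : f t = 0 := by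
  have hI : Icc t₀ t ⊆ S := hS.out ht₀ ht
  refine eq_zero_of_abs_deriv_le_mul_abs_self_of_eq_zero_right (f' := f') (K := K)
    (fun x hx ↦ ((hf x (hI hx)).continuousWithinAt).mono hI) (fun x hx ↦ ?_) h
    (fun x hx ↦ hK x (hI (Ico_subset_Icc_self hx))) t ⟨hle, le_rfl⟩
  exact ((hf x (hI (Ico_subset_Icc_self hx))).mono hI).mono_of_mem_nhdsWithin
    (Icc_mem_nhdsGE_of_mem hx)

/-- A solution of a linear differential inequality that vanishes somewhere vanishes identically. -/
theorem eq_zero_of_norm_hasDerivWithinAt_le {S : Set ℝ} (hS : S.OrdConnected) {f f' : ℝ → Z}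
    {K : ℝ} (hf : ∀ t ∈ S, HasDerivWithinAt f (f' t) S t) (hK : ∀ t ∈ S, ‖f' t‖ ≤ K * ‖f t‖)
    {t₀ t : ℝ} (ht₀ : t₀ ∈ S) (ht : t ∈ S) (h : f t₀ = 0) : f t = 0 := by
  rcases le_total t₀ t with hle | hle
  · exact eq_zero_of_norm_hasDerivWithinAt_le_right hS hf hK ht₀ ht h hle
  -- Time reversal reduces the backward case to the forward one.
  · have hS' : ((fun x : ℝ ↦ -x) ⁻¹' S).OrdConnected :=
      ⟨fun x hx y hy u hu ↦ hS.out hy hx ⟨neg_le_neg hu.2, neg_le_neg hu.1⟩⟩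
    have := eq_zero_of_norm_hasDerivWithinAt_le_right (f := fun x ↦ f (-x))
      (f' := fun x ↦ -f' (-x)) (K := K) (t₀ := -t₀) (t := -t) hS' (fun x hx ↦ ?_) (fun x hx ↦ ?_)
      (by simpa using ht₀) (by simpa using ht) (by simpa using h) (neg_le_neg hle)
    · simpa using this
    · have h1 := HasDerivWithinAt.scomp x (hf (-x) hx) ((hasDerivAt_neg x).hasDerivWithinAt)
        (mapsTo_preimage _ _)
      simpa [Function.comp_def] using h1
    · simpa using hK (-x) hx

end Gronwall

/-! ### Velocities of curves in a chart. -/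

section Chart

variable {G : Type*} [NormedAddCommGroup G] [NormedSpace ℝ G]
  {H : Type*} [TopologicalSpace H] {J : ModelWithCorners ℝ G H}
  {N : Type*} [TopologicalSpace N] [ChartedSpace H N] [IsManifold J ∞ N]

theorem hasDerivWithinAt_extChartAt_comp {x : N} {s : ℝ → N} {I : Set ℝ} {t : ℝ}
    {z : TangentSpace J (s t)} (ht : s t ∈ (extChartAt J x).source)
    (hs : HasMFDerivWithinAt 𝓘(ℝ, ℝ) J s I t ((1 : ℝ →L[ℝ] ℝ).smulRight z)) :
    HasDerivWithinAt (fun r ↦ extChartAt J x (s r)) (dchart J x (s t) z) I t := by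
  have h : HasFDerivWithinAt (fun r ↦ extChartAt J x (s r))
      ((1 : ℝ →L[ℝ] ℝ).smulRight (dchart J x (s t) z) : ℝ →L[ℝ] G) I t := by
    refine HasMFDerivWithinAt.hasFDerivWithinAt (HasMFDerivWithinAt.congr_mfderiv
      ((hasMFDerivAt_extChartAt_dchart ht).comp_hasMFDerivWithinAt t hs) ?_)
    ext
    exact map_smul (dchart J x (s t)) (1 : ℝ) z
  simpa using HasFDerivWithinAt.hasDerivWithinAt (F := G) h

end Chart

/-! ### Uniqueness of parallel sections. -/

section Uniqueness

variable {EB : Type*} [NormedAddCommGroup EB] [NormedSpace ℝ EB] [FiniteDimensional ℝ EB]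
  {F : Type*} [NormedAddCommGroup F] [NormedSpace ℝ F] [FiniteDimensional ℝ F]
  {M : Type*} [TopologicalSpace M] [ChartedSpace EB M]
  {V : M → Type*} [∀ x, AddCommGroup (V x)] [∀ x, Module ℝ (V x)] [∀ x, TopologicalSpace (V x)]
  [TopologicalSpace (TotalSpace F V)] [FiberBundle F V]
  [VectorBundle ℝ F V] [IsManifold 𝓘(ℝ, EB) ∞ M] [ContMDiffVectorBundle ∞ F V 𝓘(ℝ, EB)]
  [T2Space (TotalSpace F V)] {Ω : Opens (TotalSpace F V)} (C : NonlinearConnection EB Ω)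

namespace NonlinearConnection

-- In a chart the difference of two parallel sections solves a homogeneous linear equation. Its
-- coefficient involves only the projected velocity, here the continuous field `X` along the curve,
-- so it is bounded near `t₀` even though the velocity of `γ` need not be continuous. The conclusion
-- is an equivalence so that it can be propagated in either direction.
set_option synthInstance.maxHeartbeats 200000 in
theorem eventually_parallel_eq_iff {X : (x : M) → TangentSpace 𝓘(ℝ, EB) x}
    (hX : ContMDiff 𝓘(ℝ, EB) 𝓘(ℝ, EB).tangent ∞ (fun x ↦ (⟨x, X x⟩ : TangentBundle 𝓘(ℝ, EB) M)))
    {I : Set ℝ} (hI : I.OrdConnected) {γ s₁ s₂ : ℝ → TotalSpace F V}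
    (hγ : ∀ t ∈ I, ∀ z : TE EB (γ t), HasMFDerivWithinAt 𝓘(ℝ, ℝ) (𝓘(ℝ, EB).prod 𝓘(ℝ, F)) γ I t
      ((1 : ℝ →L[ℝ] ℝ).smulRight z) → tproj EB (γ t) z = X (γ t).proj)
    (h₁ : IsParallelAlong EB Ω C.linearization γ s₁ I)
    (h₂ : IsParallelAlong EB Ω C.linearization γ s₂ I) {t₀ : ℝ} (ht₀ : t₀ ∈ I) :
    ∀ᶠ t in nhdsWithin t₀ I, (s₁ t₀ = s₂ t₀ ↔ s₁ t = s₂ t) := by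
  set p₀ := γ t₀ with hp₀
  set Ψ := extChartAt (𝓘(ℝ, EB).prod 𝓘(ℝ, F)) p₀ with hΨ
  have hp₀s : p₀ ∈ Ψ.source := mem_extChartAt_source p₀
  have hpΩ : p₀ ∈ Ω := by
    obtain ⟨z, z', -, -, hz⟩ := h₁ t₀ ht₀
    exact (C.dchart_of_mem_horizontalSet hz).1
  have hγc : ContinuousWithinAt γ I t₀ := by
    obtain ⟨z, z', hz, -⟩ := h₁ t₀ ht₀
    exact hz.continuousWithinAt
  set A : EB × F → (EB × F →L[ℝ] EB →L[ℝ] F) := fun y ↦ fderiv ℝ (C.coef p₀) y with hA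
  set ξ : TotalSpace F V → EB := fun p ↦ dchart 𝓘(ℝ, EB) p₀.proj p.proj (X p.proj) with hξ
  have hAc : ContinuousAt (fun p ↦ A (Ψ p)) p₀ :=
    (((C.contDiffAt_coef hp₀s hpΩ).fderiv_right (m := ∞) (by simp)).continuousAt).comp
      (continuousAt_extChartAt p₀)
  have hξc : ContinuousAt ξ p₀ := by
    have h1 := (contMDiffAt_field_iff (mem_extChartAt_source p₀.proj)).1 (hX p₀.proj)
    exact ContinuousAt.comp (f := fun p : TotalSpace F V ↦ p.proj) h1.continuousAt
      (FiberBundle.continuous_proj F V).continuousAt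
  -- The added `1` makes the bound strict at `p₀`, hence valid nearby by continuity.
  set K : ℝ := ‖A (Ψ p₀)‖ * ‖ξ p₀‖ + 1 with hK
  have hbound : ∀ᶠ p in nhds p₀, ‖A (Ψ p)‖ * ‖ξ p‖ < K := by
    have h1 : ContinuousAt (fun p ↦ ‖A (Ψ p)‖) p₀ :=
      ContinuousAt.norm (E := EB × F →L[ℝ] EB →L[ℝ] F) hAc
    have h2 : ContinuousAt (fun p ↦ ‖A (Ψ p)‖ * ‖ξ p‖) p₀ := h1.mul hξc.norm
    exact h2.eventually_lt continuousAt_const (lt_add_one _)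
  have hev : ∀ᶠ t in nhdsWithin t₀ I, γ t ∈ Ψ.source ∧ ‖A (Ψ (γ t))‖ * ‖ξ (γ t)‖ < K :=
    hγc.eventually ((Filter.eventually_of_mem
      (extChartAt_source_mem_nhds (I := 𝓘(ℝ, EB).prod 𝓘(ℝ, F)) p₀) fun _ h ↦ h).and hbound)
  obtain ⟨δ, hδ, hδ'⟩ := Metric.mem_nhdsWithin_iff.1 hev
  set S : Set ℝ := Metric.ball t₀ δ ∩ I with hS
  have hSord : S.OrdConnected := (convex_ball t₀ δ).ordConnected.inter hI
  have hsol : ∀ s, IsParallelAlong EB Ω C.linearization γ s I → ∀ t ∈ S,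
      s t ∈ Ψ.source ∧ (s t).proj = (γ t).proj ∧
      HasDerivWithinAt (fun r ↦ (Ψ (s r)).2) (A (Ψ (γ t)) (0, (Ψ (s t)).2) (ξ (γ t))) S t := by
    intro s hs t ht
    obtain ⟨z, z', hz, hz', hh⟩ := hs t ht.2
    obtain ⟨-, hproj, hd⟩ := C.dchart_of_mem_horizontalSet hh
    have hγs := (hδ' ht).1
    have hss : s t ∈ Ψ.source := by
      rw [hΨ, mem_extChartAt_source_iff, hproj]
      exact mem_extChartAt_source_iff.1 hγs
    have h2 := (hasDerivWithinAt_extChartAt_comp hss hz').mono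
      (inter_subset_right (s := Metric.ball t₀ δ))
    rw [hd p₀ hγs, dchart_fst hγs, hγ t ht.2 z hz] at h2
    exact ⟨hss, hproj, ((ContinuousLinearMap.snd ℝ EB F).hasFDerivAt.comp_hasDerivWithinAt t h2)⟩
  have hiff : ∀ t ∈ S, ((Ψ (s₁ t)).2 - (Ψ (s₂ t)).2 = 0 ↔ s₁ t = s₂ t) := by
    intro t ht
    obtain ⟨h1s, h1p, -⟩ := hsol s₁ h₁ t ht
    obtain ⟨h2s, h2p, -⟩ := hsol s₂ h₂ t ht
    refine ⟨fun h ↦ Ψ.injOn h1s h2s (Prod.ext ?_ (sub_eq_zero.1 h)), fun h ↦ by rw [h, sub_self]⟩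
    rw [hΨ, extChartAt_fst h1s, extChartAt_fst h2s, h1p, h2p]
  have hzero : ∀ t ∈ S, ∀ t' ∈ S, (Ψ (s₁ t)).2 - (Ψ (s₂ t)).2 = 0 →
      (Ψ (s₁ t')).2 - (Ψ (s₂ t')).2 = 0 := by
    intro t ht t' ht' h
    refine eq_zero_of_norm_hasDerivWithinAt_le (f := fun r ↦ (Ψ (s₁ r)).2 - (Ψ (s₂ r)).2)
      (f' := fun r ↦ A (Ψ (γ r)) (0, (Ψ (s₁ r)).2 - (Ψ (s₂ r)).2) (ξ (γ r))) (K := K) hSord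
      (fun r hr ↦ ?_) (fun r hr ↦ ?_) ht ht' h
    · have h1 := (hsol s₁ h₁ r hr).2.2.sub (hsol s₂ h₂ r hr).2.2
      have h2 : A (Ψ (γ r)) (0, (Ψ (s₁ r)).2 - (Ψ (s₂ r)).2) (ξ (γ r)) =
          A (Ψ (γ r)) (0, (Ψ (s₁ r)).2) (ξ (γ r)) - A (Ψ (γ r)) (0, (Ψ (s₂ r)).2) (ξ (γ r)) := by
        rw [← sub_apply, ← map_sub]
        simp
      rw [h2]
      exact h1
    · have h1 : ‖((0 : EB), (Ψ (s₁ r)).2 - (Ψ (s₂ r)).2)‖ = ‖(Ψ (s₁ r)).2 - (Ψ (s₂ r)).2‖ := by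
        simp
      calc _ ≤ ‖A (Ψ (γ r))‖ * ‖((0 : EB), (Ψ (s₁ r)).2 - (Ψ (s₂ r)).2)‖ * ‖ξ (γ r)‖ :=
            (A (Ψ (γ r))).le_opNorm₂ _ _
        _ = ‖A (Ψ (γ r))‖ * ‖ξ (γ r)‖ * ‖(Ψ (s₁ r)).2 - (Ψ (s₂ r)).2‖ := by rw [h1]; ring
        _ ≤ _ := mul_le_mul_of_nonneg_right (hδ' hr).2.le (norm_nonneg _)
  have ht₀S : t₀ ∈ S := ⟨Metric.mem_ball_self hδ, ht₀⟩
  filter_upwards [Metric.mem_nhdsWithin_iff.2 ⟨δ, hδ, subset_rfl⟩] with t ht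
  rw [← hiff t₀ ht₀S, ← hiff t ht]
  exact ⟨hzero t₀ ht₀S t ht, hzero t ht t₀ ht₀S⟩

/-- Uniqueness of parallel sections of the linearization along a curve whose projection is an
integral curve of a smooth vector field. -/
theorem parallel_eq {X : (x : M) → TangentSpace 𝓘(ℝ, EB) x}
    (hX : ContMDiff 𝓘(ℝ, EB) 𝓘(ℝ, EB).tangent ∞ (fun x ↦ (⟨x, X x⟩ : TangentBundle 𝓘(ℝ, EB) M)))
    {I : Set ℝ} (hI : I.OrdConnected) {γ s₁ s₂ : ℝ → TotalSpace F V}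
    (hγ : ∀ t ∈ I, ∀ z : TE EB (γ t), HasMFDerivWithinAt 𝓘(ℝ, ℝ) (𝓘(ℝ, EB).prod 𝓘(ℝ, F)) γ I t
      ((1 : ℝ →L[ℝ] ℝ).smulRight z) → tproj EB (γ t) z = X (γ t).proj)
    (h₁ : IsParallelAlong EB Ω C.linearization γ s₁ I)
    (h₂ : IsParallelAlong EB Ω C.linearization γ s₂ I) {a b : ℝ} (ha : a ∈ I) (hb : b ∈ I)
    (h : s₁ a = s₂ a) : s₁ b = s₂ b := by
  -- The relation "agreement at `t` is equivalent to agreement at `t'`" is transitive and holds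
  -- locally, hence on the whole interval.
  have := hI.isPreconnected.induction₂' (fun t t' ↦ (s₁ t = s₂ t ↔ s₁ t' = s₂ t'))
    (fun t ht ↦ (C.eventually_parallel_eq_iff hX hI hγ h₁ h₂ ht).mono fun _ h ↦ ⟨h, h.symm⟩)
    (fun _ _ _ _ _ _ h h' ↦ h.trans h') ha hb
  exact this.1 h

end NonlinearConnection

end Uniqueness

/-! ### Rule (V) for the linearization. -/

section Rules

variable {EB : Type*} [NormedAddCommGroup EB] [NormedSpace ℝ EB] [FiniteDimensional ℝ EB]
  {F : Type*} [NormedAddCommGroup F] [NormedSpace ℝ F] [FiniteDimensional ℝ F]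
  {M : Type*} [TopologicalSpace M] [ChartedSpace EB M]
  {V : M → Type*} [∀ x, AddCommGroup (V x)] [∀ x, Module ℝ (V x)] [∀ x, TopologicalSpace (V x)]
  [TopologicalSpace (TotalSpace F V)] [FiberBundle F V]
  [VectorBundle ℝ F V] [IsManifold 𝓘(ℝ, EB) ∞ M] [ContMDiffVectorBundle ∞ F V 𝓘(ℝ, EB)]
  [T2Space (TotalSpace F V)] {Ω : Opens (TotalSpace F V)} (C : NonlinearConnection EB Ω)

theorem hasMFDerivAt_proj (p : TotalSpace F V) :
    HasMFDerivAt (𝓘(ℝ, EB).prod 𝓘(ℝ, F)) 𝓘(ℝ, EB) (π F V) p (tproj EB p) :=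
  ((Bundle.contMDiff_proj V (n := ∞)).mdifferentiableAt (by simp)).hasMFDerivAt

theorem hasMFDerivWithinAt_proj_comp {γ : ℝ → TotalSpace F V} {I : Set ℝ} {t : ℝ}
    {z : TE EB (γ t)} (h : HasMFDerivWithinAt 𝓘(ℝ, ℝ) (𝓘(ℝ, EB).prod 𝓘(ℝ, F)) γ I t
      ((1 : ℝ →L[ℝ] ℝ).smulRight z)) :
    HasMFDerivWithinAt 𝓘(ℝ, ℝ) 𝓘(ℝ, EB) (fun t ↦ (γ t).proj) I t
      ((1 : ℝ →L[ℝ] ℝ).smulRight (tproj EB (γ t) z)) := by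
  refine HasMFDerivWithinAt.congr_mfderiv
    ((hasMFDerivAt_proj (γ t)).comp_hasMFDerivWithinAt t h) ?_
  ext
  exact map_smul (tproj EB (γ t)) (1 : ℝ) z

/-- The segment must be nondegenerate: within a single point every vector is a derivative. -/
theorem tproj_eq_of_hasMFDerivWithinAt {γ : ℝ → TotalSpace F V} {a b t : ℝ} (hab : a ≠ b)
    (ht : t ∈ uIcc a b) {z : TE EB (γ t)} {x : TangentSpace 𝓘(ℝ, EB) (γ t).proj}
    (h : HasMFDerivWithinAt 𝓘(ℝ, ℝ) (𝓘(ℝ, EB).prod 𝓘(ℝ, F)) γ (uIcc a b) t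
      ((1 : ℝ →L[ℝ] ℝ).smulRight z))
    (h' : HasMFDerivWithinAt 𝓘(ℝ, ℝ) 𝓘(ℝ, EB) (fun t ↦ (γ t).proj) (uIcc a b) t
      ((1 : ℝ →L[ℝ] ℝ).smulRight x)) : tproj EB (γ t) z = x := by
  have hu : UniqueMDiffWithinAt 𝓘(ℝ, ℝ) (uIcc a b) t :=
    (uniqueDiffOn_uIcc hab t ht).uniqueMDiffWithinAt
  have h1 := DFunLike.congr_fun (hu.eq (hasMFDerivWithinAt_proj_comp h) h') (1 : ℝ)
  exact (one_smul ℝ _).symm.trans (h1.trans (one_smul ℝ _))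

theorem hasMFDerivWithinAt_proj_of_eq {γ : ℝ → TotalSpace F V} {I : Set ℝ} {t : ℝ} (ht : t ∈ I)
    {m : M} (hm : ∀ t ∈ I, (γ t).proj = m) :
    HasMFDerivWithinAt 𝓘(ℝ, ℝ) 𝓘(ℝ, EB) (fun t ↦ (γ t).proj) I t
      ((1 : ℝ →L[ℝ] ℝ).smulRight (0 : TangentSpace 𝓘(ℝ, EB) (γ t).proj)) := by
  have h1 : HasMFDerivWithinAt 𝓘(ℝ, ℝ) 𝓘(ℝ, EB) (fun _ : ℝ ↦ m) I t
      (0 : TangentSpace 𝓘(ℝ, ℝ) t →L[ℝ] TangentSpace 𝓘(ℝ, EB) m) := hasMFDerivWithinAt_const _ _ _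
  refine HasMFDerivWithinAt.congr_mfderiv (h1.congr_of_eventuallyEq
    (eventually_nhdsWithin_of_forall hm) (hm t ht)) ?_
  ext
  exact (smul_zero (A := EB) (1 : ℝ)).symm

theorem contMDiff_zero_field : ContMDiff 𝓘(ℝ, EB) 𝓘(ℝ, EB).tangent ∞
    (fun x ↦ (⟨x, 0⟩ : TangentBundle 𝓘(ℝ, EB) M)) := fun x ↦ by
  rw [contMDiffAt_field_iff (mem_extChartAt_source x)]
  simp only [map_zero]
  exact contMDiffAt_const

namespace NonlinearConnection

/-- The projected velocity is zero, so the parallel equation reads `s' = 0`. -/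
theorem isParallelAlong_const {m : M} {γ : ℝ → TotalSpace F V} {a b : ℝ}
    (hγ : ContMDiffOn 𝓘(ℝ, ℝ) (𝓘(ℝ, EB).prod 𝓘(ℝ, F)) ∞ γ (uIcc a b))
    (hm : ∀ t ∈ uIcc a b, γ t ∈ Ω ∧ (γ t).proj = m) (v : V m) :
    IsParallelAlong EB Ω C.linearization γ (fun _ ↦ ⟨m, v⟩) (uIcc a b) := by
  intro t ht
  obtain ⟨z, hz, hz0⟩ : ∃ z : TE EB (γ t),
      HasMFDerivWithinAt 𝓘(ℝ, ℝ) (𝓘(ℝ, EB).prod 𝓘(ℝ, F)) γ (uIcc a b) t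
        ((1 : ℝ →L[ℝ] ℝ).smulRight z) ∧ tproj EB (γ t) z = 0 := by
    -- On a degenerate segment any vector serves as the velocity, and zero is a vertical one.
    by_cases hab : a = b
    · subst hab
      rw [uIcc_self, mem_singleton_iff] at ht
      subst ht
      refine ⟨0, ?_, map_zero _⟩
      rw [uIcc_self]
      refine ⟨continuousWithinAt_singleton, HasFDerivWithinAt.of_subsingleton (E := ℝ)
        (F := EB × F) fun x hx y hy ↦ ?_⟩
      exact (show x = t from hx.1).trans (show y = t from hy.1).symm
    · have h1 := ((hγ t ht).mdifferentiableWithinAt (by simp)).hasMFDerivWithinAt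
      have h2 : HasMFDerivWithinAt 𝓘(ℝ, ℝ) (𝓘(ℝ, EB).prod 𝓘(ℝ, F)) γ (uIcc a b) t
          ((1 : ℝ →L[ℝ] ℝ).smulRight
            (mfderivWithin 𝓘(ℝ, ℝ) (𝓘(ℝ, EB).prod 𝓘(ℝ, F)) γ (uIcc a b) t (1 : ℝ))) := by
        refine h1.congr_mfderiv ?_
        ext
        exact (one_smul ℝ _).symm
      refine ⟨_, h2, tproj_eq_of_hasMFDerivWithinAt hab ht h2
        (hasMFDerivWithinAt_proj_of_eq ht fun s hs ↦ (hm s hs).2)⟩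
  refine ⟨z, 0, hz, (hasMFDerivWithinAt_const _ _ _).congr_mfderiv ?_,
    C.mem_horizontalSet_of_dchart (hm t ht).1 (hm t ht).2.symm ?_⟩
  · ext
    exact (smul_zero (A := EB × F) (1 : ℝ)).symm
  · rw [dchart_fst (mem_extChartAt_source _), hz0, map_zero, map_zero, map_zero]
    rfl

/-- The projection of a curve in a fibre is an integral curve of `X = 0`, so `parallel_eq` compares
any parallel section with the constant one. -/
theorem verticalRule_linearization : VerticalRule EB Ω C.linearization := by
  intro m γ a b hγ hm v w
  have hc := C.isParallelAlong_const hγ hm v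
  constructor
  · rintro ⟨s, hs, hsa, rfl⟩
    by_cases hab : a = b
    · rw [← hab, hsa]
    refine C.parallel_eq contMDiff_zero_field ordConnected_uIcc (fun t ht z hz ↦
      tproj_eq_of_hasMFDerivWithinAt hab ht hz
      (hasMFDerivWithinAt_proj_of_eq ht fun s hs ↦ (hm s hs).2)) hs hc left_mem_uIcc right_mem_uIcc
      hsa
  · rintro rfl
    exact ⟨_, hc, rfl, rfl⟩

end NonlinearConnection

/-! ### Flows of horizontal lifts. -/

section Flow

variable [T2Space M] {X : (x : M) → TangentSpace 𝓘(ℝ, EB) x}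

theorem NonlinearConnection.contMDiffOn_horizontalLift
    (hX : ContMDiff 𝓘(ℝ, EB) 𝓘(ℝ, EB).tangent ∞
      (fun x ↦ (⟨x, X x⟩ : TangentBundle 𝓘(ℝ, EB) M))) :
    SmoothField EB Ω (C.horizontalLift X) :=
  fun p hp ↦ (C.contMDiffAt_horizontalLift hp (hX p.proj)).contMDiffWithinAt

namespace NonlinearConnection

/-- The flow of a horizontal lift maps fibres into fibres. -/
theorem proj_flow_eq (hX : ContMDiff 𝓘(ℝ, EB) 𝓘(ℝ, EB).tangent ∞
      (fun x ↦ (⟨x, X x⟩ : TangentBundle 𝓘(ℝ, EB) M)))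
    {t : ℝ} {p q : TotalSpace F V} (hp : (t, p) ∈ flowDomain Ω (C.horizontalLift X))
    (hq : (t, q) ∈ flowDomain Ω (C.horizontalLift X)) (h : p.proj = q.proj) :
    (flow Ω (C.horizontalLift X) t p).proj = (flow Ω (C.horizontalLift X) t q).proj := by
  have hE : CompleteSpace EB := FiniteDimensional.complete ℝ EB
  have hF : CompleteSpace F := FiniteDimensional.complete ℝ F
  have hY := C.contMDiffOn_horizontalLift hX
  -- Trajectories of `X^H` project to integral curves of `X`, which are determined by their starting
  -- points in `M`.
  have key : ∀ p : TotalSpace F V, (t, p) ∈ flowDomain Ω (C.horizontalLift X) →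
      ∃ a b : ℝ, (0 : ℝ) ∈ Ioo a b ∧ t ∈ Ioo a b ∧
        (flow Ω (C.horizontalLift X) 0 p).proj = p.proj ∧
        IsMIntegralCurveOn (fun s ↦ (flow Ω (C.horizontalLift X) s p).proj) X (Ioo a b) := by
    intro p hp
    obtain ⟨a, b, h0, ht, -, hΩ, hz, hd⟩ := exists_isMIntegralCurveOn_flow hY hp
    refine ⟨a, b, h0, ht, congrArg _ hz, fun s hs ↦ ?_⟩
    have h1 := hasMFDerivWithinAt_proj_comp (hd s hs).hasMFDerivWithinAt (I := Ioo a b)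
    rwa [horizontalLift, C.tproj_hlift _ (hΩ s hs)] at h1
  obtain ⟨a, b, h0, ht, hz, hc⟩ := key p hp
  obtain ⟨a', b', h0', ht', hz', hc'⟩ := key q hq
  have hI : Ioo (max a a') (min b b') ⊆ Ioo a b :=
    Ioo_subset_Ioo (le_max_left _ _) (min_le_left _ _)
  have hI' : Ioo (max a a') (min b b') ⊆ Ioo a' b' :=
    Ioo_subset_Ioo (le_max_right _ _) (min_le_right _ _)
  exact integralCurve_eqOn (Ω := (⊤ : Opens M)) hX.contMDiffOn (t₀ := 0)
    ⟨max_lt h0.1 h0'.1, lt_min h0.2 h0'.2⟩ (fun _ _ ↦ trivial) (hc.mono hI) (hc'.mono hI')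
    (by rw [hz, hz', h]) ⟨max_lt ht.1 ht'.1, lt_min ht.2 ht'.2⟩

/-- The tangent map of the flow of a horizontal lift preserves vertical vectors. -/
theorem tproj_mfderiv_flow_verticalLift (hX : ContMDiff 𝓘(ℝ, EB) 𝓘(ℝ, EB).tangent ∞
      (fun x ↦ (⟨x, X x⟩ : TangentBundle 𝓘(ℝ, EB) M)))
    {t : ℝ} {p : TotalSpace F V} (hp : (t, p) ∈ flowDomain Ω (C.horizontalLift X))
    (b : V p.proj) :
    tproj EB (flow Ω (C.horizontalLift X) t p) (mfderiv (𝓘(ℝ, EB).prod 𝓘(ℝ, F))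
      (𝓘(ℝ, EB).prod 𝓘(ℝ, F)) (flow Ω (C.horizontalLift X) t) p (verticalLift EB p b)) = 0 := by
  have hE : CompleteSpace EB := FiniteDimensional.complete ℝ EB
  have hF : CompleteSpace F := FiniteDimensional.complete ℝ F
  have hY := C.contMDiffOn_horizontalLift hX
  obtain ⟨hev, hd⟩ := eventually_mem_flowDomain_and_mdifferentiableAt hY hp
  have hline := hasMFDerivAt_fiber_line (EB := EB) p b
  have hp0 : (⟨p.proj, p.2 + (0 : ℝ) • b⟩ : TotalSpace F V) = p := by rw [zero_smul, add_zero]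
  have h1 : HasMFDerivAt (𝓘(ℝ, EB).prod 𝓘(ℝ, F)) 𝓘(ℝ, EB)
      (fun q ↦ (flow Ω (C.horizontalLift X) t q).proj)
      (⟨p.proj, p.2 + (0 : ℝ) • b⟩ : TotalSpace F V)
      ((tproj EB (flow Ω (C.horizontalLift X) t p)).comp (mfderiv (𝓘(ℝ, EB).prod 𝓘(ℝ, F))
        (𝓘(ℝ, EB).prod 𝓘(ℝ, F)) (flow Ω (C.horizontalLift X) t) p)) := by
    rw [hp0]
    exact (hasMFDerivAt_proj _).comp p hd.hasMFDerivAt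
  have h2 := h1.comp (0 : ℝ) hline
  -- Along the line through `p` in its fibre the projected flow is constant near `0`, so its
  -- derivative `Tπ(Tφ_t(ξ^V(p, b)))` vanishes.
  have h3 : ((fun q ↦ (flow Ω (C.horizontalLift X) t q).proj) ∘
      fun s : ℝ ↦ (⟨p.proj, p.2 + s • b⟩ : TotalSpace F V)) =ᶠ[nhds 0]
      fun _ ↦ (flow Ω (C.horizontalLift X) t p).proj := by
    have hc := hline.continuousAt
    rw [ContinuousAt, hp0] at hc
    filter_upwards [hc.eventually hev] with s hs
    exact C.proj_flow_eq hX hs hp rfl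
  have h4 := hasMFDerivAt_unique h2
    ((hasMFDerivAt_const (I := 𝓘(ℝ, ℝ)) (I' := 𝓘(ℝ, EB))
      (flow Ω (C.horizontalLift X) t p).proj (0 : ℝ)).congr_of_eventuallyEq h3)
  have h5 := DFunLike.congr_fun h4 (1 : ℝ)
  have h6 : tproj EB (flow Ω (C.horizontalLift X) t p) (mfderiv (𝓘(ℝ, EB).prod 𝓘(ℝ, F))
      (𝓘(ℝ, EB).prod 𝓘(ℝ, F)) (flow Ω (C.horizontalLift X) t) p
        ((1 : ℝ) • verticalLift EB p b)) = 0 := h5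
  rwa [one_smul] at h6

/-- `ψ_t` is the fibre derivative of `φ_t`. -/
theorem verticalLift_psi (hX : ContMDiff 𝓘(ℝ, EB) 𝓘(ℝ, EB).tangent ∞
      (fun x ↦ (⟨x, X x⟩ : TangentBundle 𝓘(ℝ, EB) M)))
    {t : ℝ} {p : TotalSpace F V} (hp : (t, p) ∈ flowDomain Ω (C.horizontalLift X))
    (b : V p.proj) :
    verticalLift EB (flow Ω (C.horizontalLift X) t p) (C.psi X t p b) =
      mfderiv (𝓘(ℝ, EB).prod 𝓘(ℝ, F)) (𝓘(ℝ, EB).prod 𝓘(ℝ, F))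
        (flow Ω (C.horizontalLift X) t) p (verticalLift EB p b) := by
  obtain ⟨c, hc⟩ := (exists_verticalLift_eq_iff EB _ _).2
    (C.tproj_mfderiv_flow_verticalLift hX hp b)
  rw [psi, ← hc, C.connector_verticalLift]

/-- In the chart `X^H = (x, A x)`, where `x` represents `X` and depends only on the base variable; a
fibre derivative therefore falls on `A` alone. This identifies the variational equation on vertical
vectors with the parallel equation. -/
theorem fderiv_chartField_horizontalLift (hX : ContMDiff 𝓘(ℝ, EB) 𝓘(ℝ, EB).tangent ∞
      (fun x ↦ (⟨x, X x⟩ : TangentBundle 𝓘(ℝ, EB) M)))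
    {p : TotalSpace F V} (hp : p ∈ Ω) (b : F) :
    (fderiv ℝ (chartField (𝓘(ℝ, EB).prod 𝓘(ℝ, F)) p (C.horizontalLift X))
      (extChartAt (𝓘(ℝ, EB).prod 𝓘(ℝ, F)) p p) (0, b)).2 =
    fderiv ℝ (C.coef p) (extChartAt (𝓘(ℝ, EB).prod 𝓘(ℝ, F)) p p) (0, b)
      (dchart (𝓘(ℝ, EB).prod 𝓘(ℝ, F)) p p (C.horizontalLift X p)).1 := by
  set Ψ := extChartAt (𝓘(ℝ, EB).prod 𝓘(ℝ, F)) p with hΨ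
  have hps : p ∈ Ψ.source := mem_extChartAt_source p
  have hps' := mem_extChartAt_source (I := 𝓘(ℝ, EB)) p.proj
  set x := chartField 𝓘(ℝ, EB) p.proj X with hx
  have hmem : ∀ᶠ y in nhds (Ψ p), Ψ.symm y ∈ Ω := by
    refine (contMDiffAt_extChartAt_symm (mem_extChartAt_target p)).continuousAt.eventually_mem ?_
    rw [extChartAt_to_inv]
    exact Ω.isOpen.mem_nhds hp
  have hfst : ∀ y ∈ Ψ.target, (extChartAt 𝓘(ℝ, EB) p.proj).symm y.1 = (Ψ.symm y).proj := by
    intro y hy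
    have hs := Ψ.map_target hy
    have h1 := extChartAt_fst hs
    rw [← hΨ, Ψ.right_inv hy] at h1
    rw [h1, PartialEquiv.left_inv _ (mem_extChartAt_source_iff.1 hs).1]
  have hval : ∀ y ∈ Ψ.target, Ψ.symm y ∈ Ω →
      chartField (𝓘(ℝ, EB).prod 𝓘(ℝ, F)) p (C.horizontalLift X) y =
        (x y.1, C.coef p y (x y.1)) := by
    intro y hy hyΩ
    have h1 := C.dchart_hlift (Ψ.map_target hy) hyΩ (X (Ψ.symm y).proj)
    rw [← hΨ, Ψ.right_inv hy] at h1
    have h2 : x y.1 = dchart 𝓘(ℝ, EB) p.proj (Ψ.symm y).proj (X (Ψ.symm y).proj) := by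
      rw [hx, chartField, hfst y hy]
    rw [h2]
    exact h1
  have hev : chartField (𝓘(ℝ, EB).prod 𝓘(ℝ, F)) p (C.horizontalLift X) =ᶠ[nhds (Ψ p)]
      fun y ↦ (x y.1, C.coef p y (x y.1)) := by
    filter_upwards [extChartAt_target_mem_nhds p, hmem] with y hy hyΩ using hval y hy hyΩ
  have hxd : HasFDerivAt x (fderiv ℝ x (Ψ p).1) (Ψ p).1 := by
    rw [hΨ, extChartAt_fst hps]
    exact ((contDiffAt_chartField hps' (hX p.proj)).differentiableAt (by simp)).hasFDerivAt
  have hxd' := hxd.comp (Ψ p) (hasFDerivAt_fst (𝕜 := ℝ) (p := Ψ p))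
  have hA := ((C.contDiffAt_coef hps hp).differentiableAt (by simp)).hasFDerivAt
  have h0 : (dchart (𝓘(ℝ, EB).prod 𝓘(ℝ, F)) p p (C.horizontalLift X p)).1 = x (Ψ p).1 := by
    have h1 : (chartField (𝓘(ℝ, EB).prod 𝓘(ℝ, F)) p (C.horizontalLift X) (Ψ p)).1 = x (Ψ p).1 :=
      congrArg Prod.fst (hval (Ψ p) (Ψ.map_source hps) (by rwa [Ψ.left_inv hps]))
    rw [← h1, chartField, ← hΨ, Ψ.left_inv hps]
  have hfd := (hxd'.prodMk (hA.clm_apply hxd')).fderiv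
  rw [hev.fderiv_eq, h0]
  have h2 := congrArg Prod.snd (DFunLike.congr_fun hfd ((0 : EB), b))
  refine h2.trans ?_
  simp
  rfl

end NonlinearConnection

end Flow

end Rules

/-! ### From coordinate derivatives back to velocities of curves. -/

section Chart

variable {G : Type*} [NormedAddCommGroup G] [NormedSpace ℝ G]
  {H : Type*} [TopologicalSpace H] {J : ModelWithCorners ℝ G H} [J.Boundaryless]
  {N : Type*} [TopologicalSpace N] [ChartedSpace H N] [IsManifold J ∞ N]

/-- A curve in a chart domain is differentiable if its coordinate representation is. -/
theorem exists_hasMFDerivAt_of_extChartAt_comp {x : N} {s : ℝ → N} {t : ℝ} {c : G}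
    (hs : ∀ᶠ r in nhds t, s r ∈ (extChartAt J x).source)
    (hd : HasDerivAt (fun r ↦ extChartAt J x (s r)) c t) :
    ∃ z : TangentSpace J (s t), HasMFDerivAt 𝓘(ℝ, ℝ) J s t ((1 : ℝ →L[ℝ] ℝ).smulRight z) ∧
      dchart J x (s t) z = c := by
  have hst := hs.self_of_nhds
  have h1 := hasMFDerivAt_extChartAt_symm ((extChartAt J x).map_source hst)
  rw [(extChartAt J x).left_inv hst] at h1
  have h2 := h1.comp t hd.hasFDerivAt.hasMFDerivAt
  refine ⟨(dchart J x (s t)).inverse c, ?_, dchart_inverse hst c⟩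
  have h3 : s =ᶠ[nhds t] (extChartAt J x).symm ∘ fun r ↦ extChartAt J x (s r) :=
    hs.mono fun r hr ↦ ((extChartAt J x).left_inv hr).symm
  refine HasMFDerivAt.congr_mfderiv (h2.congr_of_eventuallyEq h3) ?_
  ext
  exact map_smul (dchart J x (s t)).inverse (1 : ℝ) c

end Chart

/-! ### Rule (H) for the linearization. -/

section Rules

variable {EB : Type*} [NormedAddCommGroup EB] [NormedSpace ℝ EB] [FiniteDimensional ℝ EB]
  {F : Type*} [NormedAddCommGroup F] [NormedSpace ℝ F] [FiniteDimensional ℝ F]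
  {M : Type*} [TopologicalSpace M] [ChartedSpace EB M]
  {V : M → Type*} [∀ x, AddCommGroup (V x)] [∀ x, Module ℝ (V x)] [∀ x, TopologicalSpace (V x)]
  [TopologicalSpace (TotalSpace F V)] [FiberBundle F V]
  [VectorBundle ℝ F V] [IsManifold 𝓘(ℝ, EB) ∞ M] [ContMDiffVectorBundle ∞ F V 𝓘(ℝ, EB)]
  [T2Space (TotalSpace F V)] {Ω : Opens (TotalSpace F V)} (C : NonlinearConnection EB Ω)
  [T2Space M] {X : (x : M) → TangentSpace 𝓘(ℝ, EB) x}

namespace NonlinearConnection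

/-- The section `ψ_s(p, v)` along `s ↦ φ_s(p)`. -/
noncomputable def psiCurve (X : (x : M) → TangentSpace 𝓘(ℝ, EB) x) (p : TotalSpace F V)
    (v : V p.proj) (s : ℝ) : TotalSpace F V :=
  ⟨(flow Ω (C.horizontalLift X) s p).proj, C.psi X s p v⟩

/-- Since `ψ_s(p, v)` lifts to `Tφ_s(ξ^V(p, v))`, its fibre coordinate is that of the differentiated
flow, whose time derivative is known. -/
theorem extChartAt_psiCurve (hX : ContMDiff 𝓘(ℝ, EB) 𝓘(ℝ, EB).tangent ∞
      (fun x ↦ (⟨x, X x⟩ : TangentBundle 𝓘(ℝ, EB) M)))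
    {s : ℝ} {p p₀ : TotalSpace F V} (hs : (s, p) ∈ flowDomain Ω (C.horizontalLift X))
    (h : flow Ω (C.horizontalLift X) s p ∈ (extChartAt (𝓘(ℝ, EB).prod 𝓘(ℝ, F)) p₀).source)
    (v : V p.proj) :
    C.psiCurve X p v s ∈ (extChartAt (𝓘(ℝ, EB).prod 𝓘(ℝ, F)) p₀).source ∧
    extChartAt (𝓘(ℝ, EB).prod 𝓘(ℝ, F)) p₀ (C.psiCurve X p v s) =
      ((extChartAt (𝓘(ℝ, EB).prod 𝓘(ℝ, F)) p₀ (flow Ω (C.horizontalLift X) s p)).1,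
        (dchart (𝓘(ℝ, EB).prod 𝓘(ℝ, F)) p₀ (flow Ω (C.horizontalLift X) s p)
          (mfderiv (𝓘(ℝ, EB).prod 𝓘(ℝ, F)) (𝓘(ℝ, EB).prod 𝓘(ℝ, F))
            (flow Ω (C.horizontalLift X) s) p (verticalLift EB p v))).2) := by
  have h1 : C.psiCurve X p v s ∈ (extChartAt (𝓘(ℝ, EB).prod 𝓘(ℝ, F)) p₀).source :=
    mem_extChartAt_source_iff.2 (mem_extChartAt_source_iff.1 h :)
  refine ⟨h1, ?_⟩
  rw [psiCurve] at h1 ⊢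
  rw [extChartAt_mk h1, extChartAt_fst h, ← C.verticalLift_psi hX hs, dchart_verticalLift h]

/-- The curve `ψ_s(p, v)` is parallel along `φ_s(p)`. -/
theorem exists_hasMFDerivAt_psiCurve (hX : ContMDiff 𝓘(ℝ, EB) 𝓘(ℝ, EB).tangent ∞
      (fun x ↦ (⟨x, X x⟩ : TangentBundle 𝓘(ℝ, EB) M)))
    {s₀ : ℝ} {p : TotalSpace F V} (hs₀ : (s₀, p) ∈ flowDomain Ω (C.horizontalLift X))
    (v : V p.proj) :
    ∃ z' : TE EB (C.psiCurve X p v s₀),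
      HasMFDerivAt 𝓘(ℝ, ℝ) (𝓘(ℝ, EB).prod 𝓘(ℝ, F)) (C.psiCurve X p v) s₀
        ((1 : ℝ →L[ℝ] ℝ).smulRight z') ∧
      ((⟨flow Ω (C.horizontalLift X) s₀ p,
          C.horizontalLift X (flow Ω (C.horizontalLift X) s₀ p)⟩, ⟨C.psiCurve X p v s₀, z'⟩) :
        TangentBundle (𝓘(ℝ, EB).prod 𝓘(ℝ, F)) (TotalSpace F V) ×
          TangentBundle (𝓘(ℝ, EB).prod 𝓘(ℝ, F)) (TotalSpace F V)) ∈
        horizontalSet EB Ω C.linearization := by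
  have hE : CompleteSpace EB := FiniteDimensional.complete ℝ EB
  have hF : CompleteSpace F := FiniteDimensional.complete ℝ F
  have hY := C.contMDiffOn_horizontalLift hX
  set p₁ := flow Ω (C.horizontalLift X) s₀ p with hp₁
  set w := mfderiv (𝓘(ℝ, EB).prod 𝓘(ℝ, F)) (𝓘(ℝ, EB).prod 𝓘(ℝ, F))
    (flow Ω (C.horizontalLift X) s₀) p (verticalLift EB p v) with hw
  set Ψ := extChartAt (𝓘(ℝ, EB).prod 𝓘(ℝ, F)) p₁ with hΨ
  have hp₁s : p₁ ∈ Ψ.source := mem_extChartAt_source p₁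
  have hp₁Ω : p₁ ∈ Ω := flow_mem hY hs₀
  obtain ⟨a, b, -, hsab, hdom, hΩ, -, hd⟩ := exists_isMIntegralCurveOn_flow hY hs₀
  have hγ := hd s₀ hsab
  have hw1 : dchart (𝓘(ℝ, EB).prod 𝓘(ℝ, F)) p₁ p₁ w =
      ((0 : EB), fiberTriv p₁.proj p₁.proj (C.psi X s₀ p v)) := by
    rw [hw, ← C.verticalLift_psi hX hs₀, dchart_verticalLift hp₁s]
  have h1 := hasDerivAt_mfderiv_flow hY hp₁Ω w
  rw [hw1] at h1
  have h2 : HasDerivAt (fun s ↦ Ψ (flow Ω (C.horizontalLift X) s p))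
      (dchart (𝓘(ℝ, EB).prod 𝓘(ℝ, F)) p₁ p₁ (C.horizontalLift X p₁)) s₀ := by
    have := hasDerivWithinAt_extChartAt_comp (I := univ)
      (s := fun s ↦ flow Ω (C.horizontalLift X) s p)
      hp₁s (hγ.hasMFDerivWithinAt)
    rwa [hasDerivWithinAt_univ] at this
  have h3 := HasDerivAt.comp_sub_const s₀ s₀ (f := fun t ↦ dchart (𝓘(ℝ, EB).prod 𝓘(ℝ, F)) p₁
    (flow Ω (C.horizontalLift X) t p₁) (mfderiv (𝓘(ℝ, EB).prod 𝓘(ℝ, F)) (𝓘(ℝ, EB).prod 𝓘(ℝ, F))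
      (flow Ω (C.horizontalLift X) t) p₁ w)) (by rw [sub_self]; exact h1)
  have hsrc : ∀ᶠ s in nhds s₀, flow Ω (C.horizontalLift X) s p ∈ Ψ.source ∧
      (s, p) ∈ flowDomain Ω (C.horizontalLift X) :=
    (hγ.continuousAt.eventually_mem (extChartAt_source_mem_nhds p₁)).and
      (Filter.eventually_of_mem (Ioo_mem_nhds hsab.1 hsab.2) hdom)
  -- The cocycle identity `Tφ_s = Tφ_{s - s₀} ∘ Tφ_{s₀}` reduces the derivative at `s₀` to the
  -- variational equation at time `0`, started at `p₁`.
  have hcoc : ∀ᶠ s in nhds s₀,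
      dchart (𝓘(ℝ, EB).prod 𝓘(ℝ, F)) p₁ (flow Ω (C.horizontalLift X) s p)
        (mfderiv (𝓘(ℝ, EB).prod 𝓘(ℝ, F)) (𝓘(ℝ, EB).prod 𝓘(ℝ, F))
          (flow Ω (C.horizontalLift X) s) p (verticalLift EB p v)) =
      dchart (𝓘(ℝ, EB).prod 𝓘(ℝ, F)) p₁ (flow Ω (C.horizontalLift X) (s - s₀) p₁)
        (mfderiv (𝓘(ℝ, EB).prod 𝓘(ℝ, F)) (𝓘(ℝ, EB).prod 𝓘(ℝ, F))
          (flow Ω (C.horizontalLift X) (s - s₀)) p₁ w) := by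
    have ht : Filter.Tendsto (fun s ↦ s - s₀) (nhds s₀) (nhds 0) := by
      have : ContinuousAt (fun s : ℝ ↦ s - s₀) s₀ := by fun_prop
      rwa [ContinuousAt, sub_self] at this
    filter_upwards [ht.eventually (eventually_mfderiv_flow_eq hY hs₀)] with s hs
    obtain ⟨-, hs1, hs2⟩ := hs
    rw [add_sub_cancel] at hs1 hs2
    rw [hs2.mfderiv, ← hs1]
    rfl
  have hc : HasDerivAt (fun s ↦ Ψ (C.psiCurve X p v s))
      ((dchart (𝓘(ℝ, EB).prod 𝓘(ℝ, F)) p₁ p₁ (C.horizontalLift X p₁)).1,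
        fderiv ℝ (C.coef p₁) (Ψ p₁) (0, fiberTriv p₁.proj p₁.proj (C.psi X s₀ p v))
          (dchart (𝓘(ℝ, EB).prod 𝓘(ℝ, F)) p₁ p₁ (C.horizontalLift X p₁)).1) s₀ := by
    have h4 := ((ContinuousLinearMap.fst ℝ EB F).hasFDerivAt.comp_hasDerivAt s₀ h2).prodMk
      ((ContinuousLinearMap.snd ℝ EB F).hasFDerivAt.comp_hasDerivAt s₀ h3)
    have h5 := C.fderiv_chartField_horizontalLift hX hp₁Ω
      (fiberTriv p₁.proj p₁.proj (C.psi X s₀ p v))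
    rw [← hΨ] at h5
    rw [← h5]
    refine h4.congr_of_eventuallyEq ?_
    filter_upwards [hsrc, hcoc] with s hs hs'
    rw [hΨ, (C.extChartAt_psiCurve hX hs.2 hs.1 v).2, hs']
    rfl
  obtain ⟨z', hz', hz'c⟩ := exists_hasMFDerivAt_of_extChartAt_comp
    (hsrc.mono fun s hs ↦ (C.extChartAt_psiCurve hX hs.2 hs.1 v).1) hc
  refine ⟨z', hz', C.mem_horizontalSet_of_dchart hp₁Ω rfl ?_⟩
  have hps : C.psiCurve X p v s₀ ∈ Ψ.source := (C.extChartAt_psiCurve hX hs₀ hp₁s v).1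
  rw [hz'c, ← hΨ]
  have h6 : (Ψ (C.psiCurve X p v s₀)).2 = fiberTriv p₁.proj p₁.proj (C.psi X s₀ p v) := by
    rw [psiCurve] at hps ⊢
    rw [hΨ, extChartAt_mk hps]
  rw [h6]

theorem isParallelAlong_psiCurve (hX : ContMDiff 𝓘(ℝ, EB) 𝓘(ℝ, EB).tangent ∞
      (fun x ↦ (⟨x, X x⟩ : TangentBundle 𝓘(ℝ, EB) M)))
    {t : ℝ} {p : TotalSpace F V} (ht : (t, p) ∈ flowDomain Ω (C.horizontalLift X))
    (v : V p.proj) :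
    IsParallelAlong EB Ω C.linearization (fun s ↦ flow Ω (C.horizontalLift X) s p)
      (C.psiCurve X p v) (uIcc 0 t) := by
  have hE : CompleteSpace EB := FiniteDimensional.complete ℝ EB
  have hF : CompleteSpace F := FiniteDimensional.complete ℝ F
  obtain ⟨a, b, h0, htab, hdom, -, -, hd⟩ :=
    exists_isMIntegralCurveOn_flow (C.contMDiffOn_horizontalLift hX) ht
  intro s hs
  have hsab : s ∈ Ioo a b := ordConnected_Ioo.uIcc_subset h0 htab hs
  obtain ⟨z', hz', hh⟩ := C.exists_hasMFDerivAt_psiCurve hX (hdom s hsab) v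
  exact ⟨_, z', (hd s hsab).hasMFDerivWithinAt, hz'.hasMFDerivWithinAt, hh⟩

/-- The identity is needed on a neighbourhood of `p`, so that it passes to the tangent map of `φ_0`
in `psiCurve_zero`. -/
theorem flow_zero (hX : ContMDiff 𝓘(ℝ, EB) 𝓘(ℝ, EB).tangent ∞
      (fun x ↦ (⟨x, X x⟩ : TangentBundle 𝓘(ℝ, EB) M)))
    {p : TotalSpace F V} (hp : p ∈ Ω) :
    (0, p) ∈ flowDomain Ω (C.horizontalLift X) ∧
      ∀ᶠ q in nhds p, flow Ω (C.horizontalLift X) 0 q = q := by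
  have hE : CompleteSpace EB := FiniteDimensional.complete ℝ EB
  have hF : CompleteSpace F := FiniteDimensional.complete ℝ F
  have hY := C.contMDiffOn_horizontalLift hX
  obtain ⟨ε, hε, W, hW, -⟩ := exists_flow_local hY hp
  have h := hW.mono fun q hq ↦ (hq 0 (by simpa using hε)).1
  refine ⟨h.self_of_nhds, h.mono fun q hq ↦ ?_⟩
  obtain ⟨a, b, -, -, -, -, hz, -⟩ := exists_isMIntegralCurveOn_flow hY hq
  exact hz

theorem psiCurve_zero (hX : ContMDiff 𝓘(ℝ, EB) 𝓘(ℝ, EB).tangent ∞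
      (fun x ↦ (⟨x, X x⟩ : TangentBundle 𝓘(ℝ, EB) M)))
    {p : TotalSpace F V} (hp : p ∈ Ω) (v : V p.proj) :
    C.psiCurve X p v 0 = ⟨p.proj, v⟩ := by
  obtain ⟨h0, h⟩ := C.flow_zero hX hp
  have hp0 : flow Ω (C.horizontalLift X) 0 p = p := h.self_of_nhds
  have hps : p ∈ (extChartAt (𝓘(ℝ, EB).prod 𝓘(ℝ, F)) p).source := mem_extChartAt_source p
  have h1 := C.extChartAt_psiCurve hX (p₀ := p) h0 (by rw [hp0]; exact hps) v
  have hs : (⟨p.proj, v⟩ : TotalSpace F V) ∈ (extChartAt (𝓘(ℝ, EB).prod 𝓘(ℝ, F)) p).source :=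
    mem_extChartAt_source_iff.2 (mem_extChartAt_source_iff.1 hps :)
  refine (extChartAt (𝓘(ℝ, EB).prod 𝓘(ℝ, F)) p).injOn h1.1 hs ?_
  have h2 : HasMFDerivAt (𝓘(ℝ, EB).prod 𝓘(ℝ, F)) (𝓘(ℝ, EB).prod 𝓘(ℝ, F))
      (flow Ω (C.horizontalLift X) 0) p (ContinuousLinearMap.id ℝ _) :=
    (hasMFDerivAt_id p).congr_of_eventuallyEq h
  have h3 : dchart (𝓘(ℝ, EB).prod 𝓘(ℝ, F)) p (flow Ω (C.horizontalLift X) 0 p)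
      (mfderiv (𝓘(ℝ, EB).prod 𝓘(ℝ, F)) (𝓘(ℝ, EB).prod 𝓘(ℝ, F))
        (flow Ω (C.horizontalLift X) 0) p (verticalLift EB p v)) =
      dchart (𝓘(ℝ, EB).prod 𝓘(ℝ, F)) p p (verticalLift EB p v) := by
    have key : ∀ q, q = p → ∀ u : EB × F, dchart (𝓘(ℝ, EB).prod 𝓘(ℝ, F)) p q u =
        dchart (𝓘(ℝ, EB).prod 𝓘(ℝ, F)) p p u := by
      rintro _ rfl u
      rfl
    rw [h2.mfderiv]
    exact key _ hp0 _
  rw [h1.2, h3, hp0, dchart_verticalLift hps, extChartAt_fst hps, extChartAt_mk hs]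

theorem horizontalRule_linearization : HorizontalRule C C.linearization := by
  intro X hX t p ht v w
  have hE : CompleteSpace EB := FiniteDimensional.complete ℝ EB
  have hF : CompleteSpace F := FiniteDimensional.complete ℝ F
  have hψ := C.isParallelAlong_psiCurve hX ht v
  obtain ⟨a, b, h0, htab, hdom, hΩ, hz, hd⟩ :=
    exists_isMIntegralCurveOn_flow (C.contMDiffOn_horizontalLift hX) ht
  have hp : p ∈ Ω := by rw [← hz]; exact hΩ 0 h0
  have hψ0 := C.psiCurve_zero hX hp v
  constructor
  · rintro ⟨s, hs, hs0, rfl⟩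
    -- For `t = 0` the velocity within the segment is not unique, so `parallel_eq` is not available;
    -- the initial value already gives the claim.
    by_cases h0t : 0 = t
    · subst h0t
      rw [hs0, ← hψ0]
      rfl
    refine C.parallel_eq hX ordConnected_uIcc (fun r hr z hz ↦
      tproj_eq_of_hasMFDerivWithinAt h0t hr hz ?_) hs hψ left_mem_uIcc right_mem_uIcc
      (hs0.trans hψ0.symm)
    have hrab : r ∈ Ioo a b := ordConnected_Ioo.uIcc_subset h0 htab hr
    have h1 := hasMFDerivWithinAt_proj_comp (hd r hrab).hasMFDerivWithinAt (I := uIcc 0 t)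
    rwa [horizontalLift, C.tproj_hlift _ (hΩ r hrab)] at h1
  · rintro rfl
    exact ⟨_, hψ, hψ0, rfl⟩

end NonlinearConnection

end Rules

/-! ### Tensoriality of covariant derivatives and of their differences. -/

section Tensoriality

variable {EB : Type*} [NormedAddCommGroup EB] [NormedSpace ℝ EB] [FiniteDimensional ℝ EB]
  {F : Type*} [NormedAddCommGroup F] [NormedSpace ℝ F] [FiniteDimensional ℝ F]
  {M : Type*} [TopologicalSpace M] [ChartedSpace EB M]
  {V : M → Type*} [∀ x, AddCommGroup (V x)] [∀ x, Module ℝ (V x)] [∀ x, TopologicalSpace (V x)]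
  [TopologicalSpace (TotalSpace F V)] [FiberBundle F V]
  [VectorBundle ℝ F V] [IsManifold 𝓘(ℝ, EB) ∞ M] [ContMDiffVectorBundle ∞ F V 𝓘(ℝ, EB)]
  [T2Space (TotalSpace F V)] {Ω : Opens (TotalSpace F V)}

theorem smoothField_zero : SmoothField EB Ω (fun _ : TotalSpace F V ↦ 0) := by
  rw [smoothField_iff]
  intro p _
  simp only [map_zero]
  exact contMDiffAt_const

theorem smoothSection_zero :
    SmoothSection EB Ω (fun p : TotalSpace F V ↦ (0 : V p.proj)) := by
  rw [smoothSection_iff]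
  intro p _
  unfold secRep
  simp only [map_zero]
  exact contDiffAt_const

theorem SmoothField.sum {ι : Type*} {s : Finset ι} {U : ι → (p : TotalSpace F V) → TE EB p}
    (hU : ∀ i, SmoothField EB Ω (U i)) : SmoothField EB Ω (fun q ↦ ∑ i ∈ s, U i q) := by
  classical
  induction s using Finset.induction_on with
  | empty => simpa only [Finset.sum_empty] using smoothField_zero
  | insert i s hi ih =>
    simp only [Finset.sum_insert hi]
    exact (hU i).add ih

theorem SmoothSection.sum {ι : Type*} {s : Finset ι} {σ : ι → (p : TotalSpace F V) → V p.proj}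
    (hσ : ∀ i, SmoothSection EB Ω (σ i)) : SmoothSection EB Ω (fun q ↦ ∑ i ∈ s, σ i q) := by
  classical
  induction s using Finset.induction_on with
  | empty => simpa only [Finset.sum_empty] using smoothSection_zero
  | insert i s hi ih =>
    simp only [Finset.sum_insert hi]
    exact (hσ i).add ih

/-- A smooth field is, up to a part vanishing to second order near `p`, a combination of global
smooth fields. -/
theorem SmoothField.exists_eq_sum {U : (p : TotalSpace F V) → TE EB p} (hU : SmoothField EB Ω U)
    (p : TotalSpace F V) : ∃ (n : ℕ) (χ : TotalSpace F V → ℝ) (f : Fin n → TotalSpace F V → ℝ)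
      (e : Fin n → (q : TotalSpace F V) → TE EB q),
      ContMDiffOn (𝓘(ℝ, EB).prod 𝓘(ℝ, F)) 𝓘(ℝ, ℝ) ∞ χ Ω ∧
      (∀ i, ContMDiffOn (𝓘(ℝ, EB).prod 𝓘(ℝ, F)) 𝓘(ℝ, ℝ) ∞ (f i) Ω) ∧
      (∀ i, SmoothField EB Ω (e i)) ∧ χ p = 0 ∧ (U p = 0 → ∀ i, f i p = 0) ∧
      U = fun q ↦ χ q • U q + ∑ i, f i q • e i q := by
  obtain ⟨χ⟩ : Nonempty (SmoothBumpFunction (𝓘(ℝ, EB).prod 𝓘(ℝ, F)) p) := inferInstance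
  set b := Module.finBasis ℝ (EB × F) with hb
  set c : Fin _ → TotalSpace F V → ℝ := fun i q ↦
    b.coord i (dchart (𝓘(ℝ, EB).prod 𝓘(ℝ, F)) p q (U q)) with hc
  -- The decomposition is `U = (1 - χ²) U + ∑ (χ cᵢ)(χ eᵢ)`: the coefficients and the frame are
  -- smooth only on the chart domain, and each needs its own factor `χ`.
  refine ⟨_, fun q ↦ 1 - χ q * χ q, fun i q ↦ χ q • c i q, fun i q ↦ χ q •
    (dchart (𝓘(ℝ, EB).prod 𝓘(ℝ, F)) p q).inverse (b i), ?_, fun i q hq ↦ ?_, fun i q hq ↦ ?_,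
    ?_, fun h0 i ↦ ?_, ?_⟩
  · exact (contMDiff_const.sub (χ.contMDiff.mul χ.contMDiff)).contMDiffOn
  · refine (contMDiffAt_bump_smul χ fun hqs ↦ ?_).contMDiffWithinAt
    exact (((b.coord i).toContinuousLinearMap.contMDiff (n := ∞)).contMDiffAt).comp q
      ((contMDiffAt_field_iff hqs).1 (smoothField_contMDiffAt hU hq))
  · exact (contMDiffAt_bump_smul_field χ fun hqs ↦
      contMDiffAt_inverse_dchart hqs (b i)).contMDiffWithinAt
  · simp only [χ.eq_one, mul_one, sub_self]
  · simp only [hc, h0, map_zero, smul_zero]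
  · funext q
    by_cases hq : q ∈ (extChartAt (𝓘(ℝ, EB).prod 𝓘(ℝ, F)) p).source
    · have h1 : ∑ i, c i q • (dchart (𝓘(ℝ, EB).prod 𝓘(ℝ, F)) p q).inverse (b i) = U q := by
        refine dchart_injective hq ?_
        rw [map_sum]
        simp only [map_smul, dchart_inverse hq]
        exact b.sum_repr _
      have h2 : ∑ i, (χ q • c i q) • χ q • (dchart (𝓘(ℝ, EB).prod 𝓘(ℝ, F)) p q).inverse (b i) =
          (χ q * χ q) • U q := by
        rw [← h1, Finset.smul_sum]
        refine Finset.sum_congr rfl fun i _ ↦ ?_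
        rw [smul_smul, smul_smul, smul_eq_mul]
        congr 1
        ring
      rw [h2, ← add_smul, sub_add_cancel, one_smul]
    · have h0 : χ q = 0 := by
        by_contra h
        exact hq (by
          rw [extChartAt_source]
          exact χ.support_subset_source h)
      simp [h0]

theorem contMDiffAt_clm_fiberTriv {p q : TotalSpace F V}
    (hq : q ∈ (extChartAt (𝓘(ℝ, EB).prod 𝓘(ℝ, F)) p).source)
    {σ : (p : TotalSpace F V) → V p.proj}
    (hσ : ContMDiffAt (𝓘(ℝ, EB).prod 𝓘(ℝ, F)) (𝓘(ℝ, EB).prod 𝓘(ℝ, F)) ∞ (asMap σ) q)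
    (L : F →L[ℝ] ℝ) :
    ContMDiffAt (𝓘(ℝ, EB).prod 𝓘(ℝ, F)) 𝓘(ℝ, ℝ) ∞
      (fun q ↦ L (fiberTriv p.proj q.proj (σ q))) q := by
  have h : ContMDiffAt (𝓘(ℝ, EB).prod 𝓘(ℝ, F)) 𝓘(ℝ, F) ∞
      (fun q ↦ fiberTriv (F := F) p.proj q.proj (σ q)) q :=
    (contDiffAt_comp_extChartAt_symm hq).1 ((contMDiffAt_asMap_iff hq).1 hσ)
  exact (L.contMDiff (n := ∞)).contMDiffAt.comp q h

theorem contDiffAt_secRep_symmL {p q : TotalSpace F V}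
    (hq : q ∈ (extChartAt (𝓘(ℝ, EB).prod 𝓘(ℝ, F)) p).source) (b : F) :
    ContDiffAt ℝ ∞
      (secRep EB p fun q ↦ (trivializationAt F V p.proj).symmL ℝ q.proj b)
      (extChartAt (𝓘(ℝ, EB).prod 𝓘(ℝ, F)) p q) := by
  refine (contDiffAt_const (c := b)).congr_of_eventuallyEq ?_
  have ht := (extChartAt (𝓘(ℝ, EB).prod 𝓘(ℝ, F)) p).map_source hq
  filter_upwards [extChartAt_target_mem_nhds' ht] with y hy
  exact Trivialization.continuousLinearMapAt_symmL _
    (mem_extChartAt_source_iff.1 ((extChartAt (𝓘(ℝ, EB).prod 𝓘(ℝ, F)) p).map_target hy)).2 _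

/-- A smooth section is, up to a part vanishing to second order near `p`, a combination of global
smooth sections. -/
theorem SmoothSection.exists_eq_sum {σ : (p : TotalSpace F V) → V p.proj}
    (hσ : SmoothSection EB Ω σ)
    (p : TotalSpace F V) : ∃ (n : ℕ) (χ : TotalSpace F V → ℝ) (f : Fin n → TotalSpace F V → ℝ)
      (e : Fin n → (q : TotalSpace F V) → V q.proj),
      ContMDiffOn (𝓘(ℝ, EB).prod 𝓘(ℝ, F)) 𝓘(ℝ, ℝ) ∞ χ Ω ∧
      (∀ i, ContMDiffOn (𝓘(ℝ, EB).prod 𝓘(ℝ, F)) 𝓘(ℝ, ℝ) ∞ (f i) Ω) ∧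
      (∀ i, SmoothSection EB Ω (e i)) ∧ χ p = 0 ∧ (σ p = 0 → ∀ i, f i p = 0) ∧
      σ = fun q ↦ χ q • σ q + ∑ i, f i q • e i q := by
  obtain ⟨χ⟩ : Nonempty (SmoothBumpFunction (𝓘(ℝ, EB).prod 𝓘(ℝ, F)) p) := inferInstance
  set b := Module.finBasis ℝ F with hb
  set c : Fin _ → TotalSpace F V → ℝ := fun i q ↦
    b.coord i (fiberTriv p.proj q.proj (σ q)) with hc
  refine ⟨_, fun q ↦ 1 - χ q * χ q, fun i q ↦ χ q • c i q, fun i q ↦ χ q •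
    (trivializationAt F V p.proj).symmL ℝ q.proj (b i), ?_, fun i q hq ↦ ?_, fun i q hq ↦ ?_,
    ?_, fun h0 i ↦ ?_, ?_⟩
  · exact (contMDiff_const.sub (χ.contMDiff.mul χ.contMDiff)).contMDiffOn
  · refine (contMDiffAt_bump_smul χ fun hqs ↦ ?_).contMDiffWithinAt
    exact contMDiffAt_clm_fiberTriv hqs (smoothSection_contMDiffAt hσ hq)
      (b.coord i).toContinuousLinearMap
  · exact (contMDiffAt_bump_smul_section χ fun hqs ↦
      contDiffAt_secRep_symmL hqs (b i)).contMDiffWithinAt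
  · simp only [χ.eq_one, mul_one, sub_self]
  · simp only [hc, h0, map_zero, smul_zero]
  · funext q
    by_cases hq : q ∈ (extChartAt (𝓘(ℝ, EB).prod 𝓘(ℝ, F)) p).source
    · have hq' := (mem_extChartAt_source_iff.1 hq).2
      have h1 : ∑ i, c i q • (trivializationAt F V p.proj).symmL ℝ q.proj (b i) = σ q := by
        refine fiberTriv_injective hq' ?_
        rw [map_sum]
        simp only [map_smul, Trivialization.continuousLinearMapAt_symmL _ hq']
        exact b.sum_repr _
      have h2 : ∑ i, (χ q • c i q) • χ q • (trivializationAt F V p.proj).symmL ℝ q.proj (b i) =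
          (χ q * χ q) • σ q := by
        rw [← h1, Finset.smul_sum]
        refine Finset.sum_congr rfl fun i _ ↦ ?_
        rw [smul_smul, smul_smul, smul_eq_mul]
        congr 1
        ring
      rw [h2, ← add_smul, sub_add_cancel, one_smul]
    · have h0 : χ q = 0 := by
        by_contra h
        exact hq (by
          rw [extChartAt_source]
          exact χ.support_subset_source h)
      simp [h0]

namespace IsCovariantDerivative

variable {D D' : ((p : TotalSpace F V) → TE EB p) → ((p : TotalSpace F V) → V p.proj) →
  (p : TotalSpace F V) → V p.proj}

theorem sum_field (hD : IsCovariantDerivative EB Ω D) {ι : Type*} (s : Finset ι)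
    {U : ι → (p : TotalSpace F V) → TE EB p} (hU : ∀ i, SmoothField EB Ω (U i))
    {σ : (p : TotalSpace F V) → V p.proj} (hσ : SmoothSection EB Ω σ) {p : TotalSpace F V}
    (hp : p ∈ Ω) : D (fun q ↦ ∑ i ∈ s, U i q) σ p = ∑ i ∈ s, D (U i) σ p := by
  classical
  induction s using Finset.induction_on with
  | empty =>
    simp only [Finset.sum_empty]
    have := hD.smul_field (fun _ ↦ 0) (fun _ ↦ 0) σ contMDiffOn_const smoothField_zero hσ p hp
    simpa only [smul_zero, zero_smul] using this
  | insert i s hi ih =>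
    simp only [Finset.sum_insert hi]
    rw [hD.add_field (U i) _ σ (hU i) (SmoothField.sum hU) hσ p hp, ih]

/-- In the decomposition of `U` every scalar coefficient vanishes at `p`, and linearity over
functions pulls these coefficients out. -/
theorem eq_zero_of_field_eq_zero (hD : IsCovariantDerivative EB Ω D)
    {U : (p : TotalSpace F V) → TE EB p} (hU : SmoothField EB Ω U)
    {σ : (p : TotalSpace F V) → V p.proj} (hσ : SmoothSection EB Ω σ) {p : TotalSpace F V}
    (hp : p ∈ Ω) (h : U p = 0) : D U σ p = 0 := by
  obtain ⟨n, χ, f, e, hχ, hf, he, hχp, hfp, hsum⟩ := hU.exists_eq_sum p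
  rw [hsum, hD.add_field _ _ σ (hU.smul hχ) (SmoothField.sum fun i ↦ (he i).smul (hf i)) hσ p hp,
    hD.sum_field _ (fun i ↦ (he i).smul (hf i)) hσ hp, hD.smul_field χ U σ hχ hU hσ p hp, hχp,
    zero_smul, zero_add]
  refine Finset.sum_eq_zero fun i _ ↦ ?_
  rw [hD.smul_field (f i) (e i) σ (hf i) (he i) hσ p hp, hfp h i, zero_smul]

/-- The value of `D_U σ` at `p` depends on `U` only through `U p`. -/
theorem congr_field (hD : IsCovariantDerivative EB Ω D)
    {U U' : (p : TotalSpace F V) → TE EB p} (hU : SmoothField EB Ω U) (hU' : SmoothField EB Ω U')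
    {σ : (p : TotalSpace F V) → V p.proj} (hσ : SmoothSection EB Ω σ) {p : TotalSpace F V}
    (hp : p ∈ Ω) (h : U p = U' p) : D U σ p = D U' σ p := by
  have hn : SmoothField EB Ω (fun q ↦ (-1 : ℝ) • U' q) :=
    SmoothField.smul (f := fun _ ↦ -1) contMDiffOn_const hU'
  have h1 := hD.eq_zero_of_field_eq_zero (hU.add hn) hσ hp (by simp [h])
  rw [hD.add_field U _ σ hU hn hσ p hp,
    hD.smul_field (fun _ ↦ -1) U' σ contMDiffOn_const hU' hσ p hp, neg_one_smul] at h1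
  exact add_neg_eq_zero.1 h1

/-- The Leibniz terms containing the derivative of `f` are the same for both operators and cancel.
-/
theorem sub_smul_section (hD : IsCovariantDerivative EB Ω D) (hD' : IsCovariantDerivative EB Ω D')
    {U : (p : TotalSpace F V) → TE EB p} (hU : SmoothField EB Ω U)
    {f : TotalSpace F V → ℝ} (hf : ContMDiffOn (𝓘(ℝ, EB).prod 𝓘(ℝ, F)) 𝓘(ℝ, ℝ) ∞ f Ω)
    {σ : (p : TotalSpace F V) → V p.proj} (hσ : SmoothSection EB Ω σ) {p : TotalSpace F V}
    (hp : p ∈ Ω) : D U (fun q ↦ f q • σ q) p - D' U (fun q ↦ f q • σ q) p =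
      f p • (D U σ p - D' U σ p) := by
  rw [hD.leibniz f U σ hf hU hσ p hp, hD'.leibniz f U σ hf hU hσ p hp, smul_sub]
  abel

theorem sub_sum_section (hD : IsCovariantDerivative EB Ω D) (hD' : IsCovariantDerivative EB Ω D')
    {U : (p : TotalSpace F V) → TE EB p} (hU : SmoothField EB Ω U) {ι : Type*} (s : Finset ι)
    {σ : ι → (p : TotalSpace F V) → V p.proj} (hσ : ∀ i, SmoothSection EB Ω (σ i))
    {p : TotalSpace F V} (hp : p ∈ Ω) :
    D U (fun q ↦ ∑ i ∈ s, σ i q) p - D' U (fun q ↦ ∑ i ∈ s, σ i q) p =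
      ∑ i ∈ s, (D U (σ i) p - D' U (σ i) p) := by
  classical
  induction s using Finset.induction_on with
  | empty =>
    simp only [Finset.sum_empty]
    have := hD.sub_smul_section hD' hU (f := fun _ ↦ 0) contMDiffOn_const smoothSection_zero hp
    simpa only [smul_zero, zero_smul] using this
  | insert i s hi ih =>
    simp only [Finset.sum_insert hi]
    rw [hD.add_section U (σ i) _ hU (hσ i) (SmoothSection.sum hσ) p hp,
      hD'.add_section U (σ i) _ hU (hσ i) (SmoothSection.sum hσ) p hp, ← ih]
    abel

theorem sub_eq_zero_of_section_eq_zero (hD : IsCovariantDerivative EB Ω D)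
    (hD' : IsCovariantDerivative EB Ω D') {U : (p : TotalSpace F V) → TE EB p}
    (hU : SmoothField EB Ω U) {σ : (p : TotalSpace F V) → V p.proj} (hσ : SmoothSection EB Ω σ)
    {p : TotalSpace F V} (hp : p ∈ Ω) (h : σ p = 0) : D U σ p - D' U σ p = 0 := by
  obtain ⟨n, χ, f, e, hχ, hf, he, hχp, hfp, hsum⟩ := hσ.exists_eq_sum p
  have hs := SmoothSection.sum (s := Finset.univ) fun i ↦ (he i).smul (hf i)
  rw [hsum, hD.add_section U _ _ hU (hσ.smul hχ) hs p hp,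
    hD'.add_section U _ _ hU (hσ.smul hχ) hs p hp, add_sub_add_comm,
    hD.sub_smul_section hD' hU hχ hσ hp,
    hD.sub_sum_section hD' hU _ (fun i ↦ (he i).smul (hf i)) hp, hχp, zero_smul, zero_add]
  refine Finset.sum_eq_zero fun i _ ↦ ?_
  rw [hD.sub_smul_section hD' hU (hf i) (he i) hp, hfp h i, zero_smul]

/-- The difference of two covariant derivatives is tensorial in the section. -/
theorem sub_congr_section (hD : IsCovariantDerivative EB Ω D)
    (hD' : IsCovariantDerivative EB Ω D') {U : (p : TotalSpace F V) → TE EB p}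
    (hU : SmoothField EB Ω U) {σ σ' : (p : TotalSpace F V) → V p.proj}
    (hσ : SmoothSection EB Ω σ) (hσ' : SmoothSection EB Ω σ')
    {p : TotalSpace F V} (hp : p ∈ Ω) (h : σ p = σ' p) :
    D U σ p - D' U σ p = D U σ' p - D' U σ' p := by
  have hn : SmoothSection EB Ω (fun q ↦ (-1 : ℝ) • σ' q) :=
    SmoothSection.smul (f := fun _ ↦ -1) contMDiffOn_const hσ'
  have h1 := hD.sub_eq_zero_of_section_eq_zero hD' hU (hσ.add hn) hp (by simp [h])
  have h2 := hD.sub_smul_section hD' hU (f := fun _ ↦ -1) contMDiffOn_const hσ' hp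
  rw [hD.add_section U σ _ hU hσ hn p hp, hD'.add_section U σ _ hU hσ hn p hp, add_sub_add_comm,
    h2, neg_one_smul] at h1
  exact add_neg_eq_zero.1 h1

end IsCovariantDerivative

end Tensoriality

/-! ### The two rules determine the covariant derivative. -/

section Characterization

variable {EB : Type*} [NormedAddCommGroup EB] [NormedSpace ℝ EB] [FiniteDimensional ℝ EB]
  {F : Type*} [NormedAddCommGroup F] [NormedSpace ℝ F] [FiniteDimensional ℝ F]
  {M : Type*} [TopologicalSpace M] [ChartedSpace EB M]
  {V : M → Type*} [∀ x, AddCommGroup (V x)] [∀ x, Module ℝ (V x)] [∀ x, TopologicalSpace (V x)]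
  [TopologicalSpace (TotalSpace F V)] [FiberBundle F V]
  [VectorBundle ℝ F V] [IsManifold 𝓘(ℝ, EB) ∞ M] [ContMDiffVectorBundle ∞ F V 𝓘(ℝ, EB)]
  [T2Space (TotalSpace F V)] {Ω : Opens (TotalSpace F V)} (C : NonlinearConnection EB Ω)
  {D : ((p : TotalSpace F V) → TE EB p) → ((p : TotalSpace F V) → V p.proj) →
    (p : TotalSpace F V) → V p.proj}

theorem IsParallelAlong.mono {γ s : ℝ → TotalSpace F V} {I I' : Set ℝ}
    (h : IsParallelAlong EB Ω D γ s I) (hI : I' ⊆ I) : IsParallelAlong EB Ω D γ s I' := by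
  intro t ht
  obtain ⟨z, z', hz, hz', hh⟩ := h t (hI ht)
  exact ⟨z, z', hz.mono hI, hz'.mono hI, hh⟩

theorem tangentBundle_mk_congr {p q : TotalSpace F V} (h : p = q) (u : EB × F) :
    (⟨p, u⟩ : TangentBundle (𝓘(ℝ, EB).prod 𝓘(ℝ, F)) (TotalSpace F V)) = ⟨q, u⟩ := by
  rw [h]

namespace NonlinearConnection

/-- If a section is parallel both for `D` and for the linearization along a curve, then the
horizontal vectors of `D` and of the linearization agree at the initial point. -/
theorem exists_common_horizontal {γ s s' : ℝ → TotalSpace F V} {δ : ℝ} (hδ : 0 < δ)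
    (h : IsParallelAlong EB Ω D γ s (uIcc 0 δ))
    (h' : IsParallelAlong EB Ω C.linearization γ s' (uIcc 0 δ))
    (hs : EqOn s s' (uIcc 0 δ)) {z : TE EB (γ 0)}
    (hz : HasMFDerivAt 𝓘(ℝ, ℝ) (𝓘(ℝ, EB).prod 𝓘(ℝ, F)) γ 0 ((1 : ℝ →L[ℝ] ℝ).smulRight z)) :
    ∃ U σ, SmoothField EB Ω U ∧ SmoothSection EB Ω σ ∧ D U σ (γ 0) = 0 ∧
      C.linearization U σ (γ 0) = 0 ∧ U (γ 0) = z ∧ asMap σ (γ 0) = s 0 := by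
  have h0 : (0 : ℝ) ∈ uIcc 0 δ := left_mem_uIcc
  have hu : UniqueMDiffWithinAt 𝓘(ℝ, ℝ) (uIcc 0 δ) 0 :=
    (uniqueDiffOn_uIcc hδ.ne 0 h0).uniqueMDiffWithinAt
  have huniq : ∀ {c : ℝ → TotalSpace F V} {u u' : TE EB (c 0)},
      HasMFDerivWithinAt 𝓘(ℝ, ℝ) (𝓘(ℝ, EB).prod 𝓘(ℝ, F)) c (uIcc 0 δ) 0
        ((1 : ℝ →L[ℝ] ℝ).smulRight u) →
      HasMFDerivWithinAt 𝓘(ℝ, ℝ) (𝓘(ℝ, EB).prod 𝓘(ℝ, F)) c (uIcc 0 δ) 0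
        ((1 : ℝ →L[ℝ] ℝ).smulRight u') → u = u' := by
    intro c u u' h1 h2
    have h3 := DFunLike.congr_fun (hu.eq h1 h2) (1 : ℝ)
    exact (one_smul ℝ u).symm.trans (h3.trans (one_smul ℝ u'))
  obtain ⟨z₁, w₁, hz₁, hw₁, p', hp', U, σ, hU, hσ, hD, he₁, he₂⟩ := h 0 h0
  obtain ⟨z₂, w₂, hz₂, hw₂, hh⟩ := h' 0 h0
  obtain rfl : z₁ = z := huniq hz₁ hz.hasMFDerivWithinAt
  obtain rfl : z₂ = z₁ := huniq hz₂ hz₁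
  obtain rfl : γ 0 = p' := congrArg TotalSpace.proj he₁
  have hUz : U (γ 0) = z₂ := by simpa using he₁.symm
  refine ⟨U, σ, hU, hσ, hD, ?_, hUz, (congrArg TotalSpace.proj he₂).symm⟩
  -- `s 0` and `s' 0` are only propositionally equal, but the tangent spaces at both points are
  -- definitionally `EB × F`; `w₂` is reread as tangent at `s 0` to compare velocities.
  have hw₂' : HasMFDerivWithinAt 𝓘(ℝ, ℝ) (𝓘(ℝ, EB).prod 𝓘(ℝ, F)) s (uIcc 0 δ) 0
      ((1 : ℝ →L[ℝ] ℝ).smulRight (show TE EB (s 0) from w₂)) :=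
    hw₂.congr_of_eventuallyEq (eventually_nhdsWithin_of_forall hs) (hs h0)
  have hw : w₁ = w₂ := huniq hw₁ hw₂'
  have he : (⟨s 0, w₁⟩ : TangentBundle (𝓘(ℝ, EB).prod 𝓘(ℝ, F)) (TotalSpace F V)) = ⟨s' 0, w₂⟩ := by
    rw [hw]
    exact tangentBundle_mk_congr (hs h0) w₂
  refine C.linearization_eq_zero_of_mem_horizontalSet hU hσ ?_
  rw [← he₂, ← he₁, he]
  exact hh

variable {C}

/-- Applied to a short line in the fibre, the rule yields a pair on which `D` and the linearization
both vanish at `p`, with arbitrary vertical value of the field and arbitrary value of the section.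
-/
theorem exists_vertical_of_verticalRule (hV : VerticalRule EB Ω D) {p : TotalSpace F V}
    (hp : p ∈ Ω) (b v : V p.proj) :
    ∃ U σ, SmoothField EB Ω U ∧ SmoothSection EB Ω σ ∧ D U σ p = 0 ∧
      C.linearization U σ p = 0 ∧ U p = verticalLift EB p b ∧ σ p = v := by
  set γ : ℝ → TotalSpace F V := fun s ↦ ⟨p.proj, p.2 + s • b⟩ with hγ
  have hγ0 : γ 0 = p := by
    rw [hγ]
    simp only [zero_smul, add_zero]
  have hsm := contMDiff_fiber_line (EB := EB) p b
  obtain ⟨δ, hδ, hΩ⟩ : ∃ δ > (0 : ℝ), ∀ t ∈ uIcc 0 δ, γ t ∈ Ω := by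
    have h1 : ∀ᶠ t in nhds (0 : ℝ), γ t ∈ Ω := by
      refine (hsm.continuous.continuousAt (x := 0)).eventually_mem ?_
      rw [show (⟨p.proj, p.2 + (0 : ℝ) • b⟩ : TotalSpace F V) = p from hγ0]
      exact Ω.isOpen.mem_nhds hp
    obtain ⟨ε, hε, h2⟩ := Metric.eventually_nhds_iff.1 h1
    refine ⟨ε / 2, by linarith, fun t ht ↦ h2 ?_⟩
    rw [uIcc_of_le (by linarith)] at ht
    rw [Real.dist_eq, sub_zero, abs_lt]
    constructor <;> linarith [ht.1, ht.2]
  have hΩ' : ∀ t ∈ uIcc 0 δ, γ t ∈ Ω ∧ (γ t).proj = p.proj := fun t ht ↦ ⟨hΩ t ht, rfl⟩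
  obtain ⟨s, hs, hs0, -⟩ := (hV p.proj γ 0 δ hsm.contMDiffOn hΩ' v ⟨p.proj, v⟩).2 rfl
  -- The rule speaks only of end values; applying it on every subsegment from `0` to `t` determines
  -- the whole section.
  have hconst : EqOn s (fun _ ↦ ⟨p.proj, v⟩) (uIcc 0 δ) := by
    intro t ht
    have hI : uIcc 0 t ⊆ uIcc 0 δ := uIcc_subset_uIcc_left ht
    exact (hV p.proj γ 0 t hsm.contMDiffOn (fun r hr ↦ hΩ' r (hI hr)) v (s t)).1
      ⟨s, hs.mono hI, hs0, rfl⟩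
  obtain ⟨U, σ, hU, hσ, h1, h2, h3, h4⟩ := C.exists_common_horizontal hδ hs
    (C.isParallelAlong_const hsm.contMDiffOn hΩ' v) hconst (hasMFDerivAt_fiber_line p b)
  have h5 : (⟨γ 0, U (γ 0)⟩ : TangentBundle (𝓘(ℝ, EB).prod 𝓘(ℝ, F)) (TotalSpace F V)) =
      ⟨p, verticalLift EB p b⟩ := by
    rw [h3]
    exact tangentBundle_mk_congr hγ0 _
  rw [hs0] at h4
  rw [hγ0] at h1 h2 h4 h5
  exact ⟨U, σ, hU, hσ, h1, h2, by simpa using h5, by simpa [asMap] using h4⟩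

/-- The horizontal counterpart: `x` is extended to a global field on `M`, and the trajectory of its
horizontal lift from `p` replaces the line in the fibre. -/
theorem exists_horizontal_of_horizontalRule [T2Space M] (hH : HorizontalRule C D)
    {p : TotalSpace F V} (hp : p ∈ Ω) (x : TangentSpace 𝓘(ℝ, EB) p.proj) (v : V p.proj) :
    ∃ U σ, SmoothField EB Ω U ∧ SmoothSection EB Ω σ ∧ D U σ p = 0 ∧
      C.linearization U σ p = 0 ∧ U p = C.hlift p x ∧ σ p = v := by
  have hE : CompleteSpace EB := FiniteDimensional.complete ℝ EB
  have hF : CompleteSpace F := FiniteDimensional.complete ℝ F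
  obtain ⟨X, hX, rfl⟩ := exists_contMDiff_field (J := 𝓘(ℝ, EB)) p.proj x
  have hY := C.contMDiffOn_horizontalLift hX
  obtain ⟨ε, hε, W, hW, -⟩ := exists_flow_local hY hp
  have hdom : ∀ t ∈ uIcc 0 (ε / 2), (t, p) ∈ flowDomain Ω (C.horizontalLift X) := by
    intro t ht
    rw [uIcc_of_le (by linarith)] at ht
    refine (hW.self_of_nhds t ?_).1
    rw [abs_lt]
    constructor <;> linarith [ht.1, ht.2]
  have hδ := hdom (ε / 2) right_mem_uIcc
  obtain ⟨a, b, h0, -, -, -, hz, hd⟩ := exists_isMIntegralCurveOn_flow hY hδ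
  obtain ⟨s, hs, hs0, -⟩ := (hH X hX (ε / 2) p hδ v _).2 rfl
  have hψ : EqOn s (C.psiCurve X p v) (uIcc 0 (ε / 2)) := by
    intro t ht
    exact (hH X hX t p (hdom t ht) v (s t)).1 ⟨s, hs.mono (uIcc_subset_uIcc_left ht), hs0, rfl⟩
  obtain ⟨U, σ, hU, hσ, h1, h2, h3, h4⟩ := C.exists_common_horizontal (by linarith) hs
    (C.isParallelAlong_psiCurve hX hδ v) hψ (hd 0 h0)
  have key : ∀ q, q = p → D U σ q = 0 → C.linearization U σ q = 0 → U q = C.horizontalLift X q →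
      asMap σ q = ⟨p.proj, v⟩ → D U σ p = 0 ∧ C.linearization U σ p = 0 ∧
        U p = C.hlift p (X p.proj) ∧ σ p = v := by
    rintro _ rfl h1 h2 h3 h4
    exact ⟨h1, h2, h3, by simpa [asMap] using h4⟩
  exact ⟨U, σ, hU, hσ, key _ hz h1 h2 h3 (h4.trans hs0)⟩

/-- The rules determine the linearization. -/
theorem eq_linearization [T2Space M] (hD : IsCovariantDerivative EB Ω D)
    (hV : VerticalRule EB Ω D) (hH : HorizontalRule C D) {U : (p : TotalSpace F V) → TE EB p}
    (hU : SmoothField EB Ω U) {σ : (p : TotalSpace F V) → V p.proj} (hσ : SmoothSection EB Ω σ)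
    {p : TotalSpace F V} (hp : p ∈ Ω) : D U σ p = C.linearization U σ p := by
  have hL := isCovariantDerivative_linearization C
  obtain ⟨U₁, σ₁, hU₁, hσ₁, hD₁, hL₁, hU₁p, hσ₁p⟩ :=
    exists_vertical_of_verticalRule (C := C) hV hp (C.connector p (U p)) (σ p)
  obtain ⟨U₂, σ₂, hU₂, hσ₂, hD₂, hL₂, hU₂p, hσ₂p⟩ :=
    exists_horizontal_of_horizontalRule hH hp (tproj EB p (U p)) (σ p)
  -- This is the splitting of `U p` into vertical and horizontal parts. On `U₁` and on `U₂` the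
  -- operators agree at `p` for one section with value `σ p`, hence for `σ` by tensoriality of the
  -- difference.
  have hUp : U p = U₁ p + U₂ p := by
    rw [hU₁p, hU₂p, C.verticalLift_connector hp, sub_add_cancel]
  have h₁ := hD.sub_congr_section hL hU₁ hσ hσ₁ hp hσ₁p.symm
  have h₂ := hD.sub_congr_section hL hU₂ hσ hσ₂ hp hσ₂p.symm
  rw [hD₁, hL₁, sub_self] at h₁
  rw [hD₂, hL₂, sub_self] at h₂
  rw [hD.congr_field hU (hU₁.add hU₂) hσ hp hUp, hL.congr_field hU (hU₁.add hU₂) hσ hp hUp,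
    hD.add_field U₁ U₂ σ hU₁ hU₂ hσ p hp, hL.add_field U₁ U₂ σ hU₁ hU₂ hσ p hp,
    sub_eq_zero.1 h₁, sub_eq_zero.1 h₂]

end NonlinearConnection

end Characterization

end EhresmannConnection

theorem mainTheorem2
    {EB : Type*} [NormedAddCommGroup EB] [NormedSpace ℝ EB] [FiniteDimensional ℝ EB]
    {F : Type*} [NormedAddCommGroup F] [NormedSpace ℝ F] [FiniteDimensional ℝ F]
    {M : Type*} [TopologicalSpace M] [T2Space M] [ChartedSpace EB M] [IsManifold 𝓘(ℝ, EB) ∞ M]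
    {V : M → Type*} [∀ x, AddCommGroup (V x)] [∀ x, Module ℝ (V x)]
    [∀ x, TopologicalSpace (V x)] [TopologicalSpace (TotalSpace F V)] [FiberBundle F V]
    [VectorBundle ℝ F V] [ContMDiffVectorBundle ∞ F V 𝓘(ℝ, EB)]
    (Ω : TopologicalSpace.Opens (TotalSpace F V))
    (C : EhresmannConnection.NonlinearConnection EB Ω) :
    EhresmannConnection.IsCovariantDerivative EB Ω C.linearization ∧
    EhresmannConnection.VerticalRule EB Ω C.linearization ∧
    EhresmannConnection.HorizontalRule C C.linearization ∧
    (∀ X : (x : M) → TangentSpace 𝓘(ℝ, EB) x,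
      ContMDiff 𝓘(ℝ, EB) 𝓘(ℝ, EB).tangent ∞ (fun x ↦ (⟨x, X x⟩ : TangentBundle 𝓘(ℝ, EB) M)) →
      ∀ (t : ℝ) (p : TotalSpace F V),
        (t, p) ∈ EhresmannConnection.flowDomain Ω (C.horizontalLift X) →
        ∀ b : V p.proj,
          EhresmannConnection.verticalLift EB
              (EhresmannConnection.flow Ω (C.horizontalLift X) t p) (C.psi X t p b) =
            mfderiv (𝓘(ℝ, EB).prod 𝓘(ℝ, F)) (𝓘(ℝ, EB).prod 𝓘(ℝ, F))
              (EhresmannConnection.flow Ω (C.horizontalLift X) t) p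
              (EhresmannConnection.verticalLift EB p b)) ∧
    ∀ D, EhresmannConnection.IsCovariantDerivative EB Ω D →
      EhresmannConnection.VerticalRule EB Ω D → EhresmannConnection.HorizontalRule C D →
      ∀ U σ, EhresmannConnection.SmoothField EB Ω U → EhresmannConnection.SmoothSection EB Ω σ →
        ∀ p ∈ Ω, D U σ p = C.linearization U σ p := by
  have hT : T2Space (TotalSpace F V) := EhresmannConnection.t2Space_totalSpace
  exact ⟨EhresmannConnection.isCovariantDerivative_linearization C,
    C.verticalRule_linearization, C.horizontalRule_linearization,
    fun X hX t p ht b ↦ C.verticalLift_psi hX ht b,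
    fun D hD hV hH U σ hU hσ p hp ↦
      EhresmannConnection.NonlinearConnection.eq_linearization hD hV hH hU hσ hp⟩
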